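/- **Setting.** Let $\Lambda$ be a complete Noetherian local ring with residue field $k$, and let $\mathcal C_\Lambda$ be the category of Artinian local $\Lambda$-algebras with residue field $k$. A functor $F:\mathcal C_\Lambda\to\mathrm{Set}$ is *smooth* if $F(A)\to F(A')$ is surjective for every surjection $A\to A'$, and *homogeneous* if $F(B\times_AC)\to F(B)\times_{F(A)}F(C)$ is bijective whenever $B\to A$ is surjective. Functors $\mathcal C_\Lambda\to\mathrm{Cat}$, transformations between them, and equalities between composites of such transformations are understood up to coherent canonical isomorphism (pseudofunctors, pseudonatural transformations, invertible modifications). *Fibres.* For $\mathcal D:\mathcal C_\Lambda\to\mathrm{Cat}$ and $D\in\mathrm{Ob}\,\mathcal D(k)$, let $\mathrm{Def}_{\mathcal D,D}(A)$ be the fibre of $\mathcal D(A)\to\mathcal D(k)$ over $(D,\mathrm{id})$: objects are pairs of an object $X$ of $\mathcal D(A)$ and an isomorphism $x:X_k\cong D$, where $X_k$ is the base change of $X$ to $k$; morphisms $(X,x)\to(Y,y)$ are the $\varphi:X\to Y$ with $y\circ\varphi_k=x$. *Uniform triviality.* $\mathcal B:\mathcal C_\Lambda\to\mathrm{Cat}$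 has *uniformly trivial deformation theory* if for every surjection $A\to A'$ the functor $\mathcal B(A)\to\mathcal B(A')$ is full and essentially surjective, and morphisms are homogeneous: for $B\to A$ surjective and $X,Y\in\mathcal B(B\times_AC)$, the map $\mathrm{Hom}(X,Y)\to\mathrm{Hom}(X_B,Y_B)\times_{\mathrm{Hom}(X_A,Y_A)}\mathrm{Hom}(X_C,Y_C)$ is bijective. An object of $\mathcal B(\Lambda)$ is a family of objects $B_A\in\mathcal B(A)$, $A\in\mathcal C_\Lambda$, with compatible base change isomorphisms; a *lift* of $X\in\mathcal B(k)$ to $\mathcal B(\Lambda)$ is such a family with an isomorphism $B_k\cong X$. *SDCs.* A *simplicial deformation complex* (SDC) consists of smooth homogeneous functors $E^n:\mathcal C_\Lambda\to\mathrm{Set}$ ($n\ge0$) with $E^n(k)$ a point, natural maps $\partial^i:E^n\to E^{n+1}$ ($1\le i\le n$) and $\sigma^i:E^n\to E^{n-1}$ ($0\le i<n$), and a natural associative product $*:E^m\times E^n\to E^{m+n}$ with identity $1\in E^0$, such that - $\partial^j\partial^i=\partial^i\partial^{j-1}$ for $i<j$, and $\sigma^j\sigma^i=\sigma^i\sigma^{j+1}$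 for $i\le j$; - $\sigma^j\partial^i=\partial^i\sigma^{j-1}$ for $i<j$, $\sigma^j\partial^i=\mathrm{id}$ for $i\in\{j,j+1\}$, and $\sigma^j\partial^i=\partial^{i-1}\sigma^j$ for $i>j+1$; - for $e\in E^m$: $\partial^i(e)*f=\partial^i(e*f)$, $e*\partial^i(f)=\partial^{i+m}(e*f)$, $\sigma^i(e)*f=\sigma^i(e*f)$, $e*\sigma^i(f)=\sigma^{i+m}(e*f)$. Its deformation groupoid $\mathrm{Def}_E(A)$ has as objects the $\omega\in E^1(A)$ with $\omega*\omega=\partial^1(\omega)$, and as morphisms $\omega\to\omega'$ the $g\in E^0(A)$ with $g*\omega=\omega'*g$. **Data.** Let $\mathcal D,\mathcal E,\mathcal A,\mathcal B:\mathcal C_\Lambda\to\mathrm{Cat}$, where $\mathcal B$ has uniformly trivial deformation theory. Suppose given adjunctions, compatible with base change, $$F\dashv U:\mathcal D\rightleftarrows\mathcal E,\qquad F\dashv U:\mathcal A\rightleftarrows\mathcal B,\qquad V\dashv G:\mathcal D\rightleftarrows\mathcal A,\qquad V\dashv G:\mathcal E\rightleftarrows\mathcal B,$$ with $U:\mathcal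 D\to\mathcal E$, $U:\mathcal A\to\mathcal B$, $V:\mathcal D\to\mathcal A$, $V:\mathcal E\to\mathcal B$. Over every $A\in\mathcal C_\Lambda$ the adjunctions $F\dashv U$ are monadic and the adjunctions $V\dashv G$ are comonadic (the comparison functors to (co)algebras are equivalences). Put $\top_h=UF$ and $\bot_v=VG$ (on $\mathcal B$), $\bot_h=FU$ and $\top_v=GV$ (on $\mathcal D$), with $\eta:1\to\top_h$, $\gamma:\bot_v\to1$, $\varepsilon:\bot_h\to1$, $\alpha:1\to\top_v$ the units and counits (the same letters are used for all the adjunctions). Assume that the following identities hold: 1. $FV=VF$ (equivalently $GU=UG$, by passing to right adjoints), 2. $UV=VU$, 3. $V\varepsilon=\varepsilon V$ or $U\alpha=\alpha U$, 4. $V\eta=\eta V$ or $U\gamma=\gamma U$. Let $\rho_B=\varepsilon_{GFB}\circ FG\eta_B:FGB\to GFB$ and $\delta=UV(\rho):\top_h\bot_v\to\bot_v\top_h$. Let $\delta^{m,n}:\top_h^m\bot_v^n\to\bot_v^n\top_h^m$, $\varepsilon^n:\bot_h^n\to1$ and $\alpha^n:1\to\top_v^n$ be the canonical maps obtained by composing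 $\delta$'s, $\varepsilon$'s and $\alpha$'s. **Theorem.** Let $D\in\mathrm{Ob}\,\mathcal D(k)$. Then a lift $B$ of $UVD\in\mathcal B(k)$ to $\mathcal B(\Lambda)$ exists, and any two lifts are isomorphic (by an isomorphism compatible with the identifications over $k$). For every lift $B$ and $n\ge0$, set $$E^n(A)=\{g\in\mathrm{Hom}_{\mathcal B(A)}(\top_h^nB,\bot_v^nB)\;:\;g_k=UV(\alpha^n_D\circ\varepsilon^n_D)\}.$$ With the operations $$g*h=\bot_v^n(g)\circ\delta^{m,n}\circ\top_h^m(h)\qquad(g\in E^m,\ h\in E^n),$$ $$\partial^i(g)=\bot_v^{n-i}V\alpha_{G\bot_v^{i-1}B}\circ g\circ\top_h^{i-1}U\varepsilon_{F\top_h^{n-i}B}\qquad(g\in E^n,\ 1\le i\le n),$$ $$\sigma^i(g)=\bot_v^{n-i-1}\gamma_{\bot_v^{i}B}\circ g\circ\top_h^{i}\eta_{\top_h^{n-i-1}B}\qquad(g\in E^n,\ 0\le i<n),$$ and with $\mathrm{id}_B\in E^0$ as identity, $E^*$ is an SDC. The categories $\mathrm{Def}_{\mathcal D,D}(A)$ and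 $\mathrm{Def}_E(A)$ are groupoids for all $A\in\mathcal C_\Lambda$, and there is an equivalence $$\mathrm{Def}_{\mathcal D,D}\simeq\mathrm{Def}_E$$ of functors on $\mathcal C_\Lambda$, that is, a transformation which is an equivalence of groupoids at every $A$. -/

import Mathlib

open CategoryTheory Bicategory
open scoped CategoryTheory.Pseudofunctor.StrongTrans

universe u v w

namespace SimplicialDeformation

set_option linter.unusedSectionVars false
set_option linter.checkUnivs false

noncomputable section

section ArtinianAlgebras

variable (Λ : Type u) [CommRing Λ] [IsLocalRing Λ]

/-- Artinian local `Λ`-algebras with the same residue field as `Λ`. The last condition says that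
`Λ` surjects onto the residue field; it then induces an isomorphism of residue fields, so the
structure map is automatically local. -/
structure ArtAlg where
  carrier : Type u
  [commRing : CommRing carrier]
  [algebra : Algebra Λ carrier]
  [isLocalRing : IsLocalRing carrier]
  [isArtinianRing : IsArtinianRing carrier]
  residue_surjective :
    Function.Surjective (algebraMap Λ (IsLocalRing.ResidueField carrier))

attribute [instance] ArtAlg.commRing ArtAlg.algebra ArtAlg.isLocalRing ArtAlg.isArtinianRing

variable {Λ}

namespace ArtAlg

/-- Morphisms are `Λ`-algebra homomorphisms (automatically local). -/
@[ext]
structure Hom (A A' : ArtAlg Λ) where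
  hom : A.carrier →ₐ[Λ] A'.carrier

instance : Category (ArtAlg Λ) where
  Hom := Hom
  id A := ⟨AlgHom.id Λ A.carrier⟩
  comp f g := ⟨g.hom.comp f.hom⟩

@[ext]
theorem hom_ext {A A' : ArtAlg Λ} {f g : A ⟶ A'} (h : f.hom = g.hom) : f = g := Hom.ext h

@[simp] theorem id_hom (A : ArtAlg Λ) : Hom.hom (𝟙 A) = AlgHom.id Λ A.carrier := rfl

@[simp] theorem comp_hom {A A' A'' : ArtAlg Λ} (f : A ⟶ A') (g : A' ⟶ A'') :
    Hom.hom (f ≫ g) = g.hom.comp f.hom := rfl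

variable (Λ) in
/-- The residue field `k`, as an object of the category. -/
def k : ArtAlg Λ where
  carrier := IsLocalRing.ResidueField Λ
  residue_surjective := by
    have h : (algebraMap Λ (IsLocalRing.ResidueField (IsLocalRing.ResidueField Λ)))
        = (IsLocalRing.residue (IsLocalRing.ResidueField Λ)).comp (IsLocalRing.residue Λ) := rfl
    rw [h]
    exact (IsLocalRing.residue_surjective).comp IsLocalRing.residue_surjective

theorem ker_eq (A : ArtAlg Λ) :
    RingHom.ker (Algebra.ofId Λ (IsLocalRing.ResidueField A.carrier))
      = IsLocalRing.maximalIdeal Λ :=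
  IsLocalRing.eq_maximalIdeal (RingHom.ker_isMaximal_of_surjective _ A.residue_surjective)

/-- The canonical map `A → k`. -/
noncomputable def toK (A : ArtAlg Λ) : A ⟶ k Λ where
  hom :=
    (((Ideal.quotientEquivAlgOfEq Λ A.ker_eq).symm.trans
      (Ideal.quotientKerAlgEquivOfSurjective
        (f := Algebra.ofId Λ (IsLocalRing.ResidueField A.carrier))
        A.residue_surjective)).symm.toAlgHom).comp
      (IsScalarTower.toAlgHom Λ A.carrier (IsLocalRing.ResidueField A.carrier))

instance (A : ArtAlg Λ) : Subsingleton (A ⟶ k Λ) where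
  allEq f g := by
    have key : ∀ (f : A ⟶ k Λ) (m : A.carrier), m ∈ IsLocalRing.maximalIdeal A.carrier →
        f.hom m = 0 := by
      intro f m hm
      have hn : IsNilpotent m := by
        obtain ⟨n, hn⟩ := IsArtinianRing.isNilpotent_jacobson_bot (R := A.carrier)
        rw [IsLocalRing.jacobson_eq_maximalIdeal _ bot_ne_top] at hn
        refine ⟨n, ?_⟩
        have := Ideal.pow_mem_pow hm n
        rw [hn] at this
        exact this
      have h0 : IsNilpotent (f.hom m) := hn.map f.hom
      have : IsReduced (k Λ).carrier := inferInstanceAs (IsReduced (IsLocalRing.ResidueField Λ))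
      exact h0.eq_zero
    ext a
    obtain ⟨l, hl⟩ := A.residue_surjective (IsLocalRing.residue _ a)
    have hm : a - algebraMap Λ A.carrier l ∈ IsLocalRing.maximalIdeal A.carrier := by
      rw [← IsLocalRing.residue_eq_zero_iff, map_sub, ← hl]
      exact sub_self _
    have h1 := key f _ hm
    have h2 := key g _ hm
    rw [map_sub, AlgHom.commutes, sub_eq_zero] at h1 h2
    rw [h1, h2]

/-- Surjective morphisms. -/
def Surj {A A' : ArtAlg Λ} (f : A ⟶ A') : Prop := Function.Surjective f.hom

/-- `P`, with the projections `p` and `q`, is the fibre product `B ×_A C` of `f` and `g`. -/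
structure IsFibreProduct {P B C A : ArtAlg Λ} (p : P ⟶ B) (q : P ⟶ C) (f : B ⟶ A) (g : C ⟶ A) :
    Prop where
  w : p ≫ f = q ≫ g
  existsUnique : ∀ (b : B.carrier) (c : C.carrier), f.hom b = g.hom c →
    ∃! x : P.carrier, p.hom x = b ∧ q.hom x = c

end ArtAlg

end ArtinianAlgebras

section CatValued

variable {Λ : Type u} [CommRing Λ] [IsLocalRing Λ]

variable (Λ) in
/-- Category-valued functors on Artinian algebras. Functoriality, and naturality of transformations
between such functors, hold up to coherent canonical isomorphism. -/
abbrev CatFunctor := LocallyDiscrete (ArtAlg Λ) ⥤ᵖ Cat.{v, w}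

/-- The category `𝓑(A)`. -/
abbrev CatFunctor.at (𝓑 : CatFunctor.{u, v, w} Λ) (A : ArtAlg Λ) : Type w := 𝓑.obj ⟨A⟩

/-- The base change functor `𝓑(A) → 𝓑(A')`. -/
abbrev CatFunctor.bc (𝓑 : CatFunctor.{u, v, w} Λ) {A A' : ArtAlg Λ} (f : A ⟶ A') :
    𝓑.at A ⥤ 𝓑.at A' := (𝓑.map f.toLoc).toFunctor

def CatFunctor.bcId (𝓑 : CatFunctor.{u, v, w} Λ) (A : ArtAlg Λ) : 𝓑.bc (𝟙 A) ≅ 𝟭 (𝓑.at A) :=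
  Cat.Hom.toNatIso (𝓑.mapId ⟨A⟩)

/-- The canonical isomorphism between base change along `h` and along `f`, then `g`, if `h = gf`. -/
def CatFunctor.bcComp (𝓑 : CatFunctor.{u, v, w} Λ) {A A' A'' : ArtAlg Λ} (f : A ⟶ A')
    (g : A' ⟶ A'') (h : A ⟶ A'') (e : f ≫ g = h) : 𝓑.bc h ≅ 𝓑.bc f ⋙ 𝓑.bc g :=
  Cat.Hom.toNatIso (𝓑.mapComp' f.toLoc g.toLoc h.toLoc (by subst e; rfl))

namespace CatFunctor
variable (𝓑 : CatFunctor.{u, v, w} Λ)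

theorem bcComp_assoc {A₀ A₁ A₂ A₃ : ArtAlg Λ} (f₀₁ : A₀ ⟶ A₁) (f₁₂ : A₁ ⟶ A₂) (f₂₃ : A₂ ⟶ A₃)
    (f₀₂ : A₀ ⟶ A₂) (f₁₃ : A₁ ⟶ A₃) (f : A₀ ⟶ A₃) (h₀₂ : f₀₁ ≫ f₁₂ = f₀₂)
    (h₁₃ : f₁₂ ≫ f₂₃ = f₁₃) (hf : f₀₁ ≫ f₁₃ = f) (hf' : f₀₂ ≫ f₂₃ = f) (X : 𝓑.at A₀) :
    (𝓑.bcComp f₀₁ f₁₃ f hf).hom.app X ≫ (𝓑.bcComp f₁₂ f₂₃ f₁₃ h₁₃).hom.app ((𝓑.bc f₀₁).obj X) =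
      (𝓑.bcComp f₀₂ f₂₃ f hf').hom.app X ≫
        (𝓑.bc f₂₃).map ((𝓑.bcComp f₀₁ f₁₂ f₀₂ h₀₂).hom.app X) := by
  subst h₀₂ h₁₃ hf
  have := 𝓑.mapComp'₀₁₃_hom_comp_whiskerLeft_mapComp'_hom f₀₁.toLoc f₁₂.toLoc f₂₃.toLoc
    (f₀₁ ≫ f₁₂).toLoc (f₁₂ ≫ f₂₃).toLoc (f₀₁ ≫ f₁₂ ≫ f₂₃).toLoc rfl rfl rfl
  have := congr($(this).toNatTrans.app X)
  simp at this
  exact this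

theorem bcComp_id_right {A A' : ArtAlg Λ} (f : A ⟶ A') (h : f ≫ 𝟙 A' = f) (X : 𝓑.at A) :
    (𝓑.bcComp f (𝟙 A') f h).hom.app X = (𝓑.bcId A').inv.app ((𝓑.bc f).obj X) := by
  have := 𝓑.mapComp'_comp_id_hom f.toLoc
  have := congr($(this).toNatTrans.app X)
  simp at this
  exact this

theorem bcComp_id_left {A A' : ArtAlg Λ} (f : A ⟶ A') (h : 𝟙 A ≫ f = f) (X : 𝓑.at A) :
    (𝓑.bcComp (𝟙 A) f f h).hom.app X = (𝓑.bc f).map ((𝓑.bcId A).inv.app X) := by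
  have := 𝓑.mapComp'_id_comp_hom f.toLoc
  have := congr($(this).toNatTrans.app X)
  simp at this
  exact this

end CatFunctor

end CatValued


section Squares

universe v₁ v₂ v₃ v₄ u₁ u₂ u₃ u₄

section Iterates
variable {C : Type u₁} [Category.{v₁} C]

/-- The iterates `Tⁿ` of an endofunctor. -/
def iter (T : C ⥤ C) : ℕ → (C ⥤ C)
  | 0 => 𝟭 C
  | n + 1 => iter T n ⋙ T

theorem iter_iter (T : C ⥤ C) {m n p : ℕ} (h : m + n = p) : iter T n ⋙ iter T m = iter T p := by
  subst h
  induction m with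
  | zero => rw [Nat.zero_add]; rfl
  | succ m ih => rw [Nat.succ_add]; exact congrArg (· ⋙ T) ih

/-- The identification `Tᵐ(Tⁿ X) = Tᵐ⁺ⁿ X`. -/
def iterIso (T : C ⥤ C) {m n p : ℕ} (h : m + n = p) (X : C) :
    (iter T m).obj ((iter T n).obj X) ≅ (iter T p).obj X :=
  (eqToIso (iter_iter T h)).app X

/-- The canonical map `Tⁿ → id` obtained from `e : T → id`; it is `e ∘ Te ∘ ⋯ ∘ Tⁿ⁻¹e`. -/
def iterToId {T : C ⥤ C} (e : T ⟶ 𝟭 C) : (n : ℕ) → (X : C) → ((iter T n).obj X ⟶ X)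
  | 0, X => 𝟙 X
  | n + 1, X => T.map (iterToId e n X) ≫ e.app X

/-- The canonical map `id → Tⁿ` obtained from `a : id → T`; it is `Tⁿ⁻¹a ∘ ⋯ ∘ Ta ∘ a`. -/
def iterOfId {T : C ⥤ C} (a : 𝟭 C ⟶ T) : (n : ℕ) → (X : C) → (X ⟶ (iter T n).obj X)
  | 0, X => 𝟙 X
  | n + 1, X => a.app X ≫ T.map (iterOfId a n X)

/-- `δᵐⁿ : TᵐLⁿ → LⁿTᵐ`, obtained from `d : TL → LT`; first for `m = 1`. -/
def iterSwapOne {T L : C ⥤ C} (d : L ⋙ T ⟶ T ⋙ L) :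
    (n : ℕ) → (X : C) → (T.obj ((iter L n).obj X) ⟶ (iter L n).obj (T.obj X))
  | 0, X => 𝟙 (T.obj X)
  | n + 1, X => d.app ((iter L n).obj X) ≫ L.map (iterSwapOne d n X)

/-- `δᵐⁿ : TᵐLⁿ → LⁿTᵐ`, obtained from `d : TL → LT`. -/
def iterSwap {T L : C ⥤ C} (d : L ⋙ T ⟶ T ⋙ L) :
    (m n : ℕ) → (X : C) → ((iter T m).obj ((iter L n).obj X) ⟶ (iter L n).obj ((iter T m).obj X))
  | 0, n, X => 𝟙 ((iter L n).obj X)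
  | m + 1, n, X => T.map (iterSwap d m n X) ≫ iterSwapOne d n ((iter T m).obj X)

end Iterates

variable {D : Type u₁} {E : Type u₂} {A : Type u₃} {B : Type u₄}
  [Category.{v₁} D] [Category.{v₂} E] [Category.{v₃} A] [Category.{v₄} B]

variable (D E A B) in
/-- A square of adjunctions
```
        U₁
    D ⇄ E        F₁ ⊣ U₁,  F₀ ⊣ U₀,
 V₁ ⇅   ⇅ V₀     V₁ ⊣ G₁,  V₀ ⊣ G₀
    A ⇄ B
        U₀
```
with `UV ≅ VU` and `FV ≅ VF`. -/
structure AdjSquare where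
  {U₁ : D ⥤ E}
  {F₁ : E ⥤ D}
  {U₀ : A ⥤ B}
  {F₀ : B ⥤ A}
  {V₁ : D ⥤ A}
  {G₁ : A ⥤ D}
  {V₀ : E ⥤ B}
  {G₀ : B ⥤ E}
  adjFU₁ : F₁ ⊣ U₁
  adjFU₀ : F₀ ⊣ U₀
  adjVG₁ : V₁ ⊣ G₁
  adjVG₀ : V₀ ⊣ G₀
  isoUV : V₁ ⋙ U₀ ≅ U₁ ⋙ V₀
  isoFV : V₀ ⋙ F₀ ≅ F₁ ⋙ V₁

namespace AdjSquare
variable (S : AdjSquare D E A B)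

/-- The isomorphism `UG ≅ GU` of right adjoints corresponding to the isomorphism `FV ≅ VF` of their
left adjoints. -/
def isoGU : S.G₁ ⋙ S.U₁ ≅ S.U₀ ⋙ S.G₀ :=
  conjugateIsoEquiv (S.adjFU₁.comp S.adjVG₁) (S.adjVG₀.comp S.adjFU₀) S.isoFV

/-- The compatibility of the adjunctions with the isomorphisms `UV ≅ VU`, `FV ≅ VF`, `GU ≅ UG`. -/
structure IsCompatible : Prop where
  /-- `Vε = εV` or `Uα = αU` -/
  counit :
    (∀ X : D, S.F₀.map (S.isoUV.hom.app X) ≫ S.isoFV.hom.app (S.U₁.obj X) ≫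
        S.V₁.map (S.adjFU₁.counit.app X) = S.adjFU₀.counit.app (S.V₁.obj X)) ∨
    (∀ X : D, S.U₁.map (S.adjVG₁.unit.app X) ≫ S.isoGU.hom.app (S.V₁.obj X) ≫
        S.G₀.map (S.isoUV.hom.app X) = S.adjVG₀.unit.app (S.U₁.obj X))
  /-- `Vη = ηV` or `Uγ = γU` -/
  unit :
    (∀ X : E, S.adjFU₀.unit.app (S.V₀.obj X) ≫ S.U₀.map (S.isoFV.hom.app X) ≫
        S.isoUV.hom.app (S.F₁.obj X) = S.V₀.map (S.adjFU₁.unit.app X)) ∨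
    (∀ X : A, S.isoUV.hom.app (S.G₁.obj X) ≫ S.V₀.map (S.isoGU.hom.app X) ≫
        S.adjVG₀.counit.app (S.U₀.obj X) = S.U₀.map (S.adjVG₁.counit.app X))

/-- The monad `⊤ₕ = UF` on `B`. -/
abbrev T : B ⥤ B := S.F₀ ⋙ S.U₀

/-- The comonad `⊥ᵥ = VG` on `B`. -/
abbrev L : B ⥤ B := S.G₀ ⋙ S.V₀

/-- The forgetful functor `UV : D ⥤ B`. -/
abbrev UV : D ⥤ B := S.V₁ ⋙ S.U₀

/-- `ρ_X = ε_{GFX} ∘ FG η_X : FGX → GFX`. -/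
def rho (X : B) : S.F₁.obj (S.G₀.obj X) ⟶ S.G₁.obj (S.F₀.obj X) :=
  S.F₁.map (S.G₀.map (S.adjFU₀.unit.app X)) ≫
    S.F₁.map (S.isoGU.inv.app (S.F₀.obj X)) ≫
    S.adjFU₁.counit.app (S.G₁.obj (S.F₀.obj X))

/-- `δ_X = UV(ρ_X)`, regarded as a map `⊤ₕ⊥ᵥX → ⊥ᵥ⊤ₕX`. -/
def deltaApp (X : B) : S.T.obj (S.L.obj X) ⟶ S.L.obj (S.T.obj X) :=
  S.U₀.map (S.isoFV.hom.app (S.G₀.obj X)) ≫ S.UV.map (S.rho X) ≫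
    S.isoUV.hom.app (S.G₁.obj (S.F₀.obj X)) ≫ S.V₀.map (S.isoGU.hom.app (S.F₀.obj X))

/-- The natural transformation `δ : ⊤ₕ⊥ᵥ → ⊥ᵥ⊤ₕ`. -/
def delta : S.L ⋙ S.T ⟶ S.T ⋙ S.L where
  app := S.deltaApp
  naturality X Y f := by
    have h1 := S.isoFV.hom.naturality (S.G₀.map f)
    have h2 := S.isoUV.hom.naturality (S.G₁.map (S.F₀.map f))
    have h3 := S.isoGU.hom.naturality (S.F₀.map f)
    have h3' := S.isoGU.inv.naturality (S.F₀.map f)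
    have h4 := S.adjFU₁.counit.naturality (S.G₁.map (S.F₀.map f))
    have h5 := S.adjFU₀.unit.naturality f
    have hr : S.F₁.map (S.G₀.map f) ≫ S.rho Y = S.rho X ≫ S.G₁.map (S.F₀.map f) := by
      dsimp [rho] at *
      rw [← Functor.map_comp_assoc, ← S.G₀.map_comp, h5]
      simp only [Functor.map_comp, Category.assoc]
      rw [← S.F₁.map_comp_assoc (S.G₀.map (S.U₀.map _)), h3']
      simp only [Functor.map_comp, Category.assoc, h4]
    dsimp [deltaApp] at *
    rw [← S.U₀.map_comp_assoc, h1]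
    simp only [Functor.map_comp, Category.assoc]
    rw [← S.U₀.map_comp_assoc (S.V₁.map _), ← S.V₁.map_comp, hr]
    simp only [Functor.map_comp, Category.assoc]
    rw [reassoc_of% h2, ← S.V₀.map_comp, ← S.V₀.map_comp, h3]

/-- `⊤ₕ(UV X) ≅ UV(⊥ₕ X)`, where `⊥ₕ = FU` on `D`. -/
def hStep (X : D) : S.T.obj (S.UV.obj X) ≅ S.UV.obj (S.F₁.obj (S.U₁.obj X)) :=
  S.U₀.mapIso (S.F₀.mapIso (S.isoUV.app X) ≪≫ S.isoFV.app (S.U₁.obj X))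

/-- `⊤ₕⁿ(UV X) ≅ UV(⊥ₕⁿ X)`. -/
def hIso : (n : ℕ) → (X : D) →
    ((iter S.T n).obj (S.UV.obj X) ≅ S.UV.obj ((iter (S.U₁ ⋙ S.F₁) n).obj X))
  | 0, X => Iso.refl (S.UV.obj X)
  | n + 1, X => S.T.mapIso (hIso n X) ≪≫ S.hStep ((iter (S.U₁ ⋙ S.F₁) n).obj X)

/-- `UV(⊤ᵥ X) ≅ ⊥ᵥ(UV X)`, where `⊤ᵥ = GV` on `D`. -/
def vStep (X : D) : S.UV.obj (S.G₁.obj (S.V₁.obj X)) ≅ S.L.obj (S.UV.obj X) :=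
  S.isoUV.app (S.G₁.obj (S.V₁.obj X)) ≪≫ S.V₀.mapIso (S.isoGU.app (S.V₁.obj X))

/-- `UV(⊤ᵥⁿ X) ≅ ⊥ᵥⁿ(UV X)`. -/
def vIso : (n : ℕ) → (X : D) →
    (S.UV.obj ((iter (S.V₁ ⋙ S.G₁) n).obj X) ≅ (iter S.L n).obj (S.UV.obj X))
  | 0, X => Iso.refl (S.UV.obj X)
  | n + 1, X => S.vStep ((iter (S.V₁ ⋙ S.G₁) n).obj X) ≪≫ S.L.mapIso (vIso n X)

/-- The map `UV(αⁿ_X ∘ εⁿ_X)`, regarded as a map `⊤ₕⁿ(UV X) → ⊥ᵥⁿ(UV X)`. -/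
def canonicalMap (n : ℕ) (X : D) :
    (iter S.T n).obj (S.UV.obj X) ⟶ (iter S.L n).obj (S.UV.obj X) :=
  (S.hIso n X).hom ≫
    S.UV.map (iterToId S.adjFU₁.counit n X ≫ iterOfId S.adjVG₁.unit n X) ≫ (S.vIso n X).hom

/-- The product `g * h = ⊥ᵥⁿ(g) ∘ δᵐⁿ ∘ ⊤ₕᵐ(h)`. -/
def prodMap {m n p : ℕ} (e : m + n = p) {X : B} (g : (iter S.T m).obj X ⟶ (iter S.L m).obj X)
    (h : (iter S.T n).obj X ⟶ (iter S.L n).obj X) : (iter S.T p).obj X ⟶ (iter S.L p).obj X :=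
  (iterIso S.T e X).inv ≫ (iter S.T m).map h ≫ iterSwap S.delta m n X ≫ (iter S.L n).map g ≫
    (iterIso S.L ((Nat.add_comm n m).trans e) X).hom

/-- `∂ⁱ(g) = ⊥ᵥⁿ⁻ⁱ Vα_{G⊥ᵥⁱ⁻¹X} ∘ g ∘ ⊤ₕⁱ⁻¹ Uε_{F⊤ₕⁿ⁻ⁱX}` for `1 ≤ i ≤ n`. -/
def faceMap {n : ℕ} (i : ℕ) (hi : 1 ≤ i) (hn : i ≤ n) {X : B}
    (g : (iter S.T n).obj X ⟶ (iter S.L n).obj X) :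
    (iter S.T (n + 1)).obj X ⟶ (iter S.L (n + 1)).obj X :=
  (iterIso S.T (show (i - 1) + ((n - i) + 2) = n + 1 by omega) X).inv ≫
    (iter S.T (i - 1)).map (S.U₀.map (S.adjFU₀.counit.app (S.F₀.obj ((iter S.T (n - i)).obj X)))) ≫
    (iterIso S.T (show (i - 1) + ((n - i) + 1) = n by omega) X).hom ≫
    g ≫
    (iterIso S.L (show (n - i) + ((i - 1) + 1) = n by omega) X).inv ≫
    (iter S.L (n - i)).map (S.V₀.map (S.adjVG₀.unit.app (S.G₀.obj ((iter S.L (i - 1)).obj X)))) ≫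
    (iterIso S.L (show (n - i) + ((i - 1) + 2) = n + 1 by omega) X).hom

/-- `σⁱ(g) = ⊥ᵥⁿ⁻ⁱ γ_{⊥ᵥⁱX} ∘ g ∘ ⊤ₕⁱ η_{⊤ₕⁿ⁻ⁱX}` for `0 ≤ i ≤ n` and `g` of degree `n + 1`. -/
def degenMap {n : ℕ} (i : ℕ) (hn : i ≤ n) {X : B}
    (g : (iter S.T (n + 1)).obj X ⟶ (iter S.L (n + 1)).obj X) :
    (iter S.T n).obj X ⟶ (iter S.L n).obj X :=
  (iterIso S.T (show i + (n - i) = n by omega) X).inv ≫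
    (iter S.T i).map (S.adjFU₀.unit.app ((iter S.T (n - i)).obj X)) ≫
    (iterIso S.T (show i + ((n - i) + 1) = n + 1 by omega) X).hom ≫
    g ≫
    (iterIso S.L (show (n - i) + (i + 1) = n + 1 by omega) X).inv ≫
    (iter S.L (n - i)).map (S.adjVG₀.counit.app ((iter S.L i).obj X)) ≫
    (iterIso S.L (show (n - i) + i = n by omega) X).hom

end AdjSquare

end Squares

section Complexes

variable {Λ : Type u} [CommRing Λ] [IsLocalRing Λ]

open ArtAlg

/-- `F` is smooth: surjections induce surjections. -/
def IsSmooth (F : ArtAlg Λ ⥤ Type v) : Prop :=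
  ∀ ⦃A A' : ArtAlg Λ⦄ (f : A ⟶ A'), Surj f → Function.Surjective (F.map f)

/-- `F` is homogeneous: `F(B ×_A C) → F(B) ×_{F(A)} F(C)` is bijective whenever `B → A` is
surjective. -/
def IsHomogeneous (F : ArtAlg Λ ⥤ Type v) : Prop :=
  ∀ ⦃P B C A : ArtAlg Λ⦄ (p : P ⟶ B) (q : P ⟶ C) (f : B ⟶ A) (g : C ⟶ A),
    IsFibreProduct p q f g → Surj f → ∀ (b : F.obj B) (c : F.obj C), F.map f b = F.map g c →
      ∃! x : F.obj P, F.map p x = b ∧ F.map q x = c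

/-- The structure of a simplicial deformation complex on a sequence of set-valued functors. -/
structure SDC (E : ℕ → ArtAlg Λ ⥤ Type v) where
  /-- `Eⁿ(k)` is a one-point set. -/
  point : ∀ n, ∃! _x : (E n).obj (k Λ), True
  smooth : ∀ n, IsSmooth (E n)
  homogeneous : ∀ n, IsHomogeneous (E n)
  /-- `∂ⁱ : Eⁿ → Eⁿ⁺¹`, for `1 ≤ i ≤ n` -/
  face {n : ℕ} (i : ℕ) (hi : 1 ≤ i) (hn : i ≤ n) {A : ArtAlg Λ} : (E n).obj A → (E (n + 1)).obj A
  /-- `σⁱ : Eⁿ⁺¹ → Eⁿ`, for `0 ≤ i < n + 1` -/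
  degen {n : ℕ} (i : ℕ) (hn : i ≤ n) {A : ArtAlg Λ} : (E (n + 1)).obj A → (E n).obj A
  /-- `* : Eᵐ × Eⁿ → Eᵐ⁺ⁿ` -/
  mul {m n p : ℕ} (h : m + n = p) {A : ArtAlg Λ} : (E m).obj A → (E n).obj A → (E p).obj A
  one (A : ArtAlg Λ) : (E 0).obj A
  map_face {n : ℕ} (i : ℕ) (hi : 1 ≤ i) (hn : i ≤ n) {A A' : ArtAlg Λ} (f : A ⟶ A')
    (x : (E n).obj A) : (E (n + 1)).map f (face i hi hn x) = face i hi hn ((E n).map f x)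
  map_degen {n : ℕ} (i : ℕ) (hn : i ≤ n) {A A' : ArtAlg Λ} (f : A ⟶ A')
    (x : (E (n + 1)).obj A) : (E n).map f (degen i hn x) = degen i hn ((E (n + 1)).map f x)
  map_mul {m n p : ℕ} (h : m + n = p) {A A' : ArtAlg Λ} (f : A ⟶ A') (x : (E m).obj A)
    (y : (E n).obj A) : (E p).map f (mul h x y) = mul h ((E m).map f x) ((E n).map f y)
  map_one {A A' : ArtAlg Λ} (f : A ⟶ A') : (E 0).map f (one A) = one A'
  mul_assoc {l m n a b p : ℕ} (h₁ : l + m = a) (h₂ : a + n = p) (h₃ : m + n = b) (h₄ : l + b = p)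
    {A : ArtAlg Λ} (x : (E l).obj A) (y : (E m).obj A) (z : (E n).obj A) :
    mul h₂ (mul h₁ x y) z = mul h₄ x (mul h₃ y z)
  one_mul {n : ℕ} {A : ArtAlg Λ} (x : (E n).obj A) : mul (Nat.zero_add n) (one A) x = x
  mul_one {n : ℕ} {A : ArtAlg Λ} (x : (E n).obj A) : mul (Nat.add_zero n) x (one A) = x
  /-- `∂ʲ∂ⁱ = ∂ⁱ∂ʲ⁻¹` for `i < j` -/
  face_face {n : ℕ} (i j : ℕ) (hi : 1 ≤ i) (hij : i < j) (hj : j ≤ n + 1) {A : ArtAlg Λ}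
    (x : (E n).obj A) :
    face j (by omega) hj (face i hi (by omega) x) =
      face i hi (by omega) (face (j - 1) (by omega) (by omega) x)
  /-- `σʲσⁱ = σⁱσʲ⁺¹` for `i ≤ j` -/
  degen_degen {n : ℕ} (i j : ℕ) (hij : i ≤ j) (hj : j ≤ n) {A : ArtAlg Λ}
    (x : (E (n + 1 + 1)).obj A) :
    degen j hj (degen i (by omega) x) = degen i (by omega) (degen (j + 1) (by omega) x)
  /-- `σʲ∂ⁱ = ∂ⁱσʲ⁻¹` for `i < j` -/
  degen_face_of_lt {n : ℕ} (i j : ℕ) (hi : 1 ≤ i) (hij : i < j) (hj : j ≤ n + 1) {A : ArtAlg Λ}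
    (x : (E (n + 1)).obj A) :
    degen j hj (face i hi (by omega) x) =
      face i hi (by omega) (degen (j - 1) (by omega) x)
  /-- `σʲ∂ʲ = id` -/
  degen_face_self {n : ℕ} (j : ℕ) (hj : 1 ≤ j) (hn : j ≤ n) {A : ArtAlg Λ} (x : (E n).obj A) :
    degen j hn (face j hj hn x) = x
  /-- `σʲ∂ʲ⁺¹ = id` -/
  degen_face_succ {n : ℕ} (j : ℕ) (hn : j + 1 ≤ n) {A : ArtAlg Λ} (x : (E n).obj A) :
    degen j (by omega) (face (j + 1) (by omega) hn x) = x
  /-- `σʲ∂ⁱ = ∂ⁱ⁻¹σʲ` for `i > j + 1` -/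
  degen_face_of_gt {n : ℕ} (i j : ℕ) (hij : j + 1 < i) (hi : i ≤ n + 1) {A : ArtAlg Λ}
    (x : (E (n + 1)).obj A) :
    degen j (by omega) (face i (by omega) hi x) =
      face (i - 1) (by omega) (by omega) (degen j (by omega) x)
  /-- `∂ⁱ(e) * f = ∂ⁱ(e * f)` -/
  face_mul {m n p : ℕ} (h : m + n = p) (i : ℕ) (hi : 1 ≤ i) (hm : i ≤ m) {A : ArtAlg Λ}
    (x : (E m).obj A) (y : (E n).obj A) :
    mul (show m + 1 + n = p + 1 by omega) (face i hi hm x) y =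
      face i hi (by omega) (mul h x y)
  /-- `e * ∂ⁱ(f) = ∂ⁱ⁺ᵐ(e * f)` for `e` of degree `m` -/
  mul_face {m n p : ℕ} (h : m + n = p) (i : ℕ) (hi : 1 ≤ i) (hn : i ≤ n) {A : ArtAlg Λ}
    (x : (E m).obj A) (y : (E n).obj A) :
    mul (show m + (n + 1) = p + 1 by omega) x (face i hi hn y) =
      face (i + m) (by omega) (by omega) (mul h x y)
  /-- `σⁱ(e) * f = σⁱ(e * f)` -/
  degen_mul {m n p : ℕ} (h : m + n = p) (i : ℕ) (hm : i ≤ m) {A : ArtAlg Λ}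
    (x : (E (m + 1)).obj A) (y : (E n).obj A) :
    mul h (degen i hm x) y = degen i (by omega) (mul (show m + 1 + n = p + 1 by omega) x y)
  /-- `e * σⁱ(f) = σⁱ⁺ᵐ(e * f)` for `e` of degree `m` -/
  mul_degen {m n p : ℕ} (h : m + n = p) (i : ℕ) (hn : i ≤ n) {A : ArtAlg Λ}
    (x : (E m).obj A) (y : (E (n + 1)).obj A) :
    mul h x (degen i hn y) =
      degen (i + m) (by omega) (mul (show m + (n + 1) = p + 1 by omega) x y)

namespace SDC

variable {E : ℕ → ArtAlg Λ ⥤ Type v} (X : SDC E)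

/-- The objects of the deformation groupoid of an SDC over `A`: the Maurer-Cartan elements
`ω * ω = ∂¹(ω)` of `E¹(A)`. (The type may be lifted to a larger universe.) -/
@[ext]
structure DefObj (A : ArtAlg Λ) : Type (max v w) where
  pt : (E 1).obj A
  mc : X.mul (show 1 + 1 = 2 from rfl) pt pt = X.face 1 le_rfl le_rfl pt

/-- Morphisms `ω → ω'` in the deformation groupoid: the elements `g` of the group `E⁰(A)` whose
adjoint action takes `ω` to `ω'`, that is, `g * ω = ω' * g`. -/
@[ext]
structure DefHom {A : ArtAlg Λ} (x y : X.DefObj A) : Type v where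
  pt : (E 0).obj A
  comm : X.mul (Nat.zero_add 1) pt x.pt = X.mul (Nat.add_zero 1) y.pt pt

instance (A : ArtAlg Λ) : Category (DefObj.{u, v, w} X A) where
  Hom := X.DefHom
  id x := ⟨X.one A, by rw [X.one_mul, X.mul_one]⟩
  comp {x y z} g h := ⟨X.mul (Nat.zero_add 0) h.pt g.pt, by
    rw [X.mul_assoc (Nat.zero_add 0) (Nat.zero_add 1) (Nat.zero_add 1) (Nat.zero_add 1), g.comm,
      ← X.mul_assoc (Nat.zero_add 1) (Nat.add_zero 1) (Nat.add_zero 1) (Nat.zero_add 1), h.comm,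
      X.mul_assoc (Nat.add_zero 1) (Nat.add_zero 1) (Nat.zero_add 0) (Nat.add_zero 1)]⟩
  id_comp g := DefHom.ext (X.mul_one g.pt)
  comp_id g := DefHom.ext (X.one_mul g.pt)
  assoc g h l := DefHom.ext
    (X.mul_assoc (Nat.zero_add 0) (Nat.zero_add 0) (Nat.zero_add 0) (Nat.zero_add 0) _ _ _).symm

theorem id_pt {A : ArtAlg Λ} (x : DefObj.{u, v, w} X A) : DefHom.pt (𝟙 x) = X.one A := rfl

theorem comp_pt {A : ArtAlg Λ} {x y z : DefObj.{u, v, w} X A} (g : x ⟶ y) (h : y ⟶ z) :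
    DefHom.pt (g ≫ h) = X.mul (Nat.zero_add 0) h.pt g.pt := rfl

@[ext]
theorem defHom_ext {A : ArtAlg Λ} {x y : DefObj.{u, v, w} X A} {g h : x ⟶ y}
    (e : DefHom.pt g = DefHom.pt h) : g = h := DefHom.ext e

theorem eqToHom_pt {A : ArtAlg Λ} {x y : DefObj.{u, v, w} X A} (e : x = y) :
    DefHom.pt (eqToHom e) = X.one A := by
  subst e; rfl

/-- Base change on deformation groupoids. -/
def defMap {A A' : ArtAlg Λ} (f : A ⟶ A') : DefObj.{u, v, w} X A ⥤ DefObj.{u, v, w} X A' where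
  obj x := ⟨(E 1).map f x.pt, by rw [← X.map_mul, x.mc, X.map_face]⟩
  map {x y} g := ⟨(E 0).map f g.pt, by rw [← X.map_mul, g.comm, X.map_mul]⟩
  map_id x := defHom_ext X (X.map_one f)
  map_comp g h := defHom_ext X (X.map_mul _ f _ _)

theorem functor_ext {C : Type*} [Category C] {A : ArtAlg Λ} {F G : C ⥤ DefObj.{u, v, w} X A}
    (h : ∀ x, (F.obj x).pt = (G.obj x).pt)
    (h' : ∀ {x y} (g : x ⟶ y), DefHom.pt (F.map g) = DefHom.pt (G.map g)) : F = G := by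
  refine CategoryTheory.Functor.ext (fun x => DefObj.ext (h x)) (fun x y g => ?_)
  ext
  rw [comp_pt, comp_pt, eqToHom_pt, eqToHom_pt, X.mul_one, X.one_mul, h']

theorem defMap_id (A : ArtAlg Λ) : defMap.{u, v, w} X (𝟙 A) = 𝟭 _ :=
  functor_ext X (fun x => by simp [defMap]) (fun g => by simp [defMap])

theorem defMap_comp {A A' A'' : ArtAlg Λ} (f : A ⟶ A') (g : A' ⟶ A'') :
    defMap.{u, v, w} X (f ≫ g) = defMap X f ⋙ defMap X g :=
  functor_ext X (fun x => by simp [defMap]) (fun g => by simp [defMap])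

/-- The deformation groupoid `Def_E` of an SDC, as a functor on Artinian algebras. -/
def Def : CatFunctor.{u, v, max v w} Λ :=
  Functor.toPseudofunctor' (I := ArtAlg Λ) (B := Cat.{v, max v w})
    { obj := fun A => Cat.of (DefObj.{u, v, w} X A)
      map := fun f => (defMap X f).toCatHom
      map_id := fun A => Cat.ext (defMap_id X A)
      map_comp := fun f g => Cat.ext (defMap_comp X f g) }

end SDC

end Complexes

section Fibres

variable {Λ : Type u} [CommRing Λ] [IsLocalRing Λ]

open ArtAlg

variable (𝓓 : CatFunctor.{u, v, w} Λ) (D : 𝓓.at (k Λ))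

/-- An object of the (homotopy) fibre of `𝓓(A) → 𝓓(k)` over `(D, id)`: an object over `A` together
with an isomorphism between its base change to `k` and `D`. -/
structure FibreObj (A : ArtAlg Λ) : Type (max v w) where
  obj : 𝓓.at A
  iso : (𝓓.bc (toK A)).obj obj ≅ D

variable {𝓓 D}

/-- A morphism of the fibre of `𝓓(A) → 𝓓(k)` over `(D, id)`. -/
@[ext]
structure FibreHom {A : ArtAlg Λ} (x y : FibreObj 𝓓 D A) : Type v where
  hom : x.obj ⟶ y.obj
  comm : (𝓓.bc (toK A)).map hom ≫ y.iso.hom = x.iso.hom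

instance (A : ArtAlg Λ) : Category (FibreObj 𝓓 D A) where
  Hom := FibreHom
  id x := ⟨𝟙 x.obj, by simp⟩
  comp g h := ⟨g.hom ≫ h.hom, by rw [Functor.map_comp, Category.assoc, h.comm, g.comm]⟩
  id_comp g := FibreHom.ext (Category.id_comp _)
  comp_id g := FibreHom.ext (Category.comp_id _)
  assoc g h l := FibreHom.ext (Category.assoc _ _ _)

namespace FibreObj

@[ext]
theorem hom_ext {A : ArtAlg Λ} {x y : FibreObj 𝓓 D A} {g h : x ⟶ y} (e : g.hom = h.hom) : g = h :=
  FibreHom.ext e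

@[simp] theorem id_hom {A : ArtAlg Λ} (x : FibreObj 𝓓 D A) : FibreHom.hom (𝟙 x) = 𝟙 x.obj := rfl

@[simp] theorem comp_hom {A : ArtAlg Λ} {x y z : FibreObj 𝓓 D A} (g : x ⟶ y) (h : y ⟶ z) :
    FibreHom.hom (g ≫ h) = g.hom ≫ h.hom := rfl

theorem eqToHom_hom {A : ArtAlg Λ} {x y : FibreObj 𝓓 D A} (e : x = y) :
    FibreHom.hom (eqToHom e) = eqToHom (congrArg FibreObj.obj e) := by
  subst e; rfl

theorem eqToHom_app_hom {A A' : ArtAlg Λ} {F G : FibreObj 𝓓 D A ⥤ FibreObj 𝓓 D A'} (e : F = G)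
    (x : FibreObj 𝓓 D A) :
    FibreHom.hom ((eqToHom e).app x) = eqToHom (by rw [e]) := by
  subst e; rfl

/-- Isomorphisms of the fibre. -/
def isoMk {A : ArtAlg Λ} {x y : FibreObj 𝓓 D A} (e : x.obj ≅ y.obj)
    (h : (𝓓.bc (toK A)).map e.hom ≫ y.iso.hom = x.iso.hom) : x ≅ y where
  hom := ⟨e.hom, h⟩
  inv := ⟨e.inv, by rw [← h, ← Functor.map_comp_assoc]; simp⟩
  hom_inv_id := hom_ext e.hom_inv_id
  inv_hom_id := hom_ext e.inv_hom_id

variable (𝓓 D) in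
/-- Base change on fibres. -/
def map {A A' : ArtAlg Λ} (f : A ⟶ A') : FibreObj 𝓓 D A ⥤ FibreObj 𝓓 D A' where
  obj x := ⟨(𝓓.bc f).obj x.obj,
    ((𝓓.bcComp f (toK A') (toK A) (Subsingleton.elim _ _)).symm.app x.obj) ≪≫ x.iso⟩
  map {x y} g := ⟨(𝓓.bc f).map g.hom, by
    have := (𝓓.bcComp f (toK A') (toK A) (Subsingleton.elim _ _)).inv.naturality g.hom
    dsimp at this ⊢
    rw [reassoc_of% this, g.comm]⟩
  map_id x := hom_ext ((𝓓.bc f).map_id _)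
  map_comp g h := hom_ext ((𝓓.bc f).map_comp _ _)

variable (𝓓 D) in
def mapId (A : ArtAlg Λ) : map 𝓓 D (𝟙 A) ≅ 𝟭 (FibreObj 𝓓 D A) :=
  NatIso.ofComponents (fun x => isoMk ((𝓓.bcId A).app x.obj) (by
    have h := 𝓓.bcComp_id_left (toK A) (Subsingleton.elim _ _) x.obj
    have h' : (𝓓.bc (toK A)).map ((𝓓.bcId A).hom.app x.obj) =
        (𝓓.bcComp (𝟙 A) (toK A) (toK A) (Subsingleton.elim _ _)).inv.app x.obj := by
      rw [← cancel_epi ((𝓓.bcComp (𝟙 A) (toK A) (toK A) (Subsingleton.elim _ _)).hom.app x.obj),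
        Iso.hom_inv_id_app, h, ← Functor.map_comp, Iso.inv_hom_id_app]
      exact ((𝓓.bc (toK A)).map_id _)
    dsimp [map] at h' ⊢
    rw [h']))
    (fun g => hom_ext ((𝓓.bcId A).hom.naturality g.hom))

variable (𝓓 D) in
def mapComp {A A' A'' : ArtAlg Λ} (f : A ⟶ A') (g : A' ⟶ A'') :
    map 𝓓 D (f ≫ g) ≅ map 𝓓 D f ⋙ map 𝓓 D g :=
  NatIso.ofComponents (fun x => isoMk ((𝓓.bcComp f g (f ≫ g) rfl).app x.obj) (by
    have h := 𝓓.bcComp_assoc f g (toK A'') (f ≫ g) (toK A') (toK A) rfl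
      (Subsingleton.elim _ _) (Subsingleton.elim _ _) (Subsingleton.elim _ _) x.obj
    have h' : (𝓓.bc (toK A'')).map ((𝓓.bcComp f g (f ≫ g) rfl).hom.app x.obj) ≫
        (𝓓.bcComp g (toK A'') (toK A') (Subsingleton.elim _ _)).inv.app ((𝓓.bc f).obj x.obj) ≫
        (𝓓.bcComp f (toK A') (toK A) (Subsingleton.elim _ _)).inv.app x.obj =
        (𝓓.bcComp (f ≫ g) (toK A'') (toK A) (Subsingleton.elim _ _)).inv.app x.obj := by
      rw [← cancel_epi
        ((𝓓.bcComp (f ≫ g) (toK A'') (toK A) (Subsingleton.elim _ _)).hom.app x.obj),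
        Iso.hom_inv_id_app, ← reassoc_of% h, Iso.hom_inv_id_app_assoc, Iso.hom_inv_id_app]
    dsimp [map] at h' ⊢
    rw [reassoc_of% h']))
    (fun l => hom_ext ((𝓓.bcComp f g (f ≫ g) rfl).hom.naturality l.hom))

end FibreObj

theorem CatFunctor.bcComp_eqToHom (𝓓 : CatFunctor.{u, v, w} Λ) {A A' A'' : ArtAlg Λ} (f : A ⟶ A')
    (g : A' ⟶ A'') (h h' : A ⟶ A'') (e : f ≫ g = h) (e' : f ≫ g = h') (X : 𝓓.at A) :
    (𝓓.bcComp f g h e).hom.app X =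
      eqToHom (by rw [← e, ← e']) ≫ (𝓓.bcComp f g h' e').hom.app X := by
  subst e e'; simp

namespace CatFunctor

theorem coh_assoc (𝓓 : CatFunctor.{u, v, w} Λ) {A₀ A₁ A₂ A₃ : ArtAlg Λ} (f : A₀ ⟶ A₁)
    (g : A₁ ⟶ A₂) (h : A₂ ⟶ A₃) (X : 𝓓.at A₀) :
    (𝓓.bcComp (f ≫ g) h _ rfl).hom.app X ≫ (𝓓.bc h).map ((𝓓.bcComp f g _ rfl).hom.app X) ≫ 𝟙 _ ≫
      (𝓓.bcComp g h _ rfl).inv.app ((𝓓.bc f).obj X) ≫ (𝓓.bcComp f (g ≫ h) _ rfl).inv.app X =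
    eqToHom (by rw [Category.assoc]) := by
  have e := 𝓓.bcComp_eqToHom f (g ≫ h) ((f ≫ g) ≫ h) (f ≫ g ≫ h) (Category.assoc _ _ _).symm rfl X
  rw [Category.id_comp, ← reassoc_of% 𝓓.bcComp_assoc f g h (f ≫ g) (g ≫ h) ((f ≫ g) ≫ h)
    rfl rfl (Category.assoc _ _ _).symm rfl X, Iso.hom_inv_id_app_assoc]
  refine (congrArg (· ≫ _) e).trans ((Category.assoc (eqToHom _) _ _).trans ?_)
  rw [Iso.hom_inv_id_app, Category.comp_id]

theorem coh_left (𝓓 : CatFunctor.{u, v, w} Λ) {A A' : ArtAlg Λ} (f : A ⟶ A') (X : 𝓓.at A) :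
    (𝓓.bcComp (𝟙 _) f _ rfl).hom.app X ≫ (𝓓.bc f).map ((𝓓.bcId _).hom.app X) ≫ 𝟙 _ =
      eqToHom (by rw [Category.id_comp]; rfl) := by
  have e := 𝓓.bcComp_eqToHom (𝟙 A) f _ f rfl (Category.id_comp _) X
  refine (congrArg (· ≫ _) e).trans ?_
  rw [bcComp_id_left, Category.comp_id, Category.assoc, ← CategoryTheory.Functor.map_comp,
    Iso.inv_hom_id_app]
  exact (congrArg (_ ≫ ·) ((𝓓.bc f).map_id _)).trans (Category.comp_id _)

theorem coh_right (𝓓 : CatFunctor.{u, v, w} Λ) {A A' : ArtAlg Λ} (f : A ⟶ A') (X : 𝓓.at A) :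
    (𝓓.bcComp f (𝟙 _) _ rfl).hom.app X ≫ (𝓓.bcId _).hom.app ((𝓓.bc f).obj X) ≫ 𝟙 _ =
      eqToHom (by rw [Category.comp_id]; rfl) := by
  have e := 𝓓.bcComp_eqToHom f (𝟙 A') _ f rfl (Category.comp_id _) X
  refine (congrArg (· ≫ _) e).trans ((Category.assoc (eqToHom _) _ _).trans ?_)
  rw [bcComp_id_right, Category.comp_id ((𝓓.bcId A').hom.app _), Iso.inv_hom_id_app]
  exact Category.comp_id _

end CatFunctor

variable (𝓓 D) in
/-- The functor `Def_{𝓓,D}`, sending `A` to the fibre of `𝓓(A) → 𝓓(k)` over `(D, id)`. -/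
def DefFibre : CatFunctor.{u, v, max v w} Λ :=
  LocallyDiscrete.mkPseudofunctor (C := Cat.{v, max v w})
    (fun A => Cat.of (FibreObj 𝓓 D A))
    (fun f => (FibreObj.map 𝓓 D f).toCatHom)
    (fun A => Cat.Hom.isoMk (FibreObj.mapId 𝓓 D A))
    (fun f g => Cat.Hom.isoMk (FibreObj.mapComp 𝓓 D f g))
    (fun f g h => by
      ext x
      simp only [Cat.Hom₂.eqToHom_toNatTrans]
      exact FibreObj.hom_ext (Eq.trans (by exact 𝓓.coh_assoc f g h x.obj)
        (FibreObj.eqToHom_app_hom _ x).symm))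
    (fun f => by
      ext x
      simp only [Cat.Hom₂.eqToHom_toNatTrans]
      exact FibreObj.hom_ext (Eq.trans (by exact 𝓓.coh_left f x.obj)
        (FibreObj.eqToHom_app_hom _ x).symm))
    (fun f => by
      ext x
      simp only [Cat.Hom₂.eqToHom_toNatTrans]
      exact FibreObj.hom_ext (Eq.trans (by exact 𝓓.coh_right f x.obj)
        (FibreObj.eqToHom_app_hom _ x).symm))

end Fibres

section Transformations

variable {Λ : Type u} [CommRing Λ] [IsLocalRing Λ]

open ArtAlg

namespace CatFunctor

variable {𝓑 𝓒 : CatFunctor.{u, v, w} Λ}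

/-- The functor `𝓑(A) → 𝓒(A)` of a transformation `T : 𝓑 → 𝓒`. -/
abbrev appAt (T : 𝓑 ⟶ 𝓒) (A : ArtAlg Λ) : 𝓑.at A ⥤ 𝓒.at A := (T.app ⟨A⟩).toFunctor

/-- The compatibility of a transformation with base change. -/
def natIso (T : 𝓑 ⟶ 𝓒) {A A' : ArtAlg Λ} (f : A ⟶ A') :
    𝓑.bc f ⋙ appAt T A' ≅ appAt T A ⋙ 𝓒.bc f :=
  Cat.Hom.toNatIso (T.naturality f.toLoc)

theorem natIso_id (T : 𝓑 ⟶ 𝓒) (A : ArtAlg Λ) (X : 𝓑.at A) :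
    (natIso T (𝟙 A)).hom.app X ≫ (𝓒.bcId A).hom.app ((appAt T A).obj X) =
      (appAt T A).map ((𝓑.bcId A).hom.app X) := by
  have := T.naturality_id ⟨A⟩
  have := congr($(this).toNatTrans.app X)
  simp [-Pseudofunctor.StrongTrans.naturality_id] at this
  exact this

theorem bcComp_rfl (𝓑 : CatFunctor.{u, v, w} Λ) {A A' A'' : ArtAlg Λ} (f : A ⟶ A') (g : A' ⟶ A'') :
    𝓑.bcComp f g _ rfl = Cat.Hom.toNatIso (𝓑.mapComp f.toLoc g.toLoc) := by
  unfold bcComp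
  exact congrArg _ (𝓑.mapComp'_eq_mapComp f.toLoc g.toLoc)

theorem natIso_comp (T : 𝓑 ⟶ 𝓒) {A A' A'' : ArtAlg Λ} (f : A ⟶ A') (g : A' ⟶ A'') (X : 𝓑.at A) :
    (natIso T (f ≫ g)).hom.app X ≫ (𝓒.bcComp f g _ rfl).hom.app ((appAt T A).obj X) =
      (appAt T A'').map ((𝓑.bcComp f g _ rfl).hom.app X) ≫
        (natIso T g).hom.app ((𝓑.bc f).obj X) ≫ (𝓒.bc g).map ((natIso T f).hom.app X) := by
  have := T.naturality_comp f.toLoc g.toLoc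
  have := congr($(this).toNatTrans.app X)
  simp [-Pseudofunctor.StrongTrans.naturality_comp] at this
  rw [bcComp_rfl, bcComp_rfl]
  exact this

end CatFunctor

/-- `𝓑` has uniformly trivial deformation theory: along surjections, base change is full and
essentially surjective, and morphisms are homogeneous, that is, for `X` and `Y` over a fibre product
`B ×_A C` the map `Hom(X, Y) → Hom(X_B, Y_B) ×_{Hom(X_A, Y_A)} Hom(X_C, Y_C)` is bijective. -/
structure UniformlyTrivial (𝓑 : CatFunctor.{u, v, w} Λ) : Prop where
  full : ∀ ⦃A A' : ArtAlg Λ⦄ (f : A ⟶ A'), Surj f → (𝓑.bc f).Full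
  essSurj : ∀ ⦃A A' : ArtAlg Λ⦄ (f : A ⟶ A'), Surj f → (𝓑.bc f).EssSurj
  homogeneous : ∀ ⦃P B C A : ArtAlg Λ⦄ (p : P ⟶ B) (q : P ⟶ C) (f : B ⟶ A) (g : C ⟶ A)
    (h : IsFibreProduct p q f g), Surj f → ∀ (X Y : 𝓑.at P)
    (s : (𝓑.bc p).obj X ⟶ (𝓑.bc p).obj Y) (t : (𝓑.bc q).obj X ⟶ (𝓑.bc q).obj Y),
    (𝓑.bcComp p f (p ≫ f) rfl).hom.app X ≫ (𝓑.bc f).map s ≫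
        (𝓑.bcComp p f (p ≫ f) rfl).inv.app Y =
      (𝓑.bcComp q g (p ≫ f) h.w.symm).hom.app X ≫ (𝓑.bc g).map t ≫
        (𝓑.bcComp q g (p ≫ f) h.w.symm).inv.app Y →
    ∃! r : X ⟶ Y, (𝓑.bc p).map r = s ∧ (𝓑.bc q).map r = t

/-- Objects of `𝓑(Λ)`: families of objects of all the categories `𝓑(A)`, compatible under base
change. -/
structure FormalObject (𝓑 : CatFunctor.{u, v, w} Λ) where
  obj (A : ArtAlg Λ) : 𝓑.at A
  iso {A A' : ArtAlg Λ} (f : A ⟶ A') : (𝓑.bc f).obj (obj A) ≅ obj A'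
  iso_id (A : ArtAlg Λ) : (iso (𝟙 A)).hom = (𝓑.bcId A).hom.app (obj A)
  iso_comp {A A' A'' : ArtAlg Λ} (f : A ⟶ A') (g : A' ⟶ A'') :
    (iso (f ≫ g)).hom =
      (𝓑.bcComp f g _ rfl).hom.app (obj A) ≫ (𝓑.bc g).map (iso f).hom ≫ (iso g).hom

namespace FormalObject

variable {𝓑 : CatFunctor.{u, v, w} Λ}

/-- The base change isomorphisms of `Tⁿ(X)`. -/
def powIso (T : 𝓑 ⟶ 𝓑) (X : FormalObject 𝓑) : (n : ℕ) → {A A' : ArtAlg Λ} → (f : A ⟶ A') →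
    ((𝓑.bc f).obj ((iter (CatFunctor.appAt T A) n).obj (X.obj A)) ≅
      (iter (CatFunctor.appAt T A') n).obj (X.obj A'))
  | 0, _, _, f => X.iso f
  | n + 1, _, A', f => ((CatFunctor.natIso T f).app _).symm ≪≫
      (CatFunctor.appAt T A').mapIso (powIso T X n f)

/-- The formal object `Tⁿ(X)`. -/
def pow (T : 𝓑 ⟶ 𝓑) (X : FormalObject 𝓑) (n : ℕ) : FormalObject 𝓑 where
  obj A := (iter (CatFunctor.appAt T A) n).obj (X.obj A)
  iso f := powIso T X n f
  iso_id A := by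
    induction n with
    | zero => exact X.iso_id A
    | succ n ih =>
      change (CatFunctor.natIso T (𝟙 A)).inv.app _ ≫ (CatFunctor.appAt T A).map
        (powIso T X n (𝟙 A)).hom = _
      rw [ih, ← CatFunctor.natIso_id, Iso.inv_hom_id_app_assoc]
      rfl
  iso_comp {A A' A''} f g := by
    induction n with
    | zero => exact X.iso_comp f g
    | succ n ih =>
      change (CatFunctor.natIso T (f ≫ g)).inv.app _ ≫ (CatFunctor.appAt T A'').map
        (powIso T X n (f ≫ g)).hom = (𝓑.bcComp f g _ rfl).hom.app
          ((CatFunctor.appAt T A).obj ((iter (CatFunctor.appAt T A) n).obj (X.obj A))) ≫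
        (𝓑.bc g).map ((CatFunctor.natIso T f).inv.app _ ≫
          (CatFunctor.appAt T A').map (powIso T X n f).hom) ≫
          (CatFunctor.natIso T g).inv.app _ ≫ (CatFunctor.appAt T A'').map (powIso T X n g).hom
      have h := CatFunctor.natIso_comp T f g ((iter (CatFunctor.appAt T A) n).obj (X.obj A))
      have h2 := (CatFunctor.natIso T g).inv.naturality (powIso T X n f).hom
      rw [ih, ← cancel_epi ((CatFunctor.natIso T (f ≫ g)).hom.app _), Iso.hom_inv_id_app_assoc]
      dsimp at h h2 ⊢
      simp only [CategoryTheory.Functor.map_comp, Category.assoc]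
      rw [reassoc_of% h, ← (𝓑.bc g).map_comp_assoc, Iso.hom_inv_id_app]
      simp [reassoc_of% h2]

/-- The functor `A ↦ Hom(X, Y)(A)`. -/
def homFunctor (X Y : FormalObject 𝓑) : ArtAlg Λ ⥤ Type v where
  obj A := X.obj A ⟶ Y.obj A
  map f := TypeCat.ofHom (fun r => (X.iso f).inv ≫ (𝓑.bc f).map r ≫ (Y.iso f).hom)
  map_id A := by
    ext r
    have h := (𝓑.bcId A).hom.naturality r
    dsimp at h ⊢
    rw [Y.iso_id, h, Iso.inv_comp_eq, X.iso_id]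
  map_comp {A A' A''} f g := by
    ext r
    have h := (𝓑.bcComp f g _ rfl).hom.naturality r
    dsimp at h ⊢
    rw [Iso.inv_comp_eq, X.iso_comp, Y.iso_comp, reassoc_of% h]
    simp

end FormalObject

/-- The subfunctor of `F` of all elements over `x ∈ F(k)`. -/
def fibreFunctor (F : ArtAlg Λ ⥤ Type v) (x : F.obj (k Λ)) : ArtAlg Λ ⥤ Type v where
  obj A := {y : F.obj A // F.map (toK A) y = x}
  map {A A'} f := TypeCat.ofHom (fun y => ⟨F.map f y.1, by
    have h : f ≫ toK A' = toK A := Subsingleton.elim _ _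
    have h' := congr($(F.map_comp f (toK A')) y.1)
    rw [h] at h'
    exact h'.symm.trans y.2⟩)
  map_id A := by
    ext y
    simp
  map_comp f g := by
    ext y
    simp

end Transformations

section Diagrams

variable {Λ : Type u} [CommRing Λ] [IsLocalRing Λ]

open ArtAlg

/-- A square of adjunctions between category-valued functors
```
        U₁
    𝓓 ⇄ 𝓔        F₁ ⊣ U₁,  F₀ ⊣ U₀,
 V₁ ⇅   ⇅ V₀     V₁ ⊣ G₁,  V₀ ⊣ G₀
    𝓐 ⇄ 𝓑
        U₀
```
with `UV ≅ VU` and `FV ≅ VF`. The adjunctions are adjunctions in the bicategory of category-valued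
functors, that is, the functors, units and counits are compatible with base change. -/
structure SquareDiagram (𝓓 𝓔 𝓐 𝓑 : CatFunctor.{u, v, w} Λ) where
  {U₁ : 𝓓 ⟶ 𝓔}
  {F₁ : 𝓔 ⟶ 𝓓}
  {U₀ : 𝓐 ⟶ 𝓑}
  {F₀ : 𝓑 ⟶ 𝓐}
  {V₁ : 𝓓 ⟶ 𝓐}
  {G₁ : 𝓐 ⟶ 𝓓}
  {V₀ : 𝓔 ⟶ 𝓑}
  {G₀ : 𝓑 ⟶ 𝓔}
  adjFU₁ : Bicategory.Adjunction F₁ U₁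
  adjFU₀ : Bicategory.Adjunction F₀ U₀
  adjVG₁ : Bicategory.Adjunction V₁ G₁
  adjVG₀ : Bicategory.Adjunction V₀ G₀
  isoUV : V₁ ≫ U₀ ≅ U₁ ≫ V₀
  isoFV : V₀ ≫ F₀ ≅ F₁ ≫ V₁

/-- The adjunction `F(A) ⊣ U(A)` of an adjunction `F ⊣ U` of category-valued functors. -/
def adjAt {𝓒 𝓒' : CatFunctor.{u, v, w} Λ} {F : 𝓒 ⟶ 𝓒'} {U : 𝓒' ⟶ 𝓒}
    (adj : Bicategory.Adjunction F U) (A : ArtAlg Λ) :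
    CatFunctor.appAt F A ⊣ CatFunctor.appAt U A :=
  CategoryTheory.Adjunction.ofCat (F := F.app ⟨A⟩) (G := U.app ⟨A⟩)
    { unit := adj.unit.as.app ⟨A⟩
      counit := adj.counit.as.app ⟨A⟩
      left_triangle := by
        have := congr($(adj.left_triangle).as.app ⟨A⟩)
        simp [Bicategory.leftZigzag, bicategoricalComp] at this ⊢
        exact this
      right_triangle := by
        have := congr($(adj.right_triangle).as.app ⟨A⟩)
        simp [Bicategory.rightZigzag, bicategoricalComp] at this ⊢
        exact this }

/-- The isomorphism of functors at `A` of an isomorphism of transformations. -/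
def isoAt {𝓒 𝓒' : CatFunctor.{u, v, w} Λ} {S T : 𝓒 ⟶ 𝓒'} (e : S ≅ T) (A : ArtAlg Λ) :
    CatFunctor.appAt S A ≅ CatFunctor.appAt T A :=
  Cat.Hom.toNatIso
    { hom := e.hom.as.app ⟨A⟩
      inv := e.inv.as.app ⟨A⟩
      hom_inv_id := congr($(e.hom_inv_id).as.app ⟨A⟩)
      inv_hom_id := congr($(e.inv_hom_id).as.app ⟨A⟩) }

namespace SquareDiagram

variable {𝓓 𝓔 𝓐 𝓑 : CatFunctor.{u, v, w} Λ} (S : SquareDiagram 𝓓 𝓔 𝓐 𝓑)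

/-- The square of adjunctions between the categories `𝓓(A)`, `𝓔(A)`, `𝓐(A)`, `𝓑(A)`. -/
def sqAt (A : ArtAlg Λ) : AdjSquare (𝓓.at A) (𝓔.at A) (𝓐.at A) (𝓑.at A) where
  adjFU₁ := adjAt S.adjFU₁ A
  adjFU₀ := adjAt S.adjFU₀ A
  adjVG₁ := adjAt S.adjVG₁ A
  adjVG₀ := adjAt S.adjVG₀ A
  isoUV := isoAt S.isoUV A
  isoFV := isoAt S.isoFV A

/-- The compatibility of the adjunctions with the isomorphisms `UV ≅ VU`, `FV ≅ VF`, `GU ≅ UG`, at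
every `A`. -/
def IsCompatible : Prop := ∀ A : ArtAlg Λ, (S.sqAt A).IsCompatible

/-- The adjunctions `F ⊣ U` are monadic. -/
def IsMonadic : Prop := ∀ A : ArtAlg Λ,
  (Monad.comparison (S.sqAt A).adjFU₁).IsEquivalence ∧
    (Monad.comparison (S.sqAt A).adjFU₀).IsEquivalence

/-- The adjunctions `V ⊣ G` are comonadic. -/
def IsComonadic : Prop := ∀ A : ArtAlg Λ,
  (Comonad.comparison (S.sqAt A).adjVG₁).IsEquivalence ∧
    (Comonad.comparison (S.sqAt A).adjVG₀).IsEquivalence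

/-- A lift of `UV D ∈ 𝓑(k)` to an object of `𝓑(Λ)`. -/
structure Lift (D : 𝓓.at (k Λ)) where
  toFormal : FormalObject 𝓑
  iso : toFormal.obj (k Λ) ≅ (S.sqAt (k Λ)).UV.obj D

namespace Lift

variable {S} {D : 𝓓.at (k Λ)}

/-- Isomorphisms of lifts. -/
structure IsoTo (B B' : S.Lift D) where
  app (A : ArtAlg Λ) : B.toFormal.obj A ≅ B'.toFormal.obj A
  naturality {A A' : ArtAlg Λ} (f : A ⟶ A') :
    (𝓑.bc f).map (app A).hom ≫ (B'.toFormal.iso f).hom =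
      (B.toFormal.iso f).hom ≫ (app A').hom
  comm : (app (k Λ)).hom ≫ B'.iso.hom = B.iso.hom

variable (B : S.Lift D)

/-- The functor `A ↦ Hom(⊤ₕⁿB, ⊥ᵥⁿB)(A)`. -/
def hom (n : ℕ) : ArtAlg Λ ⥤ Type v :=
  FormalObject.homFunctor (B.toFormal.pow (S.F₀ ≫ S.U₀) n) (B.toFormal.pow (S.G₀ ≫ S.V₀) n)

/-- The map `UV(αⁿ_D ∘ εⁿ_D)`, regarded as an element of `Hom(⊤ₕⁿB, ⊥ᵥⁿB)(k)`. -/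
def basePoint (n : ℕ) : (B.hom n).obj (k Λ) :=
  (iter (S.sqAt (k Λ)).T n).map B.iso.hom ≫ (S.sqAt (k Λ)).canonicalMap n D ≫
    (iter (S.sqAt (k Λ)).L n).map B.iso.inv

/-- `Eⁿ = Hom(⊤ₕⁿB, ⊥ᵥⁿB)_{UV(αⁿ_D ∘ εⁿ_D)}`. -/
def gradedHom (n : ℕ) : ArtAlg Λ ⥤ Type v := fibreFunctor (B.hom n) (B.basePoint n)

/-- The map `⊤ₕⁿB → ⊥ᵥⁿB` in `𝓑(A)` given by an element of `Eⁿ(A)`. -/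
def toHom {n : ℕ} {A : ArtAlg Λ} (g : (B.gradedHom n).obj A) :
    (iter (S.sqAt A).T n).obj (B.toFormal.obj A) ⟶ (iter (S.sqAt A).L n).obj (B.toFormal.obj A) :=
  g.1

/-- An SDC structure on `E*` is the standard one if its operations are given by the product
`g * h = ⊥ᵥⁿ(g) ∘ δᵐⁿ ∘ ⊤ₕᵐ(h)`, with the identity of `B` as unit, and by the operations `∂ⁱ`
and `σⁱ` of the double augmented complex. -/
structure IsStandard (E : SDC B.gradedHom) : Prop where
  mul {m n p : ℕ} (h : m + n = p) {A : ArtAlg Λ} (x : (B.gradedHom m).obj A)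
    (y : (B.gradedHom n).obj A) :
    B.toHom (E.mul h x y) = (S.sqAt A).prodMap h (B.toHom x) (B.toHom y)
  one (A : ArtAlg Λ) : B.toHom (E.one A) = 𝟙 (B.toFormal.obj A)
  face {n : ℕ} (i : ℕ) (hi : 1 ≤ i) (hn : i ≤ n) {A : ArtAlg Λ} (x : (B.gradedHom n).obj A) :
    B.toHom (E.face i hi hn x) = (S.sqAt A).faceMap i hi hn (B.toHom x)
  degen {n : ℕ} (i : ℕ) (hn : i ≤ n) {A : ArtAlg Λ} (x : (B.gradedHom (n + 1)).obj A) :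
    B.toHom (E.degen i hn x) = (S.sqAt A).degenMap i hn (B.toHom x)

end Lift

end SquareDiagram

/-- An equivalence between category-valued functors: a transformation that is an equivalence of
categories at every `A`. -/
def Equivalent (𝓒 𝓒' : CatFunctor.{u, v, w} Λ) : Prop :=
  ∃ Φ : 𝓒 ⟶ 𝓒', ∀ A : ArtAlg Λ, (CatFunctor.appAt Φ A).IsEquivalence

end Diagrams

end

end SimplicialDeformation

open SimplicialDeformation

/-!
The theorem is a descent statement in two stages. Objects of `𝓓` are objects of `𝓑` with the
structure of a bialgebra, and a bialgebra structure on a fixed object of `𝓑` is a Maurer-Cartan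
element. Uniform triviality of `𝓑` says that the underlying object of `𝓑` does not vary.

*Bialgebras.* Let `T = UF` and `L = VG` be the monad and the comonad on `𝓑(A)`. Both the conditions
`Vε = εV` and `Uα = αU` on the square of adjunctions amount to one statement: the mate `VU → UV` of
`FV ≅ VF` is the inverse of `UV ≅ VU` (`IsCompatible.mate_eq`). All four compatibilities follow, and
they make `δ : TL → LT` a mixed distributive law (`IsCompatible.law`). For `X` in `𝓓(A)` the object
`UV X` is a bialgebra for `δ`, with action `UVε` and coaction `UVα`. As the adjunctions `F ⊣ U` are
monadic and the adjunctions `V ⊣ G` are comonadic, `𝓓(A)` is equivalent to the category of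
bialgebras in `𝓑(A)` (`IsCompatible.exists_of_bialgebra`, `exists_map_of_bialgebra_map`).

*Maurer-Cartan elements.* For any mixed distributive law, the maps `Tⁿb → Lⁿb` carry the product and
the operations `∂ⁱ` and `σⁱ` of a simplicial deformation complex (`MixedLaw.prod`, `MixedLaw.face`,
`MixedLaw.degen`). A bialgebra structure `(h, v)` on `b` gives `ω = v ∘ h : Tb → Lb` with
`ω * ω = ∂¹ω`. Conversely, a Maurer-Cartan element `ω` factors as `v ∘ h` with `h = γ ∘ ω` and
`v = ω ∘ η` (`IsMaurerCartan.fac`), and this is a bialgebra structure as soon as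
`σ⁰(ω) = γ ∘ ω ∘ η` is the identity (`IsMaurerCartan.isBialgebra`). Since `σ⁰(ω)` is idempotent it
suffices that it is invertible (`IsMaurerCartan.η_comp_comp_γ`). A map intertwines two such elements
exactly when it is a map of bialgebras (`IsBialgebra.intertwine_iff`).

*Uniform triviality.* In `𝓑`, base change to `k` reflects isomorphisms
(`UniformlyTrivial.isIso_of_toK`). By fullness and induction on the exponent of nilpotency of the
maximal ideal of `A`, this comes down to endomorphisms `g` that are the identity modulo an ideal of
square zero. Then `(1, g, 1)` is an
endomorphism over `A ×_{A'} A ×_{A'} A`, by homogeneity, and it is carried to an inverse of `g` by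
the algebra map `(a, b, c) ↦ a - b + c` (`UniformlyTrivial.isIso_of_bcEnd_eq_id`). Fullness and
homogeneity also say that maps between two compatible families of objects form a smooth and
homogeneous functor; smoothness of `Eⁿ` and its homogeneity are instances of this. A
lift of `UV D` is built step by step over the algebras `Λ / 𝔪ⁿ⁺¹`, through one of which the structure
map of every Artinian algebra factors, and the isomorphism between two lifts is built in the same way
(`SquareDiagram.nonempty_lift`, `Lift.nonempty_isoTo`).

*The equivalence.* Fix a lift `B` and let `X` be an object of the fibre over `A`. Since base change
is full and reflects isomorphisms, the given `UV(X)_k ≅ UV D ≅ B_k` lifts to `UV X ≅ B_A`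
(`Lift.exists_triv`), and transport of the bialgebra structure of `UV X` gives a Maurer-Cartan
element, compatibly with base change (`toDefTrans`). The functor is fully faithful by the
description of maps of bialgebras. It is essentially surjective because `σ⁰(ω)` reduces to the
identity over `k`, so that it is invertible and every Maurer-Cartan element is a bialgebra
structure. Morphisms of `Def_E(A)` are the identity over `k`, hence invertible, so both sides are
groupoids.
-/


namespace SimplicialDeformation

universe v₁ u₁

noncomputable section

/-! ### Iterates of an endofunctor -/

section Iterates

variable {C : Type u₁} [Category.{v₁} C]

/-- Functors preserve commutative squares. The middle objects are only required to agree up to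
definitional unfolding, which makes this usable on the iterates `Tⁿ⁺¹ X = T (Tⁿ X)`. -/
theorem map_square {D : Type*} [Category* D] (T : C ⥤ D) {W X Y Z : C} {f : W ⟶ X} {g : X ⟶ Z}
    {f' : W ⟶ Y} {g' : Y ⟶ Z} (h : f ≫ g = f' ≫ g') :
    T.map f ≫ T.map g = T.map f' ≫ T.map g' := by
  rw [← T.map_comp, h, T.map_comp]

theorem map_triangle {D : Type*} [Category* D] (T : C ⥤ D) {W X Z : C} {f : W ⟶ X} {g : X ⟶ Z}
    {f' : W ⟶ Z} (h : f ≫ g = f') : T.map f ≫ T.map g = T.map f' := by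
  rw [← T.map_comp, h]

variable {T : C ⥤ C}

theorem iterIso_zero (n : ℕ) (X : C) : iterIso T (Nat.zero_add n) X = Iso.refl _ := by
  ext
  simp only [iterIso, Iso.app_hom, eqToIso.hom, eqToHom_app]
  rfl

theorem iterIso_succ {m n p : ℕ} (h : m + n = p) (h' : m + 1 + n = p + 1) (X : C) :
    iterIso T h' X = T.mapIso (iterIso T h X) := by
  subst h
  ext
  simp only [iterIso, Iso.app_hom, eqToIso.hom, eqToHom_app, Functor.mapIso_hom, eqToHom_map]
  rfl

theorem iterIso_succ_hom {m n p : ℕ} (h : m + n = p) (h' : m + 1 + n = p + 1) (X : C) :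
    (iterIso T h' X).hom = T.map (iterIso T h X).hom :=
  congrArg Iso.hom (iterIso_succ h h' X)

theorem iterIso_naturality {m n p : ℕ} (h : m + n = p) {X Y : C} (f : X ⟶ Y) :
    (iter T m).map ((iter T n).map f) ≫ (iterIso T h Y).hom =
      (iterIso T h X).hom ≫ (iter T p).map f :=
  (eqToIso (iter_iter T h)).hom.naturality f

theorem iterIso_assoc {l m n a b p : ℕ} (h₁ : l + m = a) (h₂ : a + n = p) (h₃ : m + n = b)
    (h₄ : l + b = p) (X : C) :
    (iterIso T h₁ ((iter T n).obj X)).hom ≫ (iterIso T h₂ X).hom =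
      (iter T l).map (iterIso T h₃ X).hom ≫ (iterIso T h₄ X).hom := by
  induction l generalizing a p with
  | zero =>
    obtain rfl : m = a := by omega
    obtain rfl : b = p := by omega
    rw [iterIso_zero, iterIso_zero]
    exact (Category.id_comp _).trans (Category.comp_id _).symm
  | succ l ih =>
    obtain ⟨a, rfl⟩ : ∃ a', a = a' + 1 := ⟨l + m, by omega⟩
    obtain ⟨p, rfl⟩ : ∃ p', p = p' + 1 := ⟨l + b, by omega⟩
    rw [iterIso_succ_hom (show l + m = a by omega), iterIso_succ_hom (show a + n = p by omega),
      iterIso_succ_hom (show l + b = p by omega)]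
    exact map_square T (ih (by omega) (by omega) (by omega))

theorem iterIso_right_zero (n : ℕ) (X : C) :
    (iterIso T (Nat.add_zero n) X).hom = 𝟙 ((iter T n).obj X) := by
  induction n with
  | zero => rw [iterIso_zero]; rfl
  | succ n ih =>
    rw [iterIso_succ_hom (Nat.add_zero n), ih]
    exact T.map_id _

variable (η : 𝟭 C ⟶ T) (μ : T ⋙ T ⟶ T) {L : C ⥤ C} (γ : L ⟶ 𝟭 C) (ν : L ⟶ L ⋙ L)

/-- `Tᵃ μ Tⁿ⁻¹⁻ᵃ : Tⁿ⁺¹ → Tⁿ`. -/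
def muAt : (n a : ℕ) → a < n → (X : C) → ((iter T (n + 1)).obj X ⟶ (iter T n).obj X)
  | n + 1, 0, _, X => μ.app ((iter T n).obj X)
  | n + 1, a + 1, h, X => T.map (muAt n a (by omega) X)

/-- `Tᵃ η Tⁿ⁻ᵃ : Tⁿ → Tⁿ⁺¹`. -/
def etaAt : (n a : ℕ) → a ≤ n → (X : C) → ((iter T n).obj X ⟶ (iter T (n + 1)).obj X)
  | n, 0, _, X => η.app ((iter T n).obj X)
  | n + 1, a + 1, h, X => T.map (etaAt n a (by omega) X)

/-- `Lᵃ ν Lⁿ⁻¹⁻ᵃ : Lⁿ → Lⁿ⁺¹`. -/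
def nuAt : (n a : ℕ) → a < n → (X : C) → ((iter L n).obj X ⟶ (iter L (n + 1)).obj X)
  | n + 1, 0, _, X => ν.app ((iter L n).obj X)
  | n + 1, a + 1, h, X => L.map (nuAt n a (by omega) X)

/-- `Lᵃ γ Lⁿ⁻ᵃ : Lⁿ⁺¹ → Lⁿ`. -/
def gamAt : (n a : ℕ) → a ≤ n → (X : C) → ((iter L (n + 1)).obj X ⟶ (iter L n).obj X)
  | n, 0, _, X => γ.app ((iter L n).obj X)
  | n + 1, a + 1, h, X => L.map (gamAt n a (by omega) X)

variable {η μ γ ν}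

/-! ### Simplicial identities between the structure maps of the iterates -/

theorem muAt_muAt (assoc : ∀ X, T.map (μ.app X) ≫ μ.app X = μ.app (T.obj X) ≫ μ.app X)
    {n a b : ℕ} (hab : a ≤ b) (hb : b < n) (X : C) :
    muAt μ (n + 1) (b + 1) (by omega) X ≫ muAt μ n a (by omega) X =
      muAt μ (n + 1) a (by omega) X ≫ muAt μ n b hb X := by
  induction a generalizing n b with
  | zero =>
    obtain ⟨n, rfl⟩ : ∃ n', n = n' + 1 := ⟨n - 1, by omega⟩
    cases b with
    | zero => exact assoc _
    | succ b => exact μ.naturality (muAt μ n b (by omega) X)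
  | succ a ih =>
    obtain ⟨n, rfl⟩ : ∃ n', n = n' + 1 := ⟨n - 1, by omega⟩
    obtain ⟨b, rfl⟩ : ∃ b', b = b' + 1 := ⟨b - 1, by omega⟩
    exact map_square T (ih (by omega) (by omega))

theorem etaAt_etaAt {n a b : ℕ} (hab : a ≤ b) (hb : b ≤ n) (X : C) :
    etaAt η n b hb X ≫ etaAt η (n + 1) a (by omega) X =
      etaAt η n a (by omega) X ≫ etaAt η (n + 1) (b + 1) (by omega) X := by
  induction a generalizing n b with
  | zero => cases n <;> exact η.naturality (etaAt η _ b hb X)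
  | succ a ih =>
    obtain ⟨n, rfl⟩ : ∃ n', n = n' + 1 := ⟨n - 1, by omega⟩
    obtain ⟨b, rfl⟩ : ∃ b', b = b' + 1 := ⟨b - 1, by omega⟩
    exact map_square T (ih (by omega) (by omega))

theorem etaAt_muAt_of_lt {n a b : ℕ} (hab : a < b) (hb : b ≤ n) (X : C) :
    etaAt η (n + 1) (b + 1) (by omega) X ≫ muAt μ (n + 1) a (by omega) X =
      muAt μ n a (by omega) X ≫ etaAt η n b hb X := by
  induction a generalizing n b with
  | zero =>
    obtain ⟨n, rfl⟩ : ∃ n', n = n' + 1 := ⟨n - 1, by omega⟩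
    obtain ⟨b, rfl⟩ : ∃ b', b = b' + 1 := ⟨b - 1, by omega⟩
    exact μ.naturality (etaAt η n b (by omega) X)
  | succ a ih =>
    obtain ⟨n, rfl⟩ : ∃ n', n = n' + 1 := ⟨n - 1, by omega⟩
    obtain ⟨b, rfl⟩ : ∃ b', b = b' + 1 := ⟨b - 1, by omega⟩
    exact map_square T (ih (by omega) (by omega))

theorem etaAt_muAt_of_gt {n a b : ℕ} (hab : b ≤ a) (ha : a < n) (X : C) :
    etaAt η (n + 1) b (by omega) X ≫ muAt μ (n + 1) (a + 1) (by omega) X =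
      muAt μ n a ha X ≫ etaAt η n b (by omega) X := by
  induction b generalizing n a with
  | zero => cases n <;> exact (η.naturality (muAt μ _ a ha X)).symm
  | succ b ih =>
    obtain ⟨n, rfl⟩ : ∃ n', n = n' + 1 := ⟨n - 1, by omega⟩
    obtain ⟨a, rfl⟩ : ∃ a', a = a' + 1 := ⟨a - 1, by omega⟩
    exact map_square T (ih (by omega) (by omega))

theorem etaAt_succ_muAt (unit : ∀ X, T.map (η.app X) ≫ μ.app X = 𝟙 (T.obj X))
    {n a : ℕ} (ha : a < n) (X : C) :
    etaAt η n (a + 1) ha X ≫ muAt μ n a ha X = 𝟙 _ := by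
  induction a generalizing n with
  | zero =>
    obtain ⟨n, rfl⟩ : ∃ n', n = n' + 1 := ⟨n - 1, by omega⟩
    cases n <;> exact unit _
  | succ a ih =>
    obtain ⟨n, rfl⟩ : ∃ n', n = n' + 1 := ⟨n - 1, by omega⟩
    exact (map_triangle T (ih (by omega))).trans (T.map_id _)

theorem etaAt_muAt_self (unit : ∀ X, η.app (T.obj X) ≫ μ.app X = 𝟙 (T.obj X))
    {n a : ℕ} (ha : a < n) (X : C) :
    etaAt η n a ha.le X ≫ muAt μ n a ha X = 𝟙 _ := by
  induction a generalizing n with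
  | zero =>
    obtain ⟨n, rfl⟩ : ∃ n', n = n' + 1 := ⟨n - 1, by omega⟩
    exact unit _
  | succ a ih =>
    obtain ⟨n, rfl⟩ : ∃ n', n = n' + 1 := ⟨n - 1, by omega⟩
    exact (map_triangle T (ih (by omega))).trans (T.map_id _)

theorem nuAt_nuAt (coassoc : ∀ X, ν.app X ≫ L.map (ν.app X) = ν.app X ≫ ν.app (L.obj X))
    {n a b : ℕ} (hab : a ≤ b) (hb : b < n) (X : C) :
    nuAt ν n a (by omega) X ≫ nuAt ν (n + 1) (b + 1) (by omega) X =
      nuAt ν n b hb X ≫ nuAt ν (n + 1) a (by omega) X := by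
  induction a generalizing n b with
  | zero =>
    obtain ⟨n, rfl⟩ : ∃ n', n = n' + 1 := ⟨n - 1, by omega⟩
    cases b with
    | zero => exact coassoc _
    | succ b => exact (ν.naturality (nuAt ν n b (by omega) X)).symm
  | succ a ih =>
    obtain ⟨n, rfl⟩ : ∃ n', n = n' + 1 := ⟨n - 1, by omega⟩
    obtain ⟨b, rfl⟩ : ∃ b', b = b' + 1 := ⟨b - 1, by omega⟩
    exact map_square L (ih (by omega) (by omega))

theorem gamAt_gamAt {n a b : ℕ} (hab : a ≤ b) (hb : b ≤ n) (X : C) :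
    gamAt γ (n + 1) (b + 1) (by omega) X ≫ gamAt γ n a (by omega) X =
      gamAt γ (n + 1) a (by omega) X ≫ gamAt γ n b hb X := by
  induction a generalizing n b with
  | zero => cases n <;> exact γ.naturality (gamAt γ _ b hb X)
  | succ a ih =>
    obtain ⟨n, rfl⟩ : ∃ n', n = n' + 1 := ⟨n - 1, by omega⟩
    obtain ⟨b, rfl⟩ : ∃ b', b = b' + 1 := ⟨b - 1, by omega⟩
    exact map_square L (ih (by omega) (by omega))

theorem nuAt_gamAt_of_lt {n a b : ℕ} (hab : a < b) (hb : b ≤ n) (X : C) :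
    nuAt ν (n + 1) a (by omega) X ≫ gamAt γ (n + 1) (b + 1) (by omega) X =
      gamAt γ n b hb X ≫ nuAt ν n a (by omega) X := by
  induction a generalizing n b with
  | zero =>
    obtain ⟨n, rfl⟩ : ∃ n', n = n' + 1 := ⟨n - 1, by omega⟩
    obtain ⟨b, rfl⟩ : ∃ b', b = b' + 1 := ⟨b - 1, by omega⟩
    exact (ν.naturality (gamAt γ n b (by omega) X)).symm
  | succ a ih =>
    obtain ⟨n, rfl⟩ : ∃ n', n = n' + 1 := ⟨n - 1, by omega⟩
    obtain ⟨b, rfl⟩ : ∃ b', b = b' + 1 := ⟨b - 1, by omega⟩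
    exact map_square L (ih (by omega) (by omega))

theorem nuAt_gamAt_of_gt {n a b : ℕ} (hab : b ≤ a) (ha : a < n) (X : C) :
    nuAt ν (n + 1) (a + 1) (by omega) X ≫ gamAt γ (n + 1) b (by omega) X =
      gamAt γ n b (by omega) X ≫ nuAt ν n a ha X := by
  induction b generalizing n a with
  | zero => cases n <;> exact γ.naturality (nuAt ν _ a ha X)
  | succ b ih =>
    obtain ⟨n, rfl⟩ : ∃ n', n = n' + 1 := ⟨n - 1, by omega⟩
    obtain ⟨a, rfl⟩ : ∃ a', a = a' + 1 := ⟨a - 1, by omega⟩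
    exact map_square L (ih (by omega) (by omega))

theorem nuAt_gamAt_succ (counit : ∀ X, ν.app X ≫ L.map (γ.app X) = 𝟙 (L.obj X))
    {n a : ℕ} (ha : a < n) (X : C) :
    nuAt ν n a ha X ≫ gamAt γ n (a + 1) ha X = 𝟙 _ := by
  induction a generalizing n with
  | zero =>
    obtain ⟨n, rfl⟩ : ∃ n', n = n' + 1 := ⟨n - 1, by omega⟩
    cases n <;> exact counit _
  | succ a ih =>
    obtain ⟨n, rfl⟩ : ∃ n', n = n' + 1 := ⟨n - 1, by omega⟩
    exact (map_triangle L (ih (by omega))).trans (L.map_id _)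

theorem nuAt_gamAt_self (counit : ∀ X, ν.app X ≫ γ.app (L.obj X) = 𝟙 (L.obj X))
    {n a : ℕ} (ha : a < n) (X : C) :
    nuAt ν n a ha X ≫ gamAt γ n a ha.le X = 𝟙 _ := by
  induction a generalizing n with
  | zero =>
    obtain ⟨n, rfl⟩ : ∃ n', n = n' + 1 := ⟨n - 1, by omega⟩
    exact counit _
  | succ a ih =>
    obtain ⟨n, rfl⟩ : ∃ n', n = n' + 1 := ⟨n - 1, by omega⟩
    exact (map_triangle L (ih (by omega))).trans (L.map_id _)

/-! ### Naturality of the structure maps, and their behaviour under `Tᵐ(Tⁿ X) = Tᵐ⁺ⁿ X` -/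

theorem muAt_naturality {n a : ℕ} (h : a < n) {X Y : C} (f : X ⟶ Y) :
    (iter T (n + 1)).map f ≫ muAt μ n a h Y = muAt μ n a h X ≫ (iter T n).map f := by
  induction a generalizing n with
  | zero =>
    obtain ⟨n, rfl⟩ : ∃ n', n = n' + 1 := ⟨n - 1, by omega⟩
    exact μ.naturality ((iter T n).map f)
  | succ a ih =>
    obtain ⟨n, rfl⟩ : ∃ n', n = n' + 1 := ⟨n - 1, by omega⟩
    exact map_square T (ih (by omega))

theorem etaAt_naturality {n a : ℕ} (h : a ≤ n) {X Y : C} (f : X ⟶ Y) :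
    (iter T n).map f ≫ etaAt η n a h Y = etaAt η n a h X ≫ (iter T (n + 1)).map f := by
  induction a generalizing n with
  | zero =>
    cases n with
    | zero => exact η.naturality f
    | succ n => exact η.naturality ((iter T (n + 1)).map f)
  | succ a ih =>
    obtain ⟨n, rfl⟩ : ∃ n', n = n' + 1 := ⟨n - 1, by omega⟩
    exact map_square T (ih (by omega))

theorem nuAt_naturality {n a : ℕ} (h : a < n) {X Y : C} (f : X ⟶ Y) :
    (iter L n).map f ≫ nuAt ν n a h Y = nuAt ν n a h X ≫ (iter L (n + 1)).map f := by
  induction a generalizing n with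
  | zero =>
    obtain ⟨n, rfl⟩ : ∃ n', n = n' + 1 := ⟨n - 1, by omega⟩
    exact ν.naturality ((iter L n).map f)
  | succ a ih =>
    obtain ⟨n, rfl⟩ : ∃ n', n = n' + 1 := ⟨n - 1, by omega⟩
    exact map_square L (ih (by omega))

theorem gamAt_naturality {n a : ℕ} (h : a ≤ n) {X Y : C} (f : X ⟶ Y) :
    (iter L (n + 1)).map f ≫ gamAt γ n a h Y = gamAt γ n a h X ≫ (iter L n).map f := by
  induction a generalizing n with
  | zero => cases n <;> exact γ.naturality ((iter L _).map f)
  | succ a ih =>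
    obtain ⟨n, rfl⟩ : ∃ n', n = n' + 1 := ⟨n - 1, by omega⟩
    exact map_square L (ih (by omega))

theorem muAt_iterIso {m n p a : ℕ} (h : m + n = p) (ha : a < m) (X : C) :
    muAt μ m a ha ((iter T n).obj X) ≫ (iterIso T h X).hom =
      (iterIso T (show m + 1 + n = p + 1 by omega) X).hom ≫ muAt μ p a (by omega) X := by
  induction a generalizing m p with
  | zero =>
    obtain ⟨m, rfl⟩ : ∃ m', m = m' + 1 := ⟨m - 1, by omega⟩
    obtain ⟨p, rfl⟩ : ∃ p', p = p' + 1 := ⟨p - 1, by omega⟩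
    rw [iterIso_succ_hom (show m + 1 + n = p + 1 by omega),
      iterIso_succ_hom (show m + n = p by omega)]
    exact (μ.naturality (iterIso T (show m + n = p by omega) X).hom).symm
  | succ a ih =>
    obtain ⟨m, rfl⟩ : ∃ m', m = m' + 1 := ⟨m - 1, by omega⟩
    obtain ⟨p, rfl⟩ : ∃ p', p = p' + 1 := ⟨p - 1, by omega⟩
    rw [iterIso_succ_hom (show m + n = p by omega),
      iterIso_succ_hom (show m + 1 + n = p + 1 by omega)]
    exact map_square T (ih (by omega) (by omega))

theorem map_muAt_iterIso {m n p a : ℕ} (h : m + n = p) (ha : a < n) (X : C) :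
    (iter T m).map (muAt μ n a ha X) ≫ (iterIso T h X).hom =
      (iterIso T (show m + (n + 1) = p + 1 by omega) X).hom ≫ muAt μ p (m + a) (by omega) X := by
  induction m generalizing p with
  | zero =>
    obtain rfl : n = p := by omega
    rw [iterIso_zero, iterIso_zero]
    simp only [Nat.zero_add]
    exact (Category.comp_id _).trans (Category.id_comp _).symm
  | succ m ih =>
    obtain ⟨p, rfl⟩ : ∃ p', p = p' + 1 := ⟨p - 1, by omega⟩
    rw [iterIso_succ_hom (show m + (n + 1) = p + 1 by omega),
      iterIso_succ_hom (show m + n = p by omega)]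
    simp only [Nat.succ_add m a]
    exact map_square T (ih (by omega))

theorem etaAt_iterIso {m n p a : ℕ} (h : m + n = p) (ha : a ≤ m) (X : C) :
    etaAt η m a ha ((iter T n).obj X) ≫
        (iterIso T (show m + 1 + n = p + 1 by omega) X).hom =
      (iterIso T h X).hom ≫ etaAt η p a (by omega) X := by
  induction a generalizing m p with
  | zero =>
    rw [iterIso_succ_hom h]
    cases m <;> cases p <;> exact (η.naturality (iterIso T h X).hom).symm
  | succ a ih =>
    obtain ⟨m, rfl⟩ : ∃ m', m = m' + 1 := ⟨m - 1, by omega⟩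
    obtain ⟨p, rfl⟩ : ∃ p', p = p' + 1 := ⟨p - 1, by omega⟩
    rw [iterIso_succ_hom (show m + n = p by omega),
      iterIso_succ_hom (show m + 1 + n = p + 1 by omega)]
    exact map_square T (ih (by omega) (by omega))

theorem map_etaAt_iterIso {m n p a : ℕ} (h : m + n = p) (ha : a ≤ n) (X : C) :
    (iter T m).map (etaAt η n a ha X) ≫
        (iterIso T (show m + (n + 1) = p + 1 by omega) X).hom =
      (iterIso T h X).hom ≫ etaAt η p (m + a) (by omega) X := by
  induction m generalizing p with
  | zero =>
    obtain rfl : n = p := by omega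
    rw [iterIso_zero, iterIso_zero]
    simp only [Nat.zero_add]
    exact (Category.comp_id _).trans (Category.id_comp _).symm
  | succ m ih =>
    obtain ⟨p, rfl⟩ : ∃ p', p = p' + 1 := ⟨p - 1, by omega⟩
    rw [iterIso_succ_hom (show m + (n + 1) = p + 1 by omega),
      iterIso_succ_hom (show m + n = p by omega)]
    simp only [Nat.succ_add m a]
    exact map_square T (ih (by omega))

theorem nuAt_iterIso {m n p a : ℕ} (h : m + n = p) (ha : a < m) (X : C) :
    nuAt ν m a ha ((iter L n).obj X) ≫
        (iterIso L (show m + 1 + n = p + 1 by omega) X).hom =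
      (iterIso L h X).hom ≫ nuAt ν p a (by omega) X := by
  induction a generalizing m p with
  | zero =>
    obtain ⟨m, rfl⟩ : ∃ m', m = m' + 1 := ⟨m - 1, by omega⟩
    obtain ⟨p, rfl⟩ : ∃ p', p = p' + 1 := ⟨p - 1, by omega⟩
    rw [iterIso_succ_hom (show m + 1 + n = p + 1 by omega),
      iterIso_succ_hom (show m + n = p by omega)]
    exact (ν.naturality (iterIso L (show m + n = p by omega) X).hom).symm
  | succ a ih =>
    obtain ⟨m, rfl⟩ : ∃ m', m = m' + 1 := ⟨m - 1, by omega⟩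
    obtain ⟨p, rfl⟩ : ∃ p', p = p' + 1 := ⟨p - 1, by omega⟩
    rw [iterIso_succ_hom (show m + n = p by omega),
      iterIso_succ_hom (show m + 1 + n = p + 1 by omega)]
    exact map_square L (ih (by omega) (by omega))

theorem map_nuAt_iterIso {m n p a : ℕ} (h : m + n = p) (ha : a < n) (X : C) :
    (iter L m).map (nuAt ν n a ha X) ≫
        (iterIso L (show m + (n + 1) = p + 1 by omega) X).hom =
      (iterIso L h X).hom ≫ nuAt ν p (m + a) (by omega) X := by
  induction m generalizing p with
  | zero =>
    obtain rfl : n = p := by omega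
    rw [iterIso_zero, iterIso_zero]
    simp only [Nat.zero_add]
    exact (Category.comp_id _).trans (Category.id_comp _).symm
  | succ m ih =>
    obtain ⟨p, rfl⟩ : ∃ p', p = p' + 1 := ⟨p - 1, by omega⟩
    rw [iterIso_succ_hom (show m + (n + 1) = p + 1 by omega),
      iterIso_succ_hom (show m + n = p by omega)]
    simp only [Nat.succ_add m a]
    exact map_square L (ih (by omega))

theorem gamAt_iterIso {m n p a : ℕ} (h : m + n = p) (ha : a ≤ m) (X : C) :
    gamAt γ m a ha ((iter L n).obj X) ≫ (iterIso L h X).hom =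
      (iterIso L (show m + 1 + n = p + 1 by omega) X).hom ≫ gamAt γ p a (by omega) X := by
  induction a generalizing m p with
  | zero =>
    rw [iterIso_succ_hom h]
    cases m <;> cases p <;> exact (γ.naturality (iterIso L h X).hom).symm
  | succ a ih =>
    obtain ⟨m, rfl⟩ : ∃ m', m = m' + 1 := ⟨m - 1, by omega⟩
    obtain ⟨p, rfl⟩ : ∃ p', p = p' + 1 := ⟨p - 1, by omega⟩
    rw [iterIso_succ_hom (show m + n = p by omega),
      iterIso_succ_hom (show m + 1 + n = p + 1 by omega)]
    exact map_square L (ih (by omega) (by omega))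

theorem map_gamAt_iterIso {m n p a : ℕ} (h : m + n = p) (ha : a ≤ n) (X : C) :
    (iter L m).map (gamAt γ n a ha X) ≫ (iterIso L h X).hom =
      (iterIso L (show m + (n + 1) = p + 1 by omega) X).hom ≫ gamAt γ p (m + a) (by omega) X := by
  induction m generalizing p with
  | zero =>
    obtain rfl : n = p := by omega
    rw [iterIso_zero, iterIso_zero]
    simp only [Nat.zero_add]
    exact (Category.comp_id _).trans (Category.id_comp _).symm
  | succ m ih =>
    obtain ⟨p, rfl⟩ : ∃ p', p = p' + 1 := ⟨p - 1, by omega⟩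
    rw [iterIso_succ_hom (show m + (n + 1) = p + 1 by omega),
      iterIso_succ_hom (show m + n = p by omega)]
    simp only [Nat.succ_add m a]
    exact map_square L (ih (by omega))

end Iterates

end

end SimplicialDeformation

namespace SimplicialDeformation

universe v₁ u₁

noncomputable section

/-! ### Mixed distributive laws and the double complex of an object -/

section MixedLaw

variable {C : Type u₁} [Category.{v₁} C]

/-- Pasting of two commutative squares. Like `map_square`, it serves to compose squares whose
objects agree only up to unfolding of `iter`. -/
theorem paste_squares {X₀ X₁ X₂ Y₀ Y₁ Y₂ : C} {f : X₀ ⟶ Y₀} {b : Y₀ ⟶ Y₁} {c : Y₁ ⟶ Y₂}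
    {b' : X₀ ⟶ X₁} {c' : X₁ ⟶ X₂} {e' : X₁ ⟶ Y₁} {e : X₂ ⟶ Y₂} (h₁ : f ≫ b = b' ≫ e')
    (h₂ : e' ≫ c = c' ≫ e) : f ≫ b ≫ c = (b' ≫ c') ≫ e := by
  rw [reassoc_of% h₁, h₂, Category.assoc]

theorem paste_square_triangle {X₀ X₁ Y₀ Y₁ Y₂ : C} {f : X₀ ⟶ Y₀} {b : Y₀ ⟶ Y₁} {c : Y₁ ⟶ Y₂}
    {b' : X₀ ⟶ X₁} {e' : X₁ ⟶ Y₁} {g : X₁ ⟶ Y₂} (h₁ : f ≫ b = b' ≫ e') (h₂ : e' ≫ c = g) :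
    f ≫ b ≫ c = b' ≫ g := by
  rw [reassoc_of% h₁, h₂]

theorem iter_succ_obj (T : C ⥤ C) (n : ℕ) (X : C) :
    (iter T (n + 1)).obj X = T.obj ((iter T n).obj X) := rfl

theorem iter_succ_map (T : C ⥤ C) (n : ℕ) {X Y : C} (f : X ⟶ Y) :
    (iter T (n + 1)).map f = T.map ((iter T n).map f) := rfl

/-- A mixed distributive law `d : TL → LT` of a monad `(T, η, μ)` over a comonad `(L, γ, ν)`. -/
structure MixedLaw (T L : C ⥤ C) where
  η : 𝟭 C ⟶ T
  μ : T ⋙ T ⟶ T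
  γ : L ⟶ 𝟭 C
  ν : L ⟶ L ⋙ L
  d : L ⋙ T ⟶ T ⋙ L
  η_μ (X : C) : η.app (T.obj X) ≫ μ.app X = 𝟙 (T.obj X)
  map_η_μ (X : C) : T.map (η.app X) ≫ μ.app X = 𝟙 (T.obj X)
  assoc (X : C) : T.map (μ.app X) ≫ μ.app X = μ.app (T.obj X) ≫ μ.app X
  ν_γ (X : C) : ν.app X ≫ γ.app (L.obj X) = 𝟙 (L.obj X)
  ν_map_γ (X : C) : ν.app X ≫ L.map (γ.app X) = 𝟙 (L.obj X)
  coassoc (X : C) : ν.app X ≫ L.map (ν.app X) = ν.app X ≫ ν.app (L.obj X)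
  η_d (X : C) : η.app (L.obj X) ≫ d.app X = L.map (η.app X)
  μ_d (X : C) : μ.app (L.obj X) ≫ d.app X =
    T.map (d.app X) ≫ d.app (T.obj X) ≫ L.map (μ.app X)
  d_γ (X : C) : d.app X ≫ γ.app (T.obj X) = T.map (γ.app X)
  d_ν (X : C) : d.app X ≫ ν.app (T.obj X) =
    T.map (ν.app X) ≫ d.app (L.obj X) ≫ L.map (d.app X)

section Swap

variable {T L : C ⥤ C} (d : L ⋙ T ⟶ T ⋙ L)

theorem iterSwapOne_naturality (n : ℕ) {X Y : C} (f : X ⟶ Y) :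
    T.map ((iter L n).map f) ≫ iterSwapOne d n Y =
      iterSwapOne d n X ≫ (iter L n).map (T.map f) := by
  induction n with
  | zero => exact (Category.comp_id _).trans (Category.id_comp _).symm
  | succ n ih =>
    have h := d.naturality ((iter L n).map f)
    dsimp only [Functor.comp_obj, Functor.comp_map, iter_succ_obj, iter_succ_map, iterSwapOne]
      at h ⊢
    rw [reassoc_of% h, Category.assoc, ← L.map_comp, ← L.map_comp, ih]

theorem iterSwap_naturality (m n : ℕ) {X Y : C} (f : X ⟶ Y) :
    (iter T m).map ((iter L n).map f) ≫ iterSwap d m n Y =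
      iterSwap d m n X ≫ (iter L n).map ((iter T m).map f) := by
  induction m with
  | zero => exact (Category.comp_id _).trans (Category.id_comp _).symm
  | succ m ih =>
    dsimp only [iter_succ_obj, iter_succ_map, iterSwap]
    rw [← T.map_comp_assoc, ih, T.map_comp_assoc, iterSwapOne_naturality, Category.assoc]

theorem iterSwap_add_left {l m a : ℕ} (n : ℕ) (h : l + m = a) (X : C) :
    (iterIso T h ((iter L n).obj X)).hom ≫ iterSwap d a n X =
      (iter T l).map (iterSwap d m n X) ≫ iterSwap d l n ((iter T m).obj X) ≫
        (iter L n).map (iterIso T h X).hom := by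
  induction l generalizing a with
  | zero =>
    obtain rfl : m = a := by omega
    rw [iterIso_zero, iterIso_zero]
    refine (Category.id_comp _).trans ?_
    change _ = iterSwap d m n X ≫ 𝟙 _ ≫ (iter L n).map (𝟙 _)
    rw [CategoryTheory.Functor.map_id, Category.comp_id, Category.comp_id]
  | succ l ih =>
    obtain ⟨a, rfl⟩ : ∃ a', a = a' + 1 := ⟨a - 1, by omega⟩
    rw [iterIso_succ_hom (show l + m = a by omega), iterIso_succ_hom (show l + m = a by omega)]
    dsimp only [iter_succ_obj, iter_succ_map, iterSwap]
    rw [← T.map_comp_assoc, ih, T.map_comp_assoc, T.map_comp_assoc, iterSwapOne_naturality,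
      Category.assoc]

theorem iterSwapOne_add {m n b : ℕ} (h : m + n = b) (X : C) :
    T.map (iterIso L h X).hom ≫ iterSwapOne d b X =
      iterSwapOne d m ((iter L n).obj X) ≫ (iter L m).map (iterSwapOne d n X) ≫
        (iterIso L h (T.obj X)).hom := by
  induction m generalizing b with
  | zero =>
    obtain rfl : n = b := by omega
    rw [iterIso_zero, iterIso_zero]
    change T.map (𝟙 _) ≫ _ = 𝟙 _ ≫ iterSwapOne d n X ≫ 𝟙 _
    rw [CategoryTheory.Functor.map_id, Category.id_comp, Category.id_comp, Category.comp_id]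
  | succ m ih =>
    obtain ⟨b, rfl⟩ : ∃ b', b = b' + 1 := ⟨b - 1, by omega⟩
    rw [iterIso_succ_hom (show m + n = b by omega), iterIso_succ_hom (show m + n = b by omega)]
    have h' := d.naturality (iterIso L (show m + n = b by omega) X).hom
    dsimp only [Functor.comp_obj, Functor.comp_map, iter_succ_obj, iter_succ_map, iterSwapOne]
      at h' ⊢
    rw [reassoc_of% h', ← L.map_comp, ih, L.map_comp, L.map_comp, Category.assoc]

theorem iterSwap_add_right (l : ℕ) {m n b : ℕ} (h : m + n = b) (X : C) :
    (iter T l).map (iterIso L h X).hom ≫ iterSwap d l b X =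
      iterSwap d l m ((iter L n).obj X) ≫ (iter L m).map (iterSwap d l n X) ≫
        (iterIso L h ((iter T l).obj X)).hom := by
  induction l with
  | zero =>
    change (iterIso L h X).hom ≫ 𝟙 _ = 𝟙 _ ≫ (iter L m).map (𝟙 _) ≫ (iterIso L h X).hom
    rw [CategoryTheory.Functor.map_id, Category.id_comp, Category.id_comp, Category.comp_id]
  | succ l ih =>
    dsimp only [iter_succ_obj, iter_succ_map, iterSwap]
    rw [← T.map_comp_assoc, ih, T.map_comp_assoc, T.map_comp_assoc, iterSwapOne_add,
      (iter L m).map_comp, Category.assoc, Category.assoc,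
      reassoc_of% iterSwapOne_naturality d m (iterSwap d l n X)]

end Swap

namespace MixedLaw

variable {T L : C ⥤ C} (M : MixedLaw T L)

/-! #### Compatibility of the iterated distributive law with the structure maps -/

theorem iterSwapOne_η (n : ℕ) (X : C) :
    M.η.app ((iter L n).obj X) ≫ iterSwapOne M.d n X = (iter L n).map (M.η.app X) := by
  induction n with
  | zero => exact Category.comp_id _
  | succ n ih =>
    dsimp only [iter_succ_obj, iter_succ_map, iterSwapOne]
    rw [reassoc_of% M.η_d, ← ih, L.map_comp]

theorem iterSwapOne_μ (n : ℕ) (X : C) :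
    M.μ.app ((iter L n).obj X) ≫ iterSwapOne M.d n X =
      T.map (iterSwapOne M.d n X) ≫ iterSwapOne M.d n (T.obj X) ≫
        (iter L n).map (M.μ.app X) := by
  induction n with
  | zero =>
    change M.μ.app X ≫ 𝟙 _ = T.map (𝟙 _) ≫ 𝟙 _ ≫ M.μ.app X
    rw [CategoryTheory.Functor.map_id, Category.id_comp, Category.id_comp, Category.comp_id]
  | succ n ih =>
    have h := M.d.naturality (iterSwapOne M.d n X)
    dsimp only [Functor.comp_obj, Functor.comp_map, iter_succ_obj, iter_succ_map, iterSwapOne]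
      at h ⊢
    rw [reassoc_of% M.μ_d, ← L.map_comp, ih, L.map_comp, L.map_comp, T.map_comp, Category.assoc,
      Category.assoc, reassoc_of% h]

theorem iterSwapOne_ν {n a : ℕ} (h : a < n) (X : C) :
    T.map (nuAt M.ν n a h X) ≫ iterSwapOne M.d (n + 1) X =
      iterSwapOne M.d n X ≫ nuAt M.ν n a h (T.obj X) := by
  induction a generalizing n with
  | zero =>
    obtain ⟨n, rfl⟩ : ∃ n', n = n' + 1 := ⟨n - 1, by omega⟩
    have h := M.ν.naturality (iterSwapOne M.d n X)
    dsimp only [Functor.comp_obj, Functor.comp_map, iter_succ_obj, iter_succ_map, iterSwapOne,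
      nuAt] at h ⊢
    rw [Category.assoc, h, reassoc_of% M.d_ν, L.map_comp]
  | succ a ih =>
    obtain ⟨n, rfl⟩ : ∃ n', n = n' + 1 := ⟨n - 1, by omega⟩
    exact paste_squares (M.d.naturality (nuAt M.ν n a (by omega) X))
      (map_square L (ih (by omega)))

theorem iterSwapOne_γ {n a : ℕ} (h : a ≤ n) (X : C) :
    T.map (gamAt M.γ n a h X) ≫ iterSwapOne M.d n X =
      iterSwapOne M.d (n + 1) X ≫ gamAt M.γ n a h (T.obj X) := by
  induction a generalizing n with
  | zero =>
    have key : T.map (M.γ.app ((iter L n).obj X)) ≫ iterSwapOne M.d n X =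
        (M.d.app ((iter L n).obj X) ≫ L.map (iterSwapOne M.d n X)) ≫
          M.γ.app ((iter L n).obj (T.obj X)) := by
      rw [← M.d_γ, Category.assoc, Category.assoc, M.γ.naturality]
      rfl
    cases n <;> exact key
  | succ a ih =>
    obtain ⟨n, rfl⟩ : ∃ n', n = n' + 1 := ⟨n - 1, by omega⟩
    exact paste_squares (M.d.naturality (gamAt M.γ n a (by omega) X))
      (map_square L (ih (by omega)))

theorem iterSwap_ν (m : ℕ) {n a : ℕ} (h : a < n) (X : C) :
    (iter T m).map (nuAt M.ν n a h X) ≫ iterSwap M.d m (n + 1) X =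
      iterSwap M.d m n X ≫ nuAt M.ν n a h ((iter T m).obj X) := by
  induction m with
  | zero => exact (Category.comp_id _).trans (Category.id_comp _).symm
  | succ m ih =>
    exact paste_squares (map_square T ih) (M.iterSwapOne_ν h ((iter T m).obj X))

theorem iterSwap_γ (m : ℕ) {n a : ℕ} (h : a ≤ n) (X : C) :
    (iter T m).map (gamAt M.γ n a h X) ≫ iterSwap M.d m n X =
      iterSwap M.d m (n + 1) X ≫ gamAt M.γ n a h ((iter T m).obj X) := by
  induction m with
  | zero => exact (Category.comp_id _).trans (Category.id_comp _).symm
  | succ m ih =>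
    exact paste_squares (map_square T ih) (M.iterSwapOne_γ h ((iter T m).obj X))

theorem iterSwap_μ {m a : ℕ} (n : ℕ) (h : a < m) (X : C) :
    iterSwap M.d (m + 1) n X ≫ (iter L n).map (muAt M.μ m a h X) =
      muAt M.μ m a h ((iter L n).obj X) ≫ iterSwap M.d m n X := by
  induction a generalizing m with
  | zero =>
    obtain ⟨m, rfl⟩ : ∃ m', m = m' + 1 := ⟨m - 1, by omega⟩
    have h := M.μ.naturality (iterSwap M.d m n X)
    dsimp only [Functor.comp_obj, Functor.comp_map, iter_succ_obj, iter_succ_map, iterSwap,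
      muAt] at h ⊢
    rw [← reassoc_of% h, iterSwapOne_μ, T.map_comp]
    simp only [Category.assoc]
  | succ a ih =>
    obtain ⟨m, rfl⟩ : ∃ m', m = m' + 1 := ⟨m - 1, by omega⟩
    exact (paste_squares (map_square T (ih (by omega)).symm)
      (iterSwapOne_naturality M.d n (muAt M.μ m a (by omega) X))).symm

theorem iterSwap_η {m a : ℕ} (n : ℕ) (h : a ≤ m) (X : C) :
    iterSwap M.d m n X ≫ (iter L n).map (etaAt M.η m a h X) =
      etaAt M.η m a h ((iter L n).obj X) ≫ iterSwap M.d (m + 1) n X := by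
  induction a generalizing m with
  | zero =>
    have key := paste_square_triangle (M.η.naturality (iterSwap M.d m n X)).symm
      (M.iterSwapOne_η n ((iter T m).obj X))
    cases m <;> exact key.symm
  | succ a ih =>
    obtain ⟨m, rfl⟩ : ∃ m', m = m' + 1 := ⟨m - 1, by omega⟩
    exact (paste_squares (map_square T (ih (by omega)).symm)
      (iterSwapOne_naturality M.d n (etaAt M.η m a (by omega) X))).symm

/-! #### The operations on the maps `Tⁿ X → Lⁿ X` -/

/-- The product `g * h = Lⁿ(g) ∘ dᵐⁿ ∘ Tᵐ(h)`. -/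
def prod {m n p : ℕ} (e : m + n = p) {X : C} (g : (iter T m).obj X ⟶ (iter L m).obj X)
    (h : (iter T n).obj X ⟶ (iter L n).obj X) : (iter T p).obj X ⟶ (iter L p).obj X :=
  (iterIso T e X).inv ≫ (iter T m).map h ≫ iterSwap M.d m n X ≫ (iter L n).map g ≫
    (iterIso L ((Nat.add_comm n m).trans e) X).hom

/-- The coface `∂ⁱ(g) = Lⁿ⁻ⁱ ν Lⁱ⁻¹ ∘ g ∘ Tⁱ⁻¹ μ Tⁿ⁻ⁱ`. -/
def face {n : ℕ} (i : ℕ) (hi : 1 ≤ i) (hn : i ≤ n) {X : C}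
    (g : (iter T n).obj X ⟶ (iter L n).obj X) :
    (iter T (n + 1)).obj X ⟶ (iter L (n + 1)).obj X :=
  muAt M.μ n (i - 1) (by omega) X ≫ g ≫ nuAt M.ν n (n - i) (by omega) X

/-- The codegeneracy `σⁱ(g) = Lⁿ⁻ⁱ γ Lⁱ ∘ g ∘ Tⁱ η Tⁿ⁻ⁱ`. -/
def degen {n : ℕ} (i : ℕ) (hn : i ≤ n) {X : C}
    (g : (iter T (n + 1)).obj X ⟶ (iter L (n + 1)).obj X) :
    (iter T n).obj X ⟶ (iter L n).obj X :=
  etaAt M.η n i hn X ≫ g ≫ gamAt M.γ n (n - i) (by omega) X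

variable {X : C}

theorem prod_eq {m n p : ℕ} (e : m + n = p) (g : (iter T m).obj X ⟶ (iter L m).obj X)
    (h : (iter T n).obj X ⟶ (iter L n).obj X) :
    (iterIso T e X).hom ≫ M.prod e g h = (iter T m).map h ≫ iterSwap M.d m n X ≫
      (iter L n).map g ≫ (iterIso L ((Nat.add_comm n m).trans e) X).hom :=
  Iso.hom_inv_id_assoc _ _

theorem prod_assoc {l m n a b p : ℕ} (h₁ : l + m = a) (h₂ : a + n = p) (h₃ : m + n = b)
    (h₄ : l + b = p) (x : (iter T l).obj X ⟶ (iter L l).obj X)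
    (y : (iter T m).obj X ⟶ (iter L m).obj X) (z : (iter T n).obj X ⟶ (iter L n).obj X) :
    M.prod h₂ (M.prod h₁ x y) z = M.prod h₄ x (M.prod h₃ y z) := by
  have key := iterIso_assoc (T := T) h₁ h₂ h₃ h₄ X
  have key' := iterIso_assoc (T := L) ((Nat.add_comm n m).trans h₃)
    ((Nat.add_comm b l).trans h₄) ((Nat.add_comm m l).trans h₁) ((Nat.add_comm n a).trans h₂) X
  rw [← cancel_epi ((iterIso T h₁ ((iter T n).obj X)).hom ≫ (iterIso T h₂ X).hom), Category.assoc,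
    prod_eq, key, Category.assoc, prod_eq, ← (iter T l).map_comp_assoc, prod_eq]
  rw [← reassoc_of% iterIso_naturality h₁ z, reassoc_of% iterSwap_add_left M.d n h₁ X,
    ← (iter L n).map_comp_assoc, prod_eq]
  simp only [CategoryTheory.Functor.map_comp, Category.assoc]
  rw [reassoc_of% iterSwap_add_right M.d l ((Nat.add_comm n m).trans h₃) X, ← key',
    ← reassoc_of% iterIso_naturality ((Nat.add_comm n m).trans h₃) x,
    ← reassoc_of% iterSwap_naturality M.d l n y]

theorem one_prod {n : ℕ} (x : (iter T n).obj X ⟶ (iter L n).obj X) :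
    M.prod (Nat.zero_add n) (𝟙 X) x = x := by
  unfold prod
  rw [iterIso_zero, iterIso_right_zero]
  change 𝟙 _ ≫ x ≫ 𝟙 _ ≫ (iter L n).map (𝟙 X) ≫ 𝟙 _ = x
  simp

theorem iterSwap_zero (m : ℕ) (X : C) : iterSwap M.d m 0 X = 𝟙 _ := by
  induction m with
  | zero => rfl
  | succ m ih =>
    rw [iterSwap, ih]
    exact (Category.comp_id _).trans (T.map_id _)

theorem prod_one {n : ℕ} (x : (iter T n).obj X ⟶ (iter L n).obj X) :
    M.prod (Nat.add_zero n) x (𝟙 X) = x := by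
  rw [← cancel_epi (iterIso T (Nat.add_zero n) X).hom]
  refine (M.prod_eq (n := 0) (Nat.add_zero n) x (𝟙 X)).trans ?_
  rw [iterIso_zero, iterIso_right_zero, iterSwap_zero]
  change (iter T n).map (𝟙 X) ≫ 𝟙 _ ≫ x ≫ 𝟙 _ = 𝟙 _ ≫ x
  simp

theorem face_face {n : ℕ} (i j : ℕ) (hi : 1 ≤ i) (hij : i < j) (hj : j ≤ n + 1)
    (x : (iter T n).obj X ⟶ (iter L n).obj X) :
    M.face j (by omega) hj (M.face i hi (by omega) x) =
      M.face i hi (by omega) (M.face (j - 1) (by omega) (by omega) x) := by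
  obtain ⟨a, rfl⟩ : ∃ a, i = a + 1 := ⟨i - 1, by omega⟩
  obtain ⟨b, rfl⟩ : ∃ b, j = b + 2 := ⟨j - 2, by omega⟩
  have h1 := muAt_muAt M.assoc (show a ≤ b by omega) (show b < n by omega) X
  have h2 := nuAt_nuAt (n := n) M.coassoc (show n - (b + 1) ≤ n - (a + 1) by omega) (by omega) X
  simp only [show n - (a + 1) + 1 = n + 1 - (a + 1) by omega] at h2
  simp only [face, Nat.add_sub_cancel, show b + 2 - 1 = b + 1 by omega,
    show n + 1 - (b + 2) = n - (b + 1) by omega, Category.assoc, h2, reassoc_of% h1]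

theorem degen_degen {n : ℕ} (i j : ℕ) (hij : i ≤ j) (hj : j ≤ n)
    (x : (iter T (n + 1 + 1)).obj X ⟶ (iter L (n + 1 + 1)).obj X) :
    M.degen j hj (M.degen i (by omega) x) =
      M.degen i (by omega) (M.degen (j + 1) (by omega) x) := by
  have h1 := etaAt_etaAt (η := M.η) hij hj X
  have h2 := gamAt_gamAt (n := n) (γ := M.γ) (show n - j ≤ n - i by omega) (by omega) X
  simp only [show n - i + 1 = n + 1 - i by omega] at h2
  simp only [degen, show n + 1 - (j + 1) = n - j by omega, Category.assoc, h2, reassoc_of% h1]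

theorem degen_face_of_lt {n : ℕ} (i j : ℕ) (hi : 1 ≤ i) (hij : i < j) (hj : j ≤ n + 1)
    (x : (iter T (n + 1)).obj X ⟶ (iter L (n + 1)).obj X) :
    M.degen j hj (M.face i hi (by omega) x) =
      M.face i hi (by omega) (M.degen (j - 1) (by omega) x) := by
  obtain ⟨a, rfl⟩ : ∃ a, i = a + 1 := ⟨i - 1, by omega⟩
  obtain ⟨b, rfl⟩ : ∃ b, j = b + 1 := ⟨j - 1, by omega⟩
  have h1 := etaAt_muAt_of_lt (η := M.η) (μ := M.μ) (show a < b by omega) (by omega : b ≤ n) X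
  have h2 := nuAt_gamAt_of_gt (n := n) (γ := M.γ) (ν := M.ν) (show n - b ≤ n - (a + 1) by omega)
    (by omega) X
  simp only [show n - (a + 1) + 1 = n + 1 - (a + 1) by omega] at h2
  simp only [face, degen, Nat.add_sub_cancel, show n + 1 - (b + 1) = n - b by omega,
    Category.assoc, h2, reassoc_of% h1]

theorem degen_face_self {n : ℕ} (j : ℕ) (hj : 1 ≤ j) (hn : j ≤ n)
    (x : (iter T n).obj X ⟶ (iter L n).obj X) : M.degen j hn (M.face j hj hn x) = x := by
  obtain ⟨a, rfl⟩ : ∃ a, j = a + 1 := ⟨j - 1, by omega⟩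
  have h1 := etaAt_succ_muAt M.map_η_μ (show a < n by omega) X
  have h2 := nuAt_gamAt_self M.ν_γ (show n - (a + 1) < n by omega) X
  simp only [face, degen, Nat.add_sub_cancel, Category.assoc, h2, reassoc_of% h1,
    Category.comp_id]

theorem degen_face_succ {n : ℕ} (j : ℕ) (hn : j + 1 ≤ n)
    (x : (iter T n).obj X ⟶ (iter L n).obj X) :
    M.degen j (by omega) (M.face (j + 1) (by omega) hn x) = x := by
  have h1 := etaAt_muAt_self M.η_μ (show j < n by omega) X
  have h2 := nuAt_gamAt_succ M.ν_map_γ (show n - (j + 1) < n by omega) X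
  simp only [show n - (j + 1) + 1 = n - j by omega] at h2
  simp only [face, degen, Nat.add_sub_cancel, Category.assoc, h2, reassoc_of% h1,
    Category.comp_id]

theorem degen_face_of_gt {n : ℕ} (i j : ℕ) (hij : j + 1 < i) (hi : i ≤ n + 1)
    (x : (iter T (n + 1)).obj X ⟶ (iter L (n + 1)).obj X) :
    M.degen j (by omega) (M.face i (by omega) hi x) =
      M.face (i - 1) (by omega) (by omega) (M.degen j (by omega) x) := by
  obtain ⟨a, rfl⟩ : ∃ a, i = a + 2 := ⟨i - 2, by omega⟩
  have h1 := etaAt_muAt_of_gt (η := M.η) (μ := M.μ) (show j ≤ a by omega) (by omega : a < n) X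
  have h2 := nuAt_gamAt_of_lt (n := n) (γ := M.γ) (ν := M.ν) (show n - (a + 1) < n - j by omega)
    (by omega) X
  simp only [show n - j + 1 = n + 1 - j by omega] at h2
  simp only [face, degen, show a + 2 - 1 = a + 1 by omega, Nat.add_sub_cancel,
    show n + 1 - (a + 2) = n - (a + 1) by omega, Category.assoc, h2, reassoc_of% h1]

theorem face_prod {m n p : ℕ} (h : m + n = p) (i : ℕ) (hi : 1 ≤ i) (hm : i ≤ m)
    (x : (iter T m).obj X ⟶ (iter L m).obj X) (y : (iter T n).obj X ⟶ (iter L n).obj X) :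
    M.prod (show m + 1 + n = p + 1 by omega) (M.face i hi hm x) y =
      M.face i hi (by omega) (M.prod h x y) := by
  have h1 := muAt_iterIso (μ := M.μ) h (show i - 1 < m by omega) X
  have h2 := map_nuAt_iterIso (ν := M.ν) ((Nat.add_comm n m).trans h)
    (show m - i < m by omega) X
  simp only [show n + (m - i) = p - i by omega] at h2
  rw [← cancel_epi (iterIso T (show m + 1 + n = p + 1 by omega) X).hom, prod_eq, face, face,
    ← reassoc_of% h1, reassoc_of% prod_eq M h x y]
  simp only [CategoryTheory.Functor.map_comp, Category.assoc]
  rw [h2, reassoc_of% M.iterSwap_μ n (show i - 1 < m by omega) X,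
    reassoc_of% muAt_naturality (μ := M.μ) (show i - 1 < m by omega) y]

theorem prod_face {m n p : ℕ} (h : m + n = p) (i : ℕ) (hi : 1 ≤ i) (hn : i ≤ n)
    (x : (iter T m).obj X ⟶ (iter L m).obj X) (y : (iter T n).obj X ⟶ (iter L n).obj X) :
    M.prod (show m + (n + 1) = p + 1 by omega) x (M.face i hi hn y) =
      M.face (i + m) (by omega) (by omega) (M.prod h x y) := by
  have h1 := map_muAt_iterIso (μ := M.μ) h (show i - 1 < n by omega) X
  have h2 := nuAt_iterIso (ν := M.ν) ((Nat.add_comm n m).trans h)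
    (show n - i < n by omega) X
  simp only [show m + (i - 1) = i + m - 1 by omega] at h1
  simp only [show n - i = p - (i + m) by omega] at h2
  rw [← cancel_epi (iterIso T (show m + (n + 1) = p + 1 by omega) X).hom, prod_eq, face, face,
    ← reassoc_of% h1, reassoc_of% prod_eq M h x y]
  simp only [CategoryTheory.Functor.map_comp, Category.assoc, show n - i = p - (i + m) by omega]
  rw [← h2, reassoc_of% M.iterSwap_ν m (show p - (i + m) < n by omega) X,
    reassoc_of% nuAt_naturality (ν := M.ν) (show p - (i + m) < n by omega) x]

theorem degen_prod {m n p : ℕ} (h : m + n = p) (i : ℕ) (hm : i ≤ m)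
    (x : (iter T (m + 1)).obj X ⟶ (iter L (m + 1)).obj X)
    (y : (iter T n).obj X ⟶ (iter L n).obj X) :
    M.prod h (M.degen i hm x) y =
      M.degen i (by omega) (M.prod (show m + 1 + n = p + 1 by omega) x y) := by
  have h1 := etaAt_iterIso (η := M.η) h hm X
  have h2 := map_gamAt_iterIso (γ := M.γ) ((Nat.add_comm n m).trans h)
    (show m - i ≤ m by omega) X
  simp only [show n + (m - i) = p - i by omega] at h2
  rw [← cancel_epi (iterIso T h X).hom, prod_eq, degen, degen,
    ← reassoc_of% h1, reassoc_of% prod_eq M (show m + 1 + n = p + 1 by omega) x y]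
  simp only [CategoryTheory.Functor.map_comp, Category.assoc]
  rw [h2, reassoc_of% M.iterSwap_η n hm X, reassoc_of% etaAt_naturality (η := M.η) hm y]

theorem prod_degen {m n p : ℕ} (h : m + n = p) (i : ℕ) (hn : i ≤ n)
    (x : (iter T m).obj X ⟶ (iter L m).obj X)
    (y : (iter T (n + 1)).obj X ⟶ (iter L (n + 1)).obj X) :
    M.prod h x (M.degen i hn y) =
      M.degen (i + m) (by omega) (M.prod (show m + (n + 1) = p + 1 by omega) x y) := by
  have h1 := map_etaAt_iterIso (η := M.η) h hn X
  have h2 := gamAt_iterIso (γ := M.γ) ((Nat.add_comm n m).trans h) (show n - i ≤ n by omega) X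
  simp only [show m + i = i + m by omega] at h1
  simp only [show n - i = p - (i + m) by omega] at h2
  rw [← cancel_epi (iterIso T h X).hom, prod_eq, degen, degen,
    ← reassoc_of% h1, reassoc_of% prod_eq M (show m + (n + 1) = p + 1 by omega) x y]
  simp only [CategoryTheory.Functor.map_comp, Category.assoc, show n - i = p - (i + m) by omega]
  rw [← h2, reassoc_of% M.iterSwap_γ m (show p - (i + m) ≤ n by omega) X,
    reassoc_of% gamAt_naturality (γ := M.γ) (show p - (i + m) ≤ n by omega) x]

end MixedLaw

end MixedLaw

end

end SimplicialDeformation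

namespace SimplicialDeformation

universe v₁ u₁

noncomputable section

/-! ### Bialgebras for a mixed distributive law -/

section Bialgebras

variable {C : Type u₁} [Category.{v₁} C] {T L : C ⥤ C}

/-- The iterated action `Tⁿ X → X` of `h : T X → X`. -/
def actPow {X : C} (h : T.obj X ⟶ X) : (n : ℕ) → ((iter T n).obj X ⟶ X)
  | 0 => 𝟙 X
  | n + 1 => T.map (actPow h n) ≫ h

/-- The iterated coaction `X → Lⁿ X` of `v : X → L X`. -/
def coactPow {X : C} (v : X ⟶ L.obj X) : (n : ℕ) → (X ⟶ (iter L n).obj X)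
  | 0 => 𝟙 X
  | n + 1 => v ≫ L.map (coactPow v n)

theorem actPow_iterIso {X : C} (h : T.obj X ⟶ X) {m n p : ℕ} (e : m + n = p) :
    (iterIso T e X).hom ≫ actPow h p = (iter T m).map (actPow h n) ≫ actPow h m := by
  induction m generalizing p with
  | zero =>
    obtain rfl : n = p := by omega
    rw [iterIso_zero]
    exact (Category.id_comp _).trans (Category.comp_id _).symm
  | succ m ih =>
    obtain ⟨p, rfl⟩ : ∃ p', p = p' + 1 := ⟨p - 1, by omega⟩
    rw [iterIso_succ_hom (show m + n = p by omega)]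
    dsimp only [iter_succ_obj, iter_succ_map, actPow]
    rw [← T.map_comp_assoc, ih, T.map_comp_assoc]

theorem coactPow_iterIso {X : C} (v : X ⟶ L.obj X) {m n p : ℕ} (e : m + n = p) :
    coactPow v m ≫ (iter L m).map (coactPow v n) ≫ (iterIso L e X).hom = coactPow v p := by
  induction m generalizing p with
  | zero =>
    obtain rfl : n = p := by omega
    rw [iterIso_zero]
    exact (Category.id_comp _).trans (Category.comp_id _)
  | succ m ih =>
    obtain ⟨p, rfl⟩ : ∃ p', p = p' + 1 := ⟨p - 1, by omega⟩
    rw [iterIso_succ_hom (show m + n = p by omega)]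
    dsimp only [iter_succ_obj, iter_succ_map, coactPow]
    rw [Category.assoc, ← L.map_comp, ← L.map_comp, ih]

/-- Maps compatible with actions are compatible with the iterated actions. -/
theorem map_actPow {X Y : C} {h : T.obj X ⟶ X} {h' : T.obj Y ⟶ Y} {f : X ⟶ Y}
    (hf : T.map f ≫ h' = h ≫ f) (n : ℕ) :
    (iter T n).map f ≫ actPow h' n = actPow h n ≫ f := by
  induction n with
  | zero => exact (Category.comp_id _).trans (Category.id_comp _).symm
  | succ n ih =>
    dsimp only [iter_succ_obj, iter_succ_map, actPow]
    rw [← T.map_comp_assoc, ih, T.map_comp_assoc, hf, Category.assoc]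

theorem coactPow_map {X Y : C} {v : X ⟶ L.obj X} {v' : Y ⟶ L.obj Y} {f : X ⟶ Y}
    (hf : f ≫ v' = v ≫ L.map f) (n : ℕ) :
    coactPow v n ≫ (iter L n).map f = f ≫ coactPow v' n := by
  induction n with
  | zero => exact (Category.id_comp _).trans (Category.comp_id _).symm
  | succ n ih =>
    dsimp only [iter_succ_obj, iter_succ_map, coactPow]
    rw [Category.assoc, ← L.map_comp, ih, L.map_comp, reassoc_of% hf]

/-- The map `vⁿ ∘ hⁿ : Tⁿ X → X → Lⁿ X`. -/
def canon {X : C} (h : T.obj X ⟶ X) (v : X ⟶ L.obj X) (n : ℕ) :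
    (iter T n).obj X ⟶ (iter L n).obj X :=
  actPow h n ≫ coactPow v n

theorem canon_naturality {X Y : C} {h : T.obj X ⟶ X} {h' : T.obj Y ⟶ Y} {v : X ⟶ L.obj X}
    {v' : Y ⟶ L.obj Y} {f : X ⟶ Y} (hf : T.map f ≫ h' = h ≫ f) (hf' : f ≫ v' = v ≫ L.map f)
    (n : ℕ) : (iter T n).map f ≫ canon h' v' n = canon h v n ≫ (iter L n).map f := by
  rw [canon, canon, reassoc_of% map_actPow hf, Category.assoc, coactPow_map hf']

theorem canon_zero {X : C} (h : T.obj X ⟶ X) (v : X ⟶ L.obj X) : canon h v 0 = 𝟙 X :=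
  Category.comp_id _

theorem canon_one {X : C} (h : T.obj X ⟶ X) (v : X ⟶ L.obj X) : canon h v 1 = h ≫ v := by
  have h1 : actPow h 1 = h := (congrArg (· ≫ h) (T.map_id X)).trans (Category.id_comp h)
  have h2 : coactPow v 1 = v := (congrArg (v ≫ ·) (L.map_id X)).trans (Category.comp_id v)
  rw [canon, h1, h2]
  rfl

namespace MixedLaw

variable (M : MixedLaw T L)

/-- `(X, h, v)` is a bialgebra: `(X, h)` is a `T`-algebra, `(X, v)` is an `L`-coalgebra, and `h` and
`v` are compatible with the distributive law. -/
structure IsBialgebra {X : C} (h : T.obj X ⟶ X) (v : X ⟶ L.obj X) : Prop where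
  unit : M.η.app X ≫ h = 𝟙 X
  assoc : M.μ.app X ≫ h = T.map h ≫ h
  counit : v ≫ M.γ.app X = 𝟙 X
  coassoc : v ≫ M.ν.app X = v ≫ L.map v
  compat : h ≫ v = T.map v ≫ M.d.app X ≫ L.map h

variable {M}

/-- Transport of a bialgebra structure along an isomorphism. -/
theorem IsBialgebra.of_iso {X Y : C} {h : T.obj X ⟶ X} {v : X ⟶ L.obj X}
    (H : M.IsBialgebra h v) (e : X ≅ Y) {h' : T.obj Y ⟶ Y} {v' : Y ⟶ L.obj Y}
    (hh : T.map e.hom ≫ h' = h ≫ e.hom) (hv : e.hom ≫ v' = v ≫ L.map e.hom) :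
    M.IsBialgebra h' v' := by
  obtain rfl : h' = T.map e.inv ≫ h ≫ e.hom := by
    rw [← hh, ← T.map_comp_assoc, e.inv_hom_id, T.map_id, Category.id_comp]
  obtain rfl : v' = e.inv ≫ v ≫ L.map e.hom := by
    rw [← hv, e.inv_hom_id_assoc]
  have hη := M.η.naturality e.inv
  have hμ := M.μ.naturality e.inv
  have hγ := M.γ.naturality e.hom
  have hν := M.ν.naturality e.hom
  have hd := M.d.naturality e.hom
  dsimp at hη hμ hγ hν hd
  constructor
  · rw [← reassoc_of% hη, reassoc_of% H.unit, e.inv_hom_id]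
  · rw [← reassoc_of% hμ, reassoc_of% H.assoc]
    simp
  · rw [Category.assoc, Category.assoc, hγ, reassoc_of% H.counit, e.inv_hom_id]
  · rw [Category.assoc, Category.assoc, hν, reassoc_of% H.coassoc]
    simp
  · simp only [CategoryTheory.Functor.map_comp, Category.assoc, Iso.hom_inv_id_assoc]
    rw [reassoc_of% hd, reassoc_of% H.compat, ← L.map_comp_assoc (T.map e.hom), ← T.map_comp]
    simp

section

variable {X : C} {h : T.obj X ⟶ X} {v : X ⟶ L.obj X}

theorem IsBialgebra.muAt_actPow (H : M.IsBialgebra h v) {n a : ℕ} (ha : a < n) :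
    muAt M.μ n a ha X ≫ actPow h n = actPow h (n + 1) := by
  induction a generalizing n with
  | zero =>
    obtain ⟨n, rfl⟩ : ∃ n', n = n' + 1 := ⟨n - 1, by omega⟩
    have hμ := M.μ.naturality (actPow h n)
    dsimp only [iter_succ_obj, iter_succ_map, actPow, muAt, Functor.comp_map,
      Functor.comp_obj] at hμ ⊢
    rw [← reassoc_of% hμ, H.assoc, T.map_comp_assoc]
  | succ a ih =>
    obtain ⟨n, rfl⟩ : ∃ n', n = n' + 1 := ⟨n - 1, by omega⟩
    exact (Category.assoc _ _ _).symm.trans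
      (congrArg (· ≫ h) (map_triangle T (ih (show a < n by omega))))

theorem IsBialgebra.etaAt_actPow (H : M.IsBialgebra h v) {n a : ℕ} (ha : a ≤ n) :
    etaAt M.η n a ha X ≫ actPow h (n + 1) = actPow h n := by
  induction a generalizing n with
  | zero =>
    have key : M.η.app ((iter T n).obj X) ≫ T.map (actPow h n) ≫ h = actPow h n := by
      rw [← reassoc_of% M.η.naturality (actPow h n), H.unit]
      exact Category.comp_id _
    cases n <;> exact key
  | succ a ih =>
    obtain ⟨n, rfl⟩ : ∃ n', n = n' + 1 := ⟨n - 1, by omega⟩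
    exact (Category.assoc _ _ _).symm.trans
      (congrArg (· ≫ h) (map_triangle T (ih (show a ≤ n by omega))))

theorem IsBialgebra.coactPow_nuAt (H : M.IsBialgebra h v) {n a : ℕ} (ha : a < n) :
    coactPow v n ≫ nuAt M.ν n a ha X = coactPow v (n + 1) := by
  induction a generalizing n with
  | zero =>
    obtain ⟨n, rfl⟩ : ∃ n', n = n' + 1 := ⟨n - 1, by omega⟩
    have hν := M.ν.naturality (coactPow v n)
    dsimp only [iter_succ_obj, iter_succ_map, coactPow, nuAt, Functor.comp_map,
      Functor.comp_obj] at hν ⊢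
    rw [Category.assoc, hν, reassoc_of% H.coassoc, L.map_comp]
  | succ a ih =>
    obtain ⟨n, rfl⟩ : ∃ n', n = n' + 1 := ⟨n - 1, by omega⟩
    exact (Category.assoc _ _ _).trans
      (congrArg (v ≫ ·) (map_triangle L (ih (show a < n by omega))))

theorem IsBialgebra.coactPow_gamAt (H : M.IsBialgebra h v) {n a : ℕ} (ha : a ≤ n) :
    coactPow v (n + 1) ≫ gamAt M.γ n a ha X = coactPow v n := by
  induction a generalizing n with
  | zero =>
    have key : (v ≫ L.map (coactPow v n)) ≫ M.γ.app ((iter L n).obj X) = coactPow v n := by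
      rw [Category.assoc, M.γ.naturality, reassoc_of% H.counit]
      rfl
    cases n <;> exact key
  | succ a ih =>
    obtain ⟨n, rfl⟩ : ∃ n', n = n' + 1 := ⟨n - 1, by omega⟩
    exact (Category.assoc _ _ _).trans
      (congrArg (v ≫ ·) (map_triangle L (ih (show a ≤ n by omega))))

theorem IsBialgebra.iterSwapOne_canon (H : M.IsBialgebra h v) (n : ℕ) :
    T.map (coactPow v n) ≫ iterSwapOne M.d n X ≫ (iter L n).map h = h ≫ coactPow v n := by
  induction n with
  | zero =>
    change T.map (𝟙 X) ≫ 𝟙 _ ≫ h = h ≫ 𝟙 X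
    rw [CategoryTheory.Functor.map_id, Category.id_comp, Category.id_comp, Category.comp_id]
  | succ n ih =>
    have hd := M.d.naturality (coactPow v n)
    dsimp only [iter_succ_obj, iter_succ_map, coactPow, iterSwapOne, Functor.comp_map,
      Functor.comp_obj] at hd ⊢
    rw [T.map_comp, Category.assoc, Category.assoc, reassoc_of% hd, ← L.map_comp, ← L.map_comp, ih,
      reassoc_of% H.compat, L.map_comp]

theorem IsBialgebra.iterSwap_canon (H : M.IsBialgebra h v) (m n : ℕ) :
    (iter T m).map (coactPow v n) ≫ iterSwap M.d m n X ≫ (iter L n).map (actPow h m) =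
      actPow h m ≫ coactPow v n := by
  induction m with
  | zero =>
    change coactPow v n ≫ 𝟙 _ ≫ (iter L n).map (𝟙 X) = 𝟙 X ≫ coactPow v n
    rw [CategoryTheory.Functor.map_id, Category.id_comp, Category.id_comp, Category.comp_id]
  | succ m ih =>
    have hs := iterSwapOne_naturality M.d n (actPow h m)
    dsimp only [iter_succ_obj, iter_succ_map, actPow, iterSwap] at hs ⊢
    rw [(iter L n).map_comp, Category.assoc, ← reassoc_of% hs, ← T.map_comp_assoc,
      ← T.map_comp_assoc, Category.assoc, ih, T.map_comp, Category.assoc, H.iterSwapOne_canon,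
      Category.assoc]

/-- The maps `vⁿ ∘ hⁿ` of a bialgebra are closed under products. -/
theorem IsBialgebra.prod_canon (H : M.IsBialgebra h v) {m n p : ℕ} (e : m + n = p) :
    M.prod e (canon h v m) (canon h v n) = canon h v p := by
  rw [← cancel_epi (iterIso T e X).hom, prod_eq]
  simp only [canon, CategoryTheory.Functor.map_comp, Category.assoc]
  rw [reassoc_of% H.iterSwap_canon m n, coactPow_iterIso, reassoc_of% actPow_iterIso h e]

theorem IsBialgebra.face_canon (H : M.IsBialgebra h v) {n : ℕ} (i : ℕ) (hi : 1 ≤ i)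
    (hn : i ≤ n) : M.face i hi hn (canon h v n) = canon h v (n + 1) := by
  rw [face, canon, Category.assoc, H.coactPow_nuAt, reassoc_of% H.muAt_actPow, canon]

theorem IsBialgebra.degen_canon (H : M.IsBialgebra h v) {n : ℕ} (i : ℕ) (hn : i ≤ n) :
    M.degen i hn (canon h v (n + 1)) = canon h v n := by
  rw [degen, canon, Category.assoc, H.coactPow_gamAt, reassoc_of% H.etaAt_actPow, canon]

end

/-! ### Maurer-Cartan elements are bialgebra structures -/

variable {X : C}

theorem prod_one_one (x y : T.obj X ⟶ L.obj X) :
    M.prod (m := 1) (n := 1) (show 1 + 1 = 2 from rfl) x y =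
      T.map y ≫ M.d.app X ≫ L.map x := by
  have hT : (iterIso T (show 1 + 1 = 2 from rfl) X).hom = 𝟙 (T.obj (T.obj X)) := by
    rw [iterIso_succ_hom (show 0 + 1 = 1 from rfl), iterIso_zero]
    exact T.map_id _
  have hL : (iterIso L (show 1 + 1 = 2 from rfl) X).hom = 𝟙 (L.obj (L.obj X)) := by
    rw [iterIso_succ_hom (show 0 + 1 = 1 from rfl), iterIso_zero]
    exact L.map_id _
  have hd : iterSwap M.d 1 1 X = M.d.app X := by
    change T.map (𝟙 (L.obj X)) ≫ M.d.app X ≫ L.map (𝟙 (T.obj X)) = _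
    simp
  have key := M.prod_eq (m := 1) (n := 1) (show 1 + 1 = 2 from rfl) x y
  rw [hd, hT, hL] at key
  refine (Category.id_comp _).symm.trans (key.trans ?_)
  change T.map y ≫ M.d.app X ≫ L.map x ≫ 𝟙 _ = _
  rw [Category.comp_id]

theorem prod_zero_one (g : X ⟶ X) (x : T.obj X ⟶ L.obj X) :
    M.prod (m := 0) (n := 1) (Nat.zero_add 1) g x = x ≫ L.map g := by
  have key := M.prod_eq (m := 0) (n := 1) (Nat.zero_add 1) g x
  rw [iterIso_zero, iterIso_right_zero] at key
  refine (Category.id_comp _).symm.trans (key.trans ?_)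
  change x ≫ 𝟙 _ ≫ L.map g ≫ 𝟙 _ = _
  rw [Category.comp_id, Category.id_comp]

theorem prod_one_zero (x : T.obj X ⟶ L.obj X) (g : X ⟶ X) :
    M.prod (m := 1) (n := 0) (Nat.add_zero 1) x g = T.map g ≫ x := by
  have key := M.prod_eq (m := 1) (n := 0) (Nat.add_zero 1) x g
  rw [iterIso_zero, iterIso_right_zero, iterSwap_zero] at key
  refine (Category.id_comp _).symm.trans (key.trans ?_)
  change T.map g ≫ 𝟙 _ ≫ x ≫ 𝟙 _ = _
  rw [Category.comp_id, Category.id_comp]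

theorem prod_zero_zero (g h : X ⟶ X) :
    M.prod (m := 0) (n := 0) (Nat.zero_add 0) g h = h ≫ g := by
  have key := M.prod_eq (m := 0) (n := 0) (Nat.zero_add 0) g h
  rw [iterIso_zero, iterIso_zero] at key
  refine (Category.id_comp _).symm.trans (key.trans ?_)
  change h ≫ 𝟙 _ ≫ g ≫ 𝟙 _ = _
  rw [Category.comp_id, Category.id_comp]

/-- The Maurer-Cartan equation `ω * ω = ∂¹ω`, spelled out. -/
def IsMaurerCartan (M : MixedLaw T L) (ω : T.obj X ⟶ L.obj X) : Prop :=
  T.map ω ≫ M.d.app X ≫ L.map ω = M.μ.app X ≫ ω ≫ M.ν.app X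

namespace IsMaurerCartan

variable {ω : T.obj X ⟶ L.obj X} (H : M.IsMaurerCartan ω)
include H

/-- If `γ ∘ ω ∘ η` is invertible, then it is the identity, as it is idempotent: it acts trivially
on `ω`, because `ω = σ⁰(∂¹ω) = σ⁰(ω * ω) = σ⁰(ω) * ω`. -/
theorem η_comp_comp_γ [IsIso (M.η.app X ≫ ω ≫ M.γ.app X)] :
    M.η.app X ≫ ω ≫ M.γ.app X = 𝟙 X := by
  have h1 : ω ≫ L.map (M.η.app X ≫ ω ≫ M.γ.app X) = ω := by
    have e := congr(M.η.app (T.obj X) ≫ $H ≫ L.map (M.γ.app X))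
    have hη := M.η.naturality ω
    dsimp at hη
    simp only [Category.assoc] at e
    rw [← reassoc_of% hη, reassoc_of% M.η_d, reassoc_of% M.η_μ, M.ν_map_γ] at e
    simpa using e
  have h2 := congr(M.η.app X ≫ $h1 ≫ M.γ.app X)
  have hγ := M.γ.naturality (M.η.app X ≫ ω ≫ M.γ.app X)
  dsimp at hγ
  rw [Category.assoc, hγ] at h2
  rw [← cancel_epi (M.η.app X ≫ ω ≫ M.γ.app X)]
  simpa using h2

theorem map_comp_γ : T.map (ω ≫ M.γ.app X) ≫ ω = M.μ.app X ≫ ω := by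
  have e := congr($H ≫ M.γ.app (L.obj X))
  have hγ := M.γ.naturality ω
  dsimp at hγ
  simp only [Category.assoc] at e
  rw [hγ, M.ν_γ, Category.comp_id, reassoc_of% M.d_γ, ← T.map_comp_assoc] at e
  exact e

theorem map_η_comp : ω ≫ L.map (M.η.app X ≫ ω) = ω ≫ M.ν.app X := by
  have e := congr(M.η.app (T.obj X) ≫ $H)
  have hη := M.η.naturality ω
  dsimp at hη
  rw [← reassoc_of% hη, reassoc_of% M.η_μ, reassoc_of% M.η_d, ← L.map_comp] at e
  exact e

/-- A Maurer-Cartan element is the composite `v ∘ h` of its action `h = γ ∘ ω` and its coaction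
`v = ω ∘ η`. -/
theorem fac : (ω ≫ M.γ.app X) ≫ M.η.app X ≫ ω = ω := by
  have e := congr(M.η.app (T.obj X) ≫ $(H.map_comp_γ))
  have hη := M.η.naturality (ω ≫ M.γ.app X)
  dsimp at hη
  rwa [← reassoc_of% hη, reassoc_of% M.η_μ, ← Category.assoc] at e

/-- The unit and counit axioms are both the normalisation `σ⁰(ω) = 1`. The other axioms are obtained
from `ω * ω = ∂¹ω` by composition with `γ`, with `η`, or with both. -/
theorem isBialgebra (h1 : M.η.app X ≫ ω ≫ M.γ.app X = 𝟙 X) :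
    M.IsBialgebra (ω ≫ M.γ.app X) (M.η.app X ≫ ω) where
  unit := h1
  assoc := by rw [← reassoc_of% H.map_comp_γ]
  counit := by rw [Category.assoc, h1]
  coassoc := by rw [Category.assoc, Category.assoc, H.map_η_comp]
  compat := by
    have e := congr(T.map (M.η.app X) ≫ $H ≫ L.map (M.γ.app X))
    have hu := M.map_η_μ X
    dsimp at e hu
    simp only [Category.assoc] at e
    rw [M.ν_map_γ, reassoc_of% hu, Category.comp_id] at e
    rw [H.fac, T.map_comp, L.map_comp, Category.assoc, e]

end IsMaurerCartan

/-- Maps that intertwine the elements `v ∘ h` of two bialgebras are maps of bialgebras. -/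
theorem IsBialgebra.intertwine_iff {Y : C} {h : T.obj X ⟶ X} {v : X ⟶ L.obj X}
    {h' : T.obj Y ⟶ Y} {v' : Y ⟶ L.obj Y} (H : M.IsBialgebra h v) (H' : M.IsBialgebra h' v')
    (g : X ⟶ Y) : T.map g ≫ h' ≫ v' = (h ≫ v) ≫ L.map g ↔
      T.map g ≫ h' = h ≫ g ∧ g ≫ v' = v ≫ L.map g := by
  have hη := M.η.naturality g
  have hγ := M.γ.naturality g
  dsimp at hη hγ
  refine ⟨fun e => ⟨?_, ?_⟩, fun ⟨e₁, e₂⟩ => by rw [reassoc_of% e₁, e₂, Category.assoc]⟩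
  · have e' := congr($e ≫ M.γ.app Y)
    simp only [Category.assoc] at e'
    rwa [H'.counit, Category.comp_id, hγ, reassoc_of% H.counit] at e'
  · have e' := congr(M.η.app X ≫ $e)
    simp only [Category.assoc] at e'
    rwa [← reassoc_of% hη, reassoc_of% H'.unit, reassoc_of% H.unit] at e'

end MixedLaw

end Bialgebras

end

end SimplicialDeformation

namespace SimplicialDeformation

noncomputable section

section SquareLaw

universe v₁ v₂ v₃ v₄ u₁ u₂ u₃ u₄

variable {D : Type u₁} {E : Type u₂} {A : Type u₃} {B : Type u₄}
  [Category.{v₁} D] [Category.{v₂} E] [Category.{v₃} A] [Category.{v₄} B]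

/-- Composition of an equation of maps with a further map, without any simplification. -/
theorem comp_eq_assoc {C : Type*} [Category* C] {X Y Z W : C} {f : X ⟶ Y} {g : Y ⟶ Z} {k : X ⟶ Z}
    (h : f ≫ g = k) (l : Z ⟶ W) : f ≫ g ≫ l = k ≫ l := by
  rw [← h, Category.assoc]

namespace AdjSquare

variable (S : AdjSquare D E A B)

/-! ### The compatibility conditions of a square of adjunctions are equivalent -/

/-- The mate `V₀U₁ → U₀V₁` of `F₀V₀ ≅ V₁F₁`. Each of the four compatibility conditions says that it
is the inverse of `UV ≅ VU`. -/
def mate (X : D) : S.V₀.obj (S.U₁.obj X) ⟶ S.U₀.obj (S.V₁.obj X) :=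
  S.adjFU₀.unit.app _ ≫ S.U₀.map (S.isoFV.hom.app (S.U₁.obj X)) ≫
    S.U₀.map (S.V₁.map (S.adjFU₁.counit.app X))

theorem mate_naturality {X Y : D} (f : X ⟶ Y) :
    S.V₀.map (S.U₁.map f) ≫ S.mate Y = S.mate X ≫ S.U₀.map (S.V₁.map f) := by
  have h1 := S.adjFU₀.unit.naturality (S.V₀.map (S.U₁.map f))
  have h2 := S.isoFV.hom.naturality (S.U₁.map f)
  have h3 := S.adjFU₁.counit.naturality f
  dsimp [mate] at *
  rw [reassoc_of% h1, ← S.U₀.map_comp_assoc, h2]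
  simp only [Category.assoc, CategoryTheory.Functor.map_comp]
  rw [← S.U₀.map_comp (S.V₁.map _), ← S.V₁.map_comp, h3]
  simp only [CategoryTheory.Functor.map_comp]

theorem isoGU_eq (X : A) : S.isoGU.hom.app X =
    S.adjVG₀.unit.app (S.U₁.obj (S.G₁.obj X)) ≫ S.G₀.map (S.mate (S.G₁.obj X)) ≫
      S.G₀.map (S.U₀.map (S.adjVG₁.counit.app X)) := by
  simp [isoGU, mate]

theorem mate_comp_of_mate {X : D} (h : S.mate X ≫ S.isoUV.hom.app X = 𝟙 _) :
    S.mate X = S.isoUV.inv.app X := by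
  rw [← cancel_mono (S.isoUV.hom.app X), h, Iso.inv_hom_id_app]; rfl

theorem IsCompatible.mate_eq {S : AdjSquare D E A B} (H : S.IsCompatible) (X : D) :
    S.mate X = S.isoUV.inv.app X := by
  rcases H.counit with h | h
  · rw [← cancel_epi (S.isoUV.hom.app X), Iso.hom_inv_id_app, mate]
    have h1 := S.adjFU₀.unit.naturality (S.isoUV.hom.app X)
    dsimp at h1 ⊢
    rw [reassoc_of% h1, ← S.U₀.map_comp, ← S.U₀.map_comp, h, Adjunction.right_triangle_components]
  · apply S.mate_comp_of_mate
    have h' := h X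
    rw [isoGU_eq] at h'
    have h1 := S.adjVG₀.unit.naturality (S.U₁.map (S.adjVG₁.unit.app X))
    have h2 := S.mate_naturality (S.adjVG₁.unit.app X)
    dsimp at h1 h2
    simp only [Category.assoc] at h'
    have h3 := congr(S.G₀.map (S.U₀.map $(S.adjVG₁.left_triangle_components X)))
    simp only [CategoryTheory.Functor.map_comp] at h3
    rw [reassoc_of% h1, ← S.G₀.map_comp_assoc, h2, S.G₀.map_comp_assoc, reassoc_of% h3] at h'
    apply (S.adjVG₀.homEquiv _ _).injective
    rw [Adjunction.homEquiv_unit, Adjunction.homEquiv_unit]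
    simpa using h'

variable {S} (H : S.IsCompatible)
include H

/-- `Vε = εV` -/
theorem IsCompatible.V_counit (X : D) :
    S.F₀.map (S.isoUV.inv.app X) ≫ S.adjFU₀.counit.app (S.V₁.obj X) =
      S.isoFV.hom.app (S.U₁.obj X) ≫ S.V₁.map (S.adjFU₁.counit.app X) := by
  rw [← H.mate_eq, mate, ← S.U₀.map_comp]
  simp

/-- `Uα = αU` -/
theorem IsCompatible.U_unit (X : D) :
    S.U₁.map (S.adjVG₁.unit.app X) ≫ S.isoGU.hom.app (S.V₁.obj X) =
      S.adjVG₀.unit.app (S.U₁.obj X) ≫ S.G₀.map (S.isoUV.inv.app X) := by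
  rw [isoGU_eq]
  have h1 := S.adjVG₀.unit.naturality (S.U₁.map (S.adjVG₁.unit.app X))
  have h2 := S.mate_naturality (S.adjVG₁.unit.app X)
  dsimp at h1 h2
  rw [reassoc_of% h1, ← S.G₀.map_comp_assoc, h2, S.G₀.map_comp_assoc, ← S.G₀.map_comp,
    ← S.U₀.map_comp, Adjunction.left_triangle_components, H.mate_eq]
  simp

/-- `Uγ = γU` -/
theorem IsCompatible.U_counit (X : A) :
    S.isoUV.hom.app (S.G₁.obj X) ≫ S.V₀.map (S.isoGU.hom.app X) ≫
        S.adjVG₀.counit.app (S.U₀.obj X) = S.U₀.map (S.adjVG₁.counit.app X) := by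
  have e : S.V₀.map (S.isoGU.hom.app X) ≫ S.adjVG₀.counit.app (S.U₀.obj X) =
      S.isoUV.inv.app (S.G₁.obj X) ≫ S.U₀.map (S.adjVG₁.counit.app X) := by
    rw [isoGU_eq, ← S.G₀.map_comp, H.mate_eq, S.V₀.map_comp, Category.assoc]
    have := S.adjVG₀.counit.naturality
      (S.isoUV.inv.app (S.G₁.obj X) ≫ S.U₀.map (S.adjVG₁.counit.app X))
    dsimp at this ⊢
    rw [this]
    simp
  rw [e, Iso.hom_inv_id_app_assoc]

omit H

/-! ### The mixed distributive law of a square of adjunctions -/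

variable (S)

/-- The isomorphism `U₀V₁G₁ ≅ V₀G₀U₀`, which lifts the comonad `⊥ᵥ` along `U₀`. -/
def kappa (a : A) : S.U₀.obj (S.V₁.obj (S.G₁.obj a)) ≅ S.L.obj (S.U₀.obj a) :=
  S.isoUV.app (S.G₁.obj a) ≪≫ S.V₀.mapIso (S.isoGU.app a)

theorem kappa_naturality {a b : A} (f : a ⟶ b) :
    S.U₀.map (S.V₁.map (S.G₁.map f)) ≫ (S.kappa b).hom =
      (S.kappa a).hom ≫ S.L.map (S.U₀.map f) := by
  have h1 := S.isoUV.hom.naturality (S.G₁.map f)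
  have h2 := S.isoGU.hom.naturality f
  dsimp [kappa] at h1 h2 ⊢
  rw [reassoc_of% h1, ← S.V₀.map_comp, h2]
  simp

/-- The action of `⊤ₕ` on `⊥ᵥ(U₀ a)`. -/
def liftAct (a : A) : S.T.obj (S.L.obj (S.U₀.obj a)) ⟶ S.L.obj (S.U₀.obj a) :=
  S.T.map (S.kappa a).inv ≫ S.U₀.map (S.adjFU₀.counit.app (S.V₁.obj (S.G₁.obj a))) ≫
    (S.kappa a).hom

theorem map_kappa_liftAct (a : A) : S.T.map (S.kappa a).hom ≫ S.liftAct a =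
    S.U₀.map (S.adjFU₀.counit.app (S.V₁.obj (S.G₁.obj a))) ≫ (S.kappa a).hom := by
  rw [liftAct, ← S.T.map_comp_assoc, Iso.hom_inv_id, S.T.map_id, Category.id_comp]

theorem liftAct_naturality {a b : A} (f : a ⟶ b) :
    S.T.map (S.L.map (S.U₀.map f)) ≫ S.liftAct b = S.liftAct a ≫ S.L.map (S.U₀.map f) := by
  have h1 := S.kappa_naturality f
  have h2 := S.adjFU₀.counit.naturality (S.V₁.map (S.G₁.map f))
  have e := congr(S.U₀.map $h2)
  have h3 := S.map_kappa_liftAct a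
  dsimp at h3 e
  simp only [CategoryTheory.Functor.map_comp] at e
  rw [← cancel_epi (S.T.map (S.kappa a).hom), ← S.T.map_comp_assoc, ← h1, S.T.map_comp_assoc,
    map_kappa_liftAct]
  dsimp at h1 ⊢
  rw [reassoc_of% h3, ← h1, reassoc_of% e]

theorem unit_liftAct (a : A) :
    S.adjFU₀.unit.app (S.L.obj (S.U₀.obj a)) ≫ S.liftAct a = 𝟙 _ := by
  have h := S.adjFU₀.unit.naturality (S.kappa a).inv
  dsimp [liftAct] at h ⊢
  rw [← reassoc_of% h, Adjunction.right_triangle_components_assoc, Iso.inv_hom_id]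

theorem mul_liftAct (a : A) :
    S.U₀.map (S.adjFU₀.counit.app (S.F₀.obj (S.L.obj (S.U₀.obj a)))) ≫ S.liftAct a =
      S.T.map (S.liftAct a) ≫ S.liftAct a := by
  have e1 := congr(S.U₀.map $(S.adjFU₀.counit.naturality (S.F₀.map (S.kappa a).inv)))
  have e2 := congr(S.U₀.map $(S.adjFU₀.counit.naturality
    (S.adjFU₀.counit.app (S.V₁.obj (S.G₁.obj a)))))
  dsimp [liftAct] at e1 e2 ⊢
  simp only [CategoryTheory.Functor.map_comp, Category.assoc] at e1 e2 ⊢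
  rw [← reassoc_of% e1, ← reassoc_of% e2]
  simp

/-- The multiplication of `⊤ₕ`. -/
abbrev mulT : S.T ⋙ S.T ⟶ S.T := S.adjFU₀.toMonad.μ

/-- The comultiplication of `⊥ᵥ`. -/
abbrev comulL : S.L ⟶ S.L ⋙ S.L := S.adjVG₀.toComonad.δ

variable {S}
include H

theorem IsCompatible.delta_eq (X : B) : S.delta.app X =
    S.T.map (S.L.map (S.adjFU₀.unit.app X)) ≫ S.liftAct (S.F₀.obj X) := by
  change S.deltaApp X = _
  have h1 := congr(S.U₀.map $(S.isoFV.hom.naturality (S.G₀.map (S.adjFU₀.unit.app X) ≫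
    S.isoGU.inv.app (S.F₀.obj X))))
  have h2 := congr(S.U₀.map $(H.V_counit (S.G₁.obj (S.F₀.obj X))))
  dsimp [deltaApp, rho, liftAct, kappa] at h1 h2 ⊢
  simp only [CategoryTheory.Functor.map_comp, Category.assoc] at h1 h2 ⊢
  rw [← reassoc_of% h1, ← reassoc_of% h2]

theorem IsCompatible.liftAct_eq (a : A) : S.liftAct a =
    S.delta.app (S.U₀.obj a) ≫ S.L.map (S.U₀.map (S.adjFU₀.counit.app a)) := by
  rw [H.delta_eq, Category.assoc, ← liftAct_naturality, ← S.T.map_comp_assoc, ← S.L.map_comp,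
    Adjunction.right_triangle_components]
  dsimp
  simp

theorem IsCompatible.kappa_counit (a : A) :
    (S.kappa a).hom ≫ S.adjVG₀.counit.app (S.U₀.obj a) = S.U₀.map (S.adjVG₁.counit.app a) := by
  rw [← H.U_counit a, kappa]
  simp

theorem IsCompatible.coact_eq (X : D) :
    S.U₀.map (S.V₁.map (S.adjVG₁.unit.app X)) ≫ (S.kappa (S.V₁.obj X)).hom =
      S.isoUV.hom.app X ≫ S.V₀.map (S.adjVG₀.unit.app (S.U₁.obj X)) ≫
        S.L.map (S.isoUV.inv.app X) := by
  have h1 := S.isoUV.hom.naturality (S.adjVG₁.unit.app X)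
  have h2 := H.U_unit X
  dsimp [kappa] at h1 h2 ⊢
  rw [reassoc_of% h1, ← S.V₀.map_comp, h2, S.V₀.map_comp]

theorem IsCompatible.kappa_comul (a : A) :
    (S.kappa a).hom ≫ S.comulL.app (S.U₀.obj a) =
      S.U₀.map (S.V₁.map (S.adjVG₁.unit.app (S.G₁.obj a))) ≫
        (S.kappa (S.V₁.obj (S.G₁.obj a))).hom ≫ S.L.map (S.kappa a).hom := by
  have h := S.adjVG₀.unit.naturality (S.isoGU.hom.app a)
  have h' := H.coact_eq (S.G₁.obj a)
  dsimp at h'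
  rw [reassoc_of% h']
  dsimp [kappa] at h ⊢
  rw [← S.V₀.map_comp (S.G₀.map _), ← S.G₀.map_comp, Iso.inv_hom_id_app_assoc, Category.assoc,
    ← S.V₀.map_comp, ← h, S.V₀.map_comp]
  rfl

theorem IsCompatible.liftAct_counit (a : A) :
    S.liftAct a ≫ S.adjVG₀.counit.app (S.U₀.obj a) =
      S.T.map (S.adjVG₀.counit.app (S.U₀.obj a)) ≫ S.U₀.map (S.adjFU₀.counit.app a) := by
  have e := congr(S.U₀.map $(S.adjFU₀.counit.naturality (S.adjVG₁.counit.app a)))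
  have h := H.kappa_counit a
  dsimp at e h
  simp only [CategoryTheory.Functor.map_comp] at e
  rw [← cancel_epi (S.T.map (S.kappa a).hom), ← Category.assoc, map_kappa_liftAct, Category.assoc]
  dsimp
  rw [h, ← S.U₀.map_comp_assoc (S.F₀.map _), ← S.F₀.map_comp, h, e]

theorem IsCompatible.liftAct_comul (a : A) :
    S.liftAct a ≫ S.comulL.app (S.U₀.obj a) =
      S.T.map (S.comulL.app (S.U₀.obj a)) ≫ S.delta.app (S.L.obj (S.U₀.obj a)) ≫
        S.L.map (S.liftAct a) := by
  have e := congr(S.U₀.map $(S.adjFU₀.counit.naturality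
    (S.V₁.map (S.adjVG₁.unit.app (S.G₁.obj a)))))
  have h := H.kappa_comul a
  have h1 := S.map_kappa_liftAct (S.V₁.obj (S.G₁.obj a))
  have h2 := H.liftAct_eq (S.V₁.obj (S.G₁.obj a))
  have h3 := S.delta.naturality (S.kappa a).hom
  have h4 := congr(S.L.map $(S.map_kappa_liftAct a))
  rw [← cancel_epi (S.T.map (S.kappa a).hom), ← Category.assoc, map_kappa_liftAct, Category.assoc,
    h, ← S.T.map_comp_assoc, h]
  dsimp at e h h1 h2 h3 h4 ⊢
  simp only [CategoryTheory.Functor.map_comp, Category.assoc] at e h4 ⊢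
  rw [reassoc_of% h3, h4, ← reassoc_of% e, ← reassoc_of% h1, h2]
  simp

/-- The mixed distributive law `⊤ₕ⊥ᵥ → ⊥ᵥ⊤ₕ` of a compatible square of adjunctions. -/
def IsCompatible.law : MixedLaw S.T S.L where
  η := S.adjFU₀.unit
  μ := S.mulT
  γ := S.adjVG₀.counit
  ν := S.comulL
  d := S.delta
  η_μ X := S.adjFU₀.toMonad.left_unit X
  map_η_μ X := S.adjFU₀.toMonad.right_unit X
  assoc X := S.adjFU₀.toMonad.assoc X
  ν_γ X := S.adjVG₀.toComonad.left_counit X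
  ν_map_γ X := S.adjVG₀.toComonad.right_counit X
  coassoc X := S.adjVG₀.toComonad.coassoc X
  η_d X := by
    have h := S.adjFU₀.unit.naturality (S.L.map (S.adjFU₀.unit.app X))
    have h' := S.unit_liftAct (S.F₀.obj X)
    dsimp at h h'
    rw [H.delta_eq]
    dsimp
    rw [← reassoc_of% h, h', Category.comp_id]
  μ_d X := by
    have h : S.mulT.app (S.L.obj X) ≫ S.T.map (S.L.map (S.adjFU₀.unit.app X)) =
        S.T.map (S.T.map (S.L.map (S.adjFU₀.unit.app X))) ≫ S.mulT.app (S.L.obj (S.T.obj X)) :=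
      (S.mulT.naturality (S.L.map (S.adjFU₀.unit.app X))).symm
    have h1 := H.liftAct_eq (S.F₀.obj X)
    have h2 := S.mul_liftAct (S.F₀.obj X)
    have h3 : S.delta.app (S.T.obj X) ≫ S.L.map (S.mulT.app X) = S.liftAct (S.F₀.obj X) :=
      h1.symm
    rw [h3, H.delta_eq, comp_eq_assoc h, S.T.map_comp, Category.assoc, Category.assoc, ← h2]
    rfl
  d_γ X := by
    have h := S.adjVG₀.counit.naturality (S.adjFU₀.unit.app X)
    have h1 := H.liftAct_counit (S.F₀.obj X)
    have h2 : S.T.map (S.adjFU₀.unit.app X) ≫ S.U₀.map (S.adjFU₀.counit.app (S.F₀.obj X)) = 𝟙 _ :=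
      S.adjFU₀.toMonad.right_unit X
    dsimp at h h1 h2
    rw [H.delta_eq]
    dsimp
    rw [Category.assoc, h1, ← S.U₀.map_comp_assoc, ← S.F₀.map_comp, h, S.F₀.map_comp,
      S.U₀.map_comp, Category.assoc, h2, Category.comp_id]
  d_ν X := by
    have h := S.comulL.naturality (S.adjFU₀.unit.app X)
    have h1 := H.liftAct_comul (S.F₀.obj X)
    have h2 := S.delta.naturality (S.L.map (S.adjFU₀.unit.app X))
    rw [H.delta_eq X, S.L.map_comp]
    dsimp at h h1 h2 ⊢
    rw [Category.assoc, h1, ← S.U₀.map_comp_assoc, ← S.F₀.map_comp, h]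
    simp only [CategoryTheory.Functor.map_comp, Category.assoc]
    rw [comp_eq_assoc h2, Category.assoc]

/-- The action of `⊤ₕ` on `UV X`. -/
def act (S : AdjSquare D E A B) (X : D) : S.T.obj (S.UV.obj X) ⟶ S.UV.obj X :=
  S.U₀.map (S.adjFU₀.counit.app (S.V₁.obj X))

/-- The coaction of `⊥ᵥ` on `UV X`. -/
def coact (S : AdjSquare D E A B) (X : D) : S.UV.obj X ⟶ S.L.obj (S.UV.obj X) :=
  S.U₀.map (S.V₁.map (S.adjVG₁.unit.app X)) ≫ (S.kappa (S.V₁.obj X)).hom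

omit H in
theorem act_naturality {X Y : D} (f : X ⟶ Y) :
    S.T.map (S.UV.map f) ≫ S.act Y = S.act X ≫ S.UV.map f := by
  have := congr(S.U₀.map $(S.adjFU₀.counit.naturality (S.V₁.map f)))
  rw [S.U₀.map_comp, S.U₀.map_comp] at this
  exact this

omit H in
theorem coact_naturality {X Y : D} (f : X ⟶ Y) :
    S.UV.map f ≫ S.coact Y = S.coact X ≫ S.L.map (S.UV.map f) := by
  have h1 := congr(S.U₀.map (S.V₁.map $(S.adjVG₁.unit.naturality f)))
  have h2 := S.kappa_naturality (S.V₁.map f)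
  dsimp [coact] at h1 h2 ⊢
  simp only [CategoryTheory.Functor.map_comp] at h1
  rw [reassoc_of% h1, h2, Category.assoc]

theorem IsCompatible.isBialgebra (X : D) : H.law.IsBialgebra (S.act X) (S.coact X) where
  unit := S.adjFU₀.right_triangle_components _
  assoc := by
    have := congr(S.U₀.map $(S.adjFU₀.counit.naturality (S.adjFU₀.counit.app (S.V₁.obj X))))
    dsimp at this
    simp only [CategoryTheory.Functor.map_comp] at this
    exact this.symm
  counit := by
    have h := H.kappa_counit (S.V₁.obj X)
    change S.coact X ≫ S.adjVG₀.counit.app (S.UV.obj X) = _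
    dsimp [coact] at h ⊢
    rw [Category.assoc, h, ← S.U₀.map_comp, S.adjVG₁.left_triangle_components, S.U₀.map_id]
  coassoc := by
    have h := H.kappa_comul (S.V₁.obj X)
    have h1 := S.kappa_naturality (S.V₁.map (S.adjVG₁.unit.app X))
    have h2 := congr(S.U₀.map (S.V₁.map $(S.adjVG₁.unit.naturality (S.adjVG₁.unit.app X))))
    change S.coact X ≫ S.comulL.app (S.UV.obj X) = _
    dsimp [coact] at h h1 h2 ⊢
    simp only [CategoryTheory.Functor.map_comp, Category.assoc] at h2 ⊢
    rw [h, comp_eq_assoc h2, Category.assoc, comp_eq_assoc h1, Category.assoc]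
  compat := by
    have h := H.liftAct_eq (S.V₁.obj X)
    have h1 := S.map_kappa_liftAct (S.V₁.obj X)
    have h2 := congr(S.U₀.map $(S.adjFU₀.counit.naturality (S.V₁.map (S.adjVG₁.unit.app X))))
    change S.act X ≫ S.coact X = S.T.map (S.coact X) ≫ S.delta.app _ ≫ S.L.map (S.act X)
    dsimp [act, coact] at h h1 h2 ⊢
    simp only [CategoryTheory.Functor.map_comp, Category.assoc] at h2 ⊢
    rw [← h, h1, reassoc_of% h2]

theorem IsCompatible.hStep_comp (X : D) :
    (S.hStep X).hom ≫ S.UV.map (S.adjFU₁.counit.app X) = S.act X := by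
  have h := H.V_counit X
  dsimp [hStep, act] at h ⊢
  rw [S.U₀.map_comp, Category.assoc, ← S.U₀.map_comp, ← h, ← S.U₀.map_comp, ← S.F₀.map_comp_assoc,
    Iso.hom_inv_id_app]
  simp

omit H in
theorem vStep_comp (X : D) :
    S.UV.map (S.adjVG₁.unit.app X) ≫ (S.vStep X).hom = S.coact X := rfl

omit H in
theorem hStep_naturality {X Y : D} (f : X ⟶ Y) :
    S.T.map (S.UV.map f) ≫ (S.hStep Y).hom =
      (S.hStep X).hom ≫ S.UV.map (S.F₁.map (S.U₁.map f)) := by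
  have h1 := S.isoUV.hom.naturality f
  have h2 := S.isoFV.hom.naturality (S.U₁.map f)
  dsimp [hStep] at h1 h2 ⊢
  rw [← S.U₀.map_comp, ← S.U₀.map_comp, ← S.F₀.map_comp_assoc, h1, S.F₀.map_comp, Category.assoc,
    Category.assoc, h2]

omit H in
theorem vStep_naturality {X Y : D} (f : X ⟶ Y) :
    S.UV.map (S.G₁.map (S.V₁.map f)) ≫ (S.vStep Y).hom =
      (S.vStep X).hom ≫ S.L.map (S.UV.map f) :=
  S.kappa_naturality (S.V₁.map f)

theorem IsCompatible.hIso_comp (n : ℕ) (X : D) :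
    (S.hIso n X).hom ≫ S.UV.map (iterToId S.adjFU₁.counit n X) = actPow (S.act X) n := by
  induction n with
  | zero => exact (Category.id_comp _).trans (S.UV.map_id X)
  | succ n ih =>
    have h1 := S.hStep_naturality (iterToId S.adjFU₁.counit n X)
    change (S.T.map (S.hIso n X).hom ≫ (S.hStep _).hom) ≫
      S.UV.map (S.F₁.map (S.U₁.map (iterToId S.adjFU₁.counit n X)) ≫ S.adjFU₁.counit.app X) =
        S.T.map (actPow (S.act X) n) ≫ S.act X
    rw [S.UV.map_comp, Category.assoc, comp_eq_assoc h1.symm, Category.assoc, H.hStep_comp,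
      ← S.T.map_comp_assoc, ih]

omit H in
theorem comp_vIso (n : ℕ) (X : D) :
    S.UV.map (iterOfId S.adjVG₁.unit n X) ≫ (S.vIso n X).hom = coactPow (S.coact X) n := by
  induction n with
  | zero => exact (Category.comp_id _).trans (S.UV.map_id X)
  | succ n ih =>
    have h1 := S.vStep_naturality (iterOfId S.adjVG₁.unit n X)
    change S.UV.map (S.adjVG₁.unit.app X ≫ S.G₁.map (S.V₁.map (iterOfId S.adjVG₁.unit n X))) ≫
      (S.vStep _).hom ≫ S.L.map (S.vIso n X).hom = S.coact X ≫ S.L.map (coactPow (S.coact X) n)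
    rw [S.UV.map_comp, Category.assoc, comp_eq_assoc h1, Category.assoc, ← ih,
      ← S.vStep_comp, S.L.map_comp,
      Category.assoc]

/-- The map `UV(αⁿ ∘ εⁿ)` is built from the bialgebra structure of `UV X`. -/
theorem IsCompatible.canonicalMap_eq (n : ℕ) (X : D) :
    S.canonicalMap n X = canon (S.act X) (S.coact X) n := by
  rw [canonicalMap, canon, ← H.hIso_comp, ← comp_vIso, S.UV.map_comp]
  simp only [Category.assoc]

end AdjSquare

end SquareLaw

end

end SimplicialDeformation

namespace SimplicialDeformation

noncomputable section

section SquareOperations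

universe v₁ v₂ v₃ v₄ u₁ u₂ u₃ u₄

section

variable {C : Type u₁} [Category.{v₁} C] {T L : C ⥤ C}

theorem comp_assoc_middle {X₀ X₁ X₂ X₃ X₄ X₅ : C} (a : X₀ ⟶ X₁) (b : X₁ ⟶ X₂) (c : X₂ ⟶ X₃)
    (g : X₃ ⟶ X₄) (t : X₄ ⟶ X₅) : a ≫ b ≫ c ≫ g ≫ t = (a ≫ b ≫ c) ≫ g ≫ t := by
  simp only [Category.assoc]

theorem muAt_eq (μ : T ⋙ T ⟶ T) {n a b : ℕ} (h₁ : a + (b + 2) = n + 1) (h₂ : a + (b + 1) = n)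
    (ha : a < n) (X : C) : muAt μ n a ha X =
      (iterIso T h₁ X).inv ≫ (iter T a).map (μ.app ((iter T b).obj X)) ≫ (iterIso T h₂ X).hom :=
  ((Iso.inv_comp_eq _).2 (map_muAt_iterIso (a := 0) h₂ (Nat.succ_pos b) X)).symm

theorem etaAt_eq (η : 𝟭 C ⟶ T) {n a b : ℕ} (h₁ : a + b = n) (h₂ : a + (b + 1) = n + 1)
    (ha : a ≤ n) (X : C) : etaAt η n a ha X =
      (iterIso T h₁ X).inv ≫ (iter T a).map (η.app ((iter T b).obj X)) ≫ (iterIso T h₂ X).hom := by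
  have := ((Iso.inv_comp_eq _).2 (map_etaAt_iterIso (η := η) (a := 0) h₁ (Nat.zero_le b) X)).symm
  cases b <;> exact this

theorem nuAt_eq (ν : L ⟶ L ⋙ L) {n a b : ℕ} (h₁ : a + (b + 1) = n) (h₂ : a + (b + 2) = n + 1)
    (ha : a < n) (X : C) : nuAt ν n a ha X =
      (iterIso L h₁ X).inv ≫ (iter L a).map (ν.app ((iter L b).obj X)) ≫ (iterIso L h₂ X).hom :=
  ((Iso.inv_comp_eq _).2 (map_nuAt_iterIso (a := 0) h₁ (Nat.succ_pos b) X)).symm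

theorem gamAt_eq (γ : L ⟶ 𝟭 C) {n a b : ℕ} (h₁ : a + (b + 1) = n + 1) (h₂ : a + b = n)
    (ha : a ≤ n) (X : C) : gamAt γ n a ha X =
      (iterIso L h₁ X).inv ≫ (iter L a).map (γ.app ((iter L b).obj X)) ≫ (iterIso L h₂ X).hom := by
  have := ((Iso.inv_comp_eq _).2 (map_gamAt_iterIso (γ := γ) (a := 0) h₂ (Nat.zero_le b) X)).symm
  cases b <;> exact this

end

variable {D : Type u₁} {E : Type u₂} {A : Type u₃} {B : Type u₄}
  [Category.{v₁} D] [Category.{v₂} E] [Category.{v₃} A] [Category.{v₄} B]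

namespace AdjSquare

variable {S : AdjSquare D E A B} (H : S.IsCompatible)
include H

theorem IsCompatible.prodMap_eq {m n p : ℕ} (e : m + n = p) {X : B}
    (g : (iter S.T m).obj X ⟶ (iter S.L m).obj X) (h : (iter S.T n).obj X ⟶ (iter S.L n).obj X) :
    S.prodMap e g h = H.law.prod e g h := rfl

theorem IsCompatible.faceMap_eq {n : ℕ} (i : ℕ) (hi : 1 ≤ i) (hn : i ≤ n) {X : B}
    (g : (iter S.T n).obj X ⟶ (iter S.L n).obj X) :
    S.faceMap i hi hn g = H.law.face i hi hn g := by
  rw [MixedLaw.face, muAt_eq (b := n - i) _ (by omega) (by omega),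
    nuAt_eq (b := i - 1) _ (by omega) (by omega)]
  exact comp_assoc_middle _ _ _ _ _

theorem IsCompatible.degenMap_eq {n : ℕ} (i : ℕ) (hn : i ≤ n) {X : B}
    (g : (iter S.T (n + 1)).obj X ⟶ (iter S.L (n + 1)).obj X) :
    S.degenMap i hn g = H.law.degen i hn g := by
  rw [MixedLaw.degen, etaAt_eq (b := n - i) _ (by omega) (by omega),
    gamAt_eq (b := i) _ (by omega) (by omega)]
  exact comp_assoc_middle _ _ _ _ _

/-! ### Reconstruction of objects of `D` from bialgebras in `B` -/

omit H in
/-- If `F₀ ⊣ U₀` is monadic, then maps of `A` are the same as maps in `B` that are compatible with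
the actions. -/
theorem exists_map_of_act [(Monad.comparison S.adjFU₀).IsEquivalence] {a b : A}
    (φ : S.U₀.obj a ⟶ S.U₀.obj b)
    (h : S.T.map φ ≫ S.U₀.map (S.adjFU₀.counit.app b) = S.U₀.map (S.adjFU₀.counit.app a) ≫ φ) :
    ∃ f : a ⟶ b, S.U₀.map f = φ := by
  let g : (Monad.comparison S.adjFU₀).obj a ⟶ (Monad.comparison S.adjFU₀).obj b := ⟨φ, h⟩
  exact ⟨(Monad.comparison S.adjFU₀).preimage g,
    congrArg Monad.Algebra.Hom.f ((Monad.comparison S.adjFU₀).map_preimage g)⟩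

omit H in
theorem faithful_U₀ [(Monad.comparison S.adjFU₀).IsEquivalence] : S.U₀.Faithful := by
  have : (Monad.comparison S.adjFU₀ ⋙ S.adjFU₀.toMonad.forget).Faithful := inferInstance
  exact this

omit H in
theorem exists_map_of_coact [(Comonad.comparison S.adjVG₁).IsEquivalence] {X Y : D}
    (ψ : S.V₁.obj X ⟶ S.V₁.obj Y)
    (h : S.V₁.map (S.adjVG₁.unit.app X) ≫ S.V₁.map (S.G₁.map ψ) =
      ψ ≫ S.V₁.map (S.adjVG₁.unit.app Y)) :
    ∃ f : X ⟶ Y, S.V₁.map f = ψ := by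
  let g : (Comonad.comparison S.adjVG₁).obj X ⟶ (Comonad.comparison S.adjVG₁).obj Y := ⟨ψ, h⟩
  exact ⟨(Comonad.comparison S.adjVG₁).preimage g,
    congrArg Comonad.Coalgebra.Hom.f ((Comonad.comparison S.adjVG₁).map_preimage g)⟩

omit H in
theorem faithful_V₁ [(Comonad.comparison S.adjVG₁).IsEquivalence] : S.V₁.Faithful := by
  have : (Comonad.comparison S.adjVG₁ ⋙ S.adjVG₁.toComonad.forget).Faithful := inferInstance
  exact this

omit H in
theorem UV_faithful [(Monad.comparison S.adjFU₀).IsEquivalence]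
    [(Comonad.comparison S.adjVG₁).IsEquivalence] : S.UV.Faithful :=
  have := faithful_U₀ (S := S)
  have := faithful_V₁ (S := S)
  Functor.Faithful.comp _ _

omit H in
/-- Maps of `D` are the same as maps of bialgebras. -/
theorem exists_map_of_bialgebra_map [(Monad.comparison S.adjFU₀).IsEquivalence]
    [(Comonad.comparison S.adjVG₁).IsEquivalence] {X Y : D} (φ : S.UV.obj X ⟶ S.UV.obj Y)
    (h : S.T.map φ ≫ S.act Y = S.act X ≫ φ) (h' : φ ≫ S.coact Y = S.coact X ≫ S.L.map φ) :
    ∃ f : X ⟶ Y, S.UV.map f = φ := by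
  have := faithful_U₀ (S := S)
  obtain ⟨ψ, hψ⟩ := exists_map_of_act φ h
  obtain ⟨f, hf⟩ := exists_map_of_coact ψ (X := X) (Y := Y) (by
    apply S.U₀.map_injective
    have e := S.kappa_naturality ψ
    rw [← cancel_mono (S.kappa (S.V₁.obj Y)).hom, S.U₀.map_comp, S.U₀.map_comp, Category.assoc,
      Category.assoc, e, hψ]
    simp only [coact, Category.assoc] at h'
    exact h'.symm)
  exact ⟨f, by rw [← hψ, ← hf]; rfl⟩

/-- If `F₀ ⊣ U₀` is monadic, then a bialgebra structure on `U₀ a` comes from a coalgebra structure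
on `a` for the comonad `V₁G₁`. -/
theorem IsCompatible.exists_coalgebra [(Monad.comparison S.adjFU₀).IsEquivalence] {a : A}
    {v : S.U₀.obj a ⟶ S.L.obj (S.U₀.obj a)}
    (hb : H.law.IsBialgebra (S.U₀.map (S.adjFU₀.counit.app a)) v) :
    ∃ c : a ⟶ S.V₁.obj (S.G₁.obj a), S.U₀.map c ≫ (S.kappa a).hom = v ∧
      c ≫ S.adjVG₁.counit.app a = 𝟙 a ∧
      c ≫ S.V₁.map (S.adjVG₁.unit.app (S.G₁.obj a)) = c ≫ S.V₁.map (S.G₁.map c) := by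
  have := faithful_U₀ (S := S)
  obtain ⟨c, hc⟩ := exists_map_of_act (S := S) (a := a) (b := S.V₁.obj (S.G₁.obj a))
    (v ≫ (S.kappa a).inv) (by
      have h1 : S.U₀.map (S.adjFU₀.counit.app a) ≫ v = S.T.map v ≫ S.liftAct a := by
        rw [H.liftAct_eq a]
        exact hb.compat
      rw [← cancel_mono (S.kappa a).hom, Category.assoc, Category.assoc, Category.assoc,
        Iso.inv_hom_id, Category.comp_id, h1, S.T.map_comp, Category.assoc]
      rfl)
  have hκ : S.U₀.map c ≫ (S.kappa a).hom = v := by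
    rw [hc, Category.assoc, Iso.inv_hom_id, Category.comp_id]
  refine ⟨c, hκ, ?_, ?_⟩
  · apply S.U₀.map_injective
    rw [S.U₀.map_comp, ← H.kappa_counit, comp_eq_assoc hκ, S.U₀.map_id]
    exact hb.counit
  · apply S.U₀.map_injective
    have h1 := H.kappa_comul a
    have h2 := S.kappa_naturality c
    rw [← cancel_mono ((S.kappa (S.V₁.obj (S.G₁.obj a))).hom ≫ S.L.map (S.kappa a).hom),
      S.U₀.map_comp, S.U₀.map_comp, Category.assoc, Category.assoc, ← h1, comp_eq_assoc h2,
      Category.assoc, ← S.L.map_comp, hκ, comp_eq_assoc hκ, comp_eq_assoc hκ]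
    exact hb.coassoc

/-- Every bialgebra in `B` comes from an object of `D`. -/
theorem IsCompatible.exists_of_bialgebra [(Monad.comparison S.adjFU₀).IsEquivalence]
    [(Comonad.comparison S.adjVG₁).IsEquivalence] {X : B} {h : S.T.obj X ⟶ X}
    {v : X ⟶ S.L.obj X} (hb : H.law.IsBialgebra h v) :
    ∃ (Y : D) (e : S.UV.obj Y ≅ X), S.T.map e.hom ≫ h = S.act Y ≫ e.hom ∧
      e.hom ≫ v = S.coact Y ≫ S.L.map e.hom := by
  let P : S.adjFU₀.toMonad.Algebra := ⟨X, h, hb.unit, hb.assoc⟩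
  let i := (Monad.comparison S.adjFU₀).objObjPreimageIso P
  let a : A := (Monad.comparison S.adjFU₀).objPreimage P
  let e₀ : S.U₀.obj a ≅ X := S.adjFU₀.toMonad.forget.mapIso i
  have he₀ : S.T.map e₀.hom ≫ h = S.U₀.map (S.adjFU₀.counit.app a) ≫ e₀.hom := i.hom.h
  have hb' : H.law.IsBialgebra (S.U₀.map (S.adjFU₀.counit.app a))
      (e₀.hom ≫ v ≫ S.L.map e₀.inv) := by
    refine hb.of_iso e₀.symm ?_ ?_
    · rw [Iso.symm_hom, ← cancel_mono e₀.hom, Category.assoc, ← he₀, Category.assoc,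
        Iso.inv_hom_id, Category.comp_id, ← S.T.map_comp_assoc, Iso.inv_hom_id, S.T.map_id,
        Category.id_comp]
    · simp
  obtain ⟨c, hc, hc', hc''⟩ := H.exists_coalgebra hb'
  let Q : S.adjVG₁.toComonad.Coalgebra := ⟨a, c, hc', hc''⟩
  let j := (Comonad.comparison S.adjVG₁).objObjPreimageIso Q
  let Y : D := (Comonad.comparison S.adjVG₁).objPreimage Q
  let j₀ : S.V₁.obj Y ≅ a := S.adjVG₁.toComonad.forget.mapIso j
  have hj₀ : S.V₁.map (S.adjVG₁.unit.app Y) ≫ S.V₁.map (S.G₁.map j₀.hom) = j₀.hom ≫ c := j.hom.h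
  refine ⟨Y, S.U₀.mapIso j₀ ≪≫ e₀, ?_, ?_⟩
  · have h1 := congr(S.U₀.map $(S.adjFU₀.counit.naturality j₀.hom))
    rw [S.U₀.map_comp, S.U₀.map_comp] at h1
    have h1' : S.T.map (S.U₀.map j₀.hom) ≫ S.U₀.map (S.adjFU₀.counit.app a) =
      S.act Y ≫ S.U₀.map j₀.hom := h1
    rw [Iso.trans_hom, Functor.mapIso_hom, S.T.map_comp, Category.assoc, he₀, comp_eq_assoc h1',
      Category.assoc]
  · have h1 := S.kappa_naturality j₀.hom
    have h2 := congr(S.U₀.map $hj₀)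
    rw [S.U₀.map_comp, S.U₀.map_comp] at h2
    rw [Iso.trans_hom, Functor.mapIso_hom, S.L.map_comp, coact, Category.assoc, Category.assoc,
      comp_eq_assoc h1.symm, Category.assoc, comp_eq_assoc h2, Category.assoc, comp_eq_assoc hc,
      Category.assoc, Category.assoc, ← S.L.map_comp, Iso.inv_hom_id, S.L.map_id, Category.comp_id]

end AdjSquare

end SquareOperations

end

end SimplicialDeformation

namespace SimplicialDeformation

noncomputable section

/-! ### Base change of mixed distributive laws -/

section LawMap

universe v₁ v₂ u₁ u₂

variable {C : Type u₁} {C' : Type u₂} [Category.{v₁} C] [Category.{v₂} C']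

theorem comp_eq_assoc_three {X Y Z W V : C} {f : X ⟶ Y} {g : Y ⟶ Z} {k : Z ⟶ W} {m : X ⟶ W}
    (h : f ≫ g ≫ k = m) (l : W ⟶ V) : f ≫ g ≫ k ≫ l = m ≫ l := by
  rw [← h, Category.assoc, Category.assoc]

section

variable {Φ : C ⥤ C'} {T : C ⥤ C} {T' : C' ⥤ C'} (t : Φ ⋙ T' ⟶ T ⋙ Φ)

theorem comp_naturality {X Y : C} (f : X ⟶ Y) :
    T'.map (Φ.map f) ≫ t.app Y = t.app X ≫ Φ.map (T.map f) :=
  t.naturality f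

/-- The map `T'ⁿ Y → Φ(Tⁿ X)` induced by `j : Y → Φ X` and `t : T'Φ → ΦT`. -/
def powHom {X : C} {Y : C'} (j : Y ⟶ Φ.obj X) : (n : ℕ) →
    ((iter T' n).obj Y ⟶ Φ.obj ((iter T n).obj X))
  | 0 => j
  | n + 1 => T'.map (powHom j n) ≫ t.app ((iter T n).obj X)

theorem map_powHom {X : C} {Y Z : C'} (k : Z ⟶ Y) (j : Y ⟶ Φ.obj X) (n : ℕ) :
    (iter T' n).map k ≫ powHom t j n = powHom t (k ≫ j) n := by
  induction n with
  | zero => rfl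
  | succ n ih =>
    dsimp only [powHom, iter_succ_obj, iter_succ_map]
    rw [← T'.map_comp_assoc, ih]

theorem powHom_map {X Z : C} {Y : C'} (j : Y ⟶ Φ.obj X) (f : X ⟶ Z) (n : ℕ) :
    powHom t j n ≫ Φ.map ((iter T n).map f) = powHom t (j ≫ Φ.map f) n := by
  induction n with
  | zero => rfl
  | succ n ih =>
    dsimp only [powHom, iter_succ_obj, iter_succ_map]
    rw [Category.assoc, ← comp_naturality, ← T'.map_comp_assoc, ih]

theorem iterIso_powHom {X : C} {Y : C'} (j : Y ⟶ Φ.obj X) {m n p : ℕ} (h : m + n = p) :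
    (iterIso T' h Y).hom ≫ powHom t j p =
      powHom t (powHom t j n) m ≫ Φ.map (iterIso T h X).hom := by
  induction m generalizing p with
  | zero =>
    obtain rfl : n = p := by omega
    rw [iterIso_zero, iterIso_zero]
    change 𝟙 _ ≫ powHom t j n = powHom t j n ≫ Φ.map (𝟙 _)
    simp
  | succ m ih =>
    obtain ⟨p, rfl⟩ : ∃ p', p = p' + 1 := ⟨p - 1, by omega⟩
    rw [iterIso_succ_hom (show m + n = p by omega), iterIso_succ_hom (show m + n = p by omega)]
    dsimp only [powHom, iter_succ_obj, iter_succ_map]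
    rw [← T'.map_comp_assoc, ih, T'.map_comp_assoc, comp_naturality, Category.assoc]

theorem powHom_muAt {μ : T ⋙ T ⟶ T} {μ' : T' ⋙ T' ⟶ T'}
    (H : ∀ X, T'.map (t.app X) ≫ t.app (T.obj X) ≫ Φ.map (μ.app X) =
      μ'.app (Φ.obj X) ≫ t.app X)
    {X : C} {Y : C'} (j : Y ⟶ Φ.obj X) {n a : ℕ} (ha : a < n) :
    powHom t j (n + 1) ≫ Φ.map (muAt μ n a ha X) = muAt μ' n a ha Y ≫ powHom t j n := by
  induction a generalizing n with
  | zero =>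
    obtain ⟨n, rfl⟩ : ∃ n', n = n' + 1 := ⟨n - 1, by omega⟩
    have h := μ'.naturality (powHom t j n)
    dsimp only [powHom, iter_succ_obj, iter_succ_map, muAt, Functor.comp_map, Functor.comp_obj]
      at h ⊢
    rw [T'.map_comp, Category.assoc, Category.assoc, H, comp_eq_assoc h, Category.assoc]
  | succ a ih =>
    obtain ⟨n, rfl⟩ : ∃ n', n = n' + 1 := ⟨n - 1, by omega⟩
    have h := comp_naturality t (muAt μ n a (by omega) X)
    specialize ih (show a < n by omega)
    refine (Category.assoc _ _ _).trans ((congrArg (_ ≫ ·) h.symm).trans ?_)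
    exact (comp_eq_assoc (map_square T' ih) _).trans (Category.assoc _ _ _)

theorem powHom_etaAt {η : 𝟭 C ⟶ T} {η' : 𝟭 C' ⟶ T'}
    (H : ∀ X, η'.app (Φ.obj X) ≫ t.app X = Φ.map (η.app X))
    {X : C} {Y : C'} (j : Y ⟶ Φ.obj X) {n a : ℕ} (ha : a ≤ n) :
    powHom t j n ≫ Φ.map (etaAt η n a ha X) = etaAt η' n a ha Y ≫ powHom t j (n + 1) := by
  induction a generalizing n with
  | zero =>
    have key : powHom t j n ≫ Φ.map (η.app ((iter T n).obj X)) =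
        η'.app ((iter T' n).obj Y) ≫ T'.map (powHom t j n) ≫ t.app _ := by
      rw [← H, comp_eq_assoc (η'.naturality (powHom t j n)).symm, Category.assoc]
      rfl
    cases n <;> exact key
  | succ a ih =>
    obtain ⟨n, rfl⟩ : ∃ n', n = n' + 1 := ⟨n - 1, by omega⟩
    have h := comp_naturality t (etaAt η n a (by omega) X)
    specialize ih (show a ≤ n by omega)
    refine (Category.assoc _ _ _).trans ((congrArg (_ ≫ ·) h.symm).trans ?_)
    exact (comp_eq_assoc (map_square T' ih) _).trans (Category.assoc _ _ _)

theorem powHom_nuAt {ν : T ⟶ T ⋙ T} {ν' : T' ⟶ T' ⋙ T'}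
    (H : ∀ X, ν'.app (Φ.obj X) ≫ T'.map (t.app X) ≫ t.app (T.obj X) =
      t.app X ≫ Φ.map (ν.app X))
    {X : C} {Y : C'} (j : Y ⟶ Φ.obj X) {n a : ℕ} (ha : a < n) :
    powHom t j n ≫ Φ.map (nuAt ν n a ha X) = nuAt ν' n a ha Y ≫ powHom t j (n + 1) := by
  induction a generalizing n with
  | zero =>
    obtain ⟨n, rfl⟩ : ∃ n', n = n' + 1 := ⟨n - 1, by omega⟩
    have h := ν'.naturality (powHom t j n)
    dsimp only [powHom, iter_succ_obj, iter_succ_map, nuAt, Functor.comp_map, Functor.comp_obj]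
      at h ⊢
    rw [T'.map_comp, Category.assoc, Category.assoc, ← H, comp_eq_assoc h, Category.assoc]
  | succ a ih =>
    obtain ⟨n, rfl⟩ : ∃ n', n = n' + 1 := ⟨n - 1, by omega⟩
    have h := comp_naturality t (nuAt ν n a (by omega) X)
    specialize ih (show a < n by omega)
    refine (Category.assoc _ _ _).trans ((congrArg (_ ≫ ·) h.symm).trans ?_)
    exact (comp_eq_assoc (map_square T' ih) _).trans (Category.assoc _ _ _)

theorem powHom_gamAt {γ : T ⟶ 𝟭 C} {γ' : T' ⟶ 𝟭 C'}
    (H : ∀ X, t.app X ≫ Φ.map (γ.app X) = γ'.app (Φ.obj X))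
    {X : C} {Y : C'} (j : Y ⟶ Φ.obj X) {n a : ℕ} (ha : a ≤ n) :
    powHom t j (n + 1) ≫ Φ.map (gamAt γ n a ha X) = gamAt γ' n a ha Y ≫ powHom t j n := by
  induction a generalizing n with
  | zero =>
    have key : (T'.map (powHom t j n) ≫ t.app _) ≫ Φ.map (γ.app ((iter T n).obj X)) =
        γ'.app ((iter T' n).obj Y) ≫ powHom t j n := by
      rw [Category.assoc, H, γ'.naturality]
      rfl
    cases n <;> exact key
  | succ a ih =>
    obtain ⟨n, rfl⟩ : ∃ n', n = n' + 1 := ⟨n - 1, by omega⟩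
    have h := comp_naturality t (gamAt γ n a (by omega) X)
    specialize ih (show a ≤ n by omega)
    refine (Category.assoc _ _ _).trans ((congrArg (_ ≫ ·) h.symm).trans ?_)
    exact (comp_eq_assoc (map_square T' ih) _).trans (Category.assoc _ _ _)

theorem powHom_actPow {X : C} {Y : C'} (j : Y ⟶ Φ.obj X) {h : T.obj X ⟶ X} {h' : T'.obj Y ⟶ Y}
    (H : T'.map j ≫ t.app X ≫ Φ.map h = h' ≫ j) (n : ℕ) :
    powHom t j n ≫ Φ.map (actPow h n) = actPow h' n ≫ j := by
  induction n with
  | zero =>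
    change j ≫ Φ.map (𝟙 X) = 𝟙 Y ≫ j
    simp
  | succ n ih =>
    dsimp only [powHom, iter_succ_obj, iter_succ_map, actPow]
    rw [Φ.map_comp, Category.assoc, comp_eq_assoc (comp_naturality t (actPow h n)).symm,
      Category.assoc, ← T'.map_comp_assoc, ih, T'.map_comp_assoc, H, Category.assoc]

theorem coactPow_powHom {X : C} {Y : C'} (j : Y ⟶ Φ.obj X) {v : X ⟶ T.obj X} {v' : Y ⟶ T'.obj Y}
    (H : v' ≫ T'.map j ≫ t.app X = j ≫ Φ.map v) (n : ℕ) :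
    coactPow v' n ≫ powHom t j n = j ≫ Φ.map (coactPow v n) := by
  induction n with
  | zero =>
    change 𝟙 Y ≫ j = j ≫ Φ.map (𝟙 X)
    simp
  | succ n ih =>
    dsimp only [powHom, iter_succ_obj, iter_succ_map, coactPow]
    rw [Φ.map_comp, ← reassoc_of% H, ← comp_naturality, Category.assoc, ← T'.map_comp_assoc, ih,
      T'.map_comp_assoc]

end

variable {T L : C ⥤ C} {T' L' : C' ⥤ C'}

/-- A functor `Φ` together with transformations `T'Φ → ΦT` and `L'Φ → ΦL` that are compatible with
the mixed distributive laws of `(T, L)` and `(T', L')`. -/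
structure LawMap (M : MixedLaw T L) (M' : MixedLaw T' L') (Φ : C ⥤ C') where
  t : Φ ⋙ T' ⟶ T ⋙ Φ
  l : Φ ⋙ L' ⟶ L ⋙ Φ
  η (X : C) : M'.η.app (Φ.obj X) ≫ t.app X = Φ.map (M.η.app X)
  μ (X : C) : T'.map (t.app X) ≫ t.app (T.obj X) ≫ Φ.map (M.μ.app X) =
    M'.μ.app (Φ.obj X) ≫ t.app X
  γ (X : C) : l.app X ≫ Φ.map (M.γ.app X) = M'.γ.app (Φ.obj X)
  ν (X : C) : M'.ν.app (Φ.obj X) ≫ L'.map (l.app X) ≫ l.app (L.obj X) =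
    l.app X ≫ Φ.map (M.ν.app X)
  d (X : C) : T'.map (l.app X) ≫ t.app (L.obj X) ≫ Φ.map (M.d.app X) =
    M'.d.app (Φ.obj X) ≫ L'.map (t.app X) ≫ l.app (T.obj X)

namespace LawMap

variable {M : MixedLaw T L} {M' : MixedLaw T' L'} {Φ : C ⥤ C'} (P : LawMap M M' Φ)
  {X : C} {Y : C'} (j : Y ⟶ Φ.obj X)

theorem iterSwapOne_powHom (n : ℕ) :
    T'.map (powHom P.l j n) ≫ P.t.app ((iter L n).obj X) ≫ Φ.map (iterSwapOne M.d n X) =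
      iterSwapOne M'.d n Y ≫ powHom P.l (T'.map j ≫ P.t.app X) n := by
  induction n with
  | zero =>
    change T'.map j ≫ P.t.app X ≫ Φ.map (𝟙 _) = 𝟙 _ ≫ T'.map j ≫ P.t.app X
    simp
  | succ n ih =>
    have h := M'.d.naturality (powHom P.l j n)
    dsimp only [powHom, iter_succ_obj, iter_succ_map, iterSwapOne, Functor.comp_map,
      Functor.comp_obj] at h ⊢
    rw [T'.map_comp, Φ.map_comp, Category.assoc, comp_eq_assoc_three (P.d _),
      Category.assoc, Category.assoc, comp_eq_assoc h, Category.assoc, ← comp_naturality,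
      ← L'.map_comp_assoc, ← L'.map_comp_assoc, Category.assoc (T'.map _), ih, L'.map_comp]
    simp only [Category.assoc]

theorem iterSwap_powHom (m n : ℕ) :
    powHom P.t (powHom P.l j n) m ≫ Φ.map (iterSwap M.d m n X) =
      iterSwap M'.d m n Y ≫ powHom P.l (powHom P.t j m) n := by
  induction m with
  | zero =>
    change powHom P.l j n ≫ Φ.map (𝟙 _) = 𝟙 _ ≫ powHom P.l j n
    simp
  | succ m ih =>
    have h := P.iterSwapOne_powHom (powHom P.t j m) n
    dsimp only [powHom, iter_succ_obj, iter_succ_map, iterSwap] at h ⊢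
    rw [Φ.map_comp, Category.assoc, comp_eq_assoc (comp_naturality P.t _).symm, Category.assoc,
      ← T'.map_comp_assoc, ih, T'.map_comp_assoc, h, Category.assoc]

/-- `g' : T'ⁿ Y → L'ⁿ Y` is the base change of `g : Tⁿ X → Lⁿ X` along `j : Y → Φ X`. -/
def IsBaseChange (n : ℕ) (g : (iter T n).obj X ⟶ (iter L n).obj X)
    (g' : (iter T' n).obj Y ⟶ (iter L' n).obj Y) : Prop :=
  powHom P.t j n ≫ Φ.map g = g' ≫ powHom P.l j n

variable {P j}

theorem IsBaseChange.face {n : ℕ} {g : (iter T n).obj X ⟶ (iter L n).obj X}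
    {g' : (iter T' n).obj Y ⟶ (iter L' n).obj Y} (h : P.IsBaseChange j n g g') (i : ℕ) (hi : 1 ≤ i)
    (hn : i ≤ n) : P.IsBaseChange j (n + 1) (M.face i hi hn g) (M'.face i hi hn g') := by
  unfold IsBaseChange at h ⊢
  rw [MixedLaw.face, MixedLaw.face, Φ.map_comp, Φ.map_comp, comp_eq_assoc (powHom_muAt _ P.μ j _),
    Category.assoc, comp_eq_assoc h, Category.assoc, powHom_nuAt _ P.ν j]
  simp only [Category.assoc]

theorem IsBaseChange.degen {n : ℕ} {g : (iter T (n + 1)).obj X ⟶ (iter L (n + 1)).obj X}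
    {g' : (iter T' (n + 1)).obj Y ⟶ (iter L' (n + 1)).obj Y} (h : P.IsBaseChange j (n + 1) g g')
    (i : ℕ) (hn : i ≤ n) : P.IsBaseChange j n (M.degen i hn g) (M'.degen i hn g') := by
  unfold IsBaseChange at h ⊢
  rw [MixedLaw.degen, MixedLaw.degen, Φ.map_comp, Φ.map_comp,
    comp_eq_assoc (powHom_etaAt _ P.η j _), Category.assoc, comp_eq_assoc h, Category.assoc,
    powHom_gamAt _ P.γ j]
  simp only [Category.assoc]

theorem IsBaseChange.prod {m n p : ℕ} (e : m + n = p) {x : (iter T m).obj X ⟶ (iter L m).obj X}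
    {x' : (iter T' m).obj Y ⟶ (iter L' m).obj Y} {y : (iter T n).obj X ⟶ (iter L n).obj X}
    {y' : (iter T' n).obj Y ⟶ (iter L' n).obj Y} (hx : P.IsBaseChange j m x x')
    (hy : P.IsBaseChange j n y y') : P.IsBaseChange j p (M.prod e x y) (M'.prod e x' y') := by
  unfold IsBaseChange at hx hy ⊢
  rw [← cancel_epi (iterIso T' e Y).hom, comp_eq_assoc (iterIso_powHom _ j e), Category.assoc,
    ← Φ.map_comp, MixedLaw.prod_eq, comp_eq_assoc (MixedLaw.prod_eq M' e x' y')]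
  simp only [CategoryTheory.Functor.map_comp, Category.assoc]
  rw [comp_eq_assoc (powHom_map P.t _ _ _), hy, ← map_powHom, Category.assoc,
    comp_eq_assoc (P.iterSwap_powHom j m n), Category.assoc,
    comp_eq_assoc (powHom_map P.l _ _ _), hx, ← map_powHom, Category.assoc, iterIso_powHom]

theorem isBaseChange_canon {h : T.obj X ⟶ X} {h' : T'.obj Y ⟶ Y} {v : X ⟶ L.obj X}
    {v' : Y ⟶ L'.obj Y} (Hh : T'.map j ≫ P.t.app X ≫ Φ.map h = h' ≫ j)
    (Hv : v' ≫ L'.map j ≫ P.l.app X = j ≫ Φ.map v) (n : ℕ) :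
    P.IsBaseChange j n (canon h v n) (canon h' v' n) := by
  rw [IsBaseChange, canon, canon, Φ.map_comp, comp_eq_assoc (powHom_actPow _ j Hh n),
    Category.assoc, Category.assoc, coactPow_powHom _ j Hv n]

end LawMap

end LawMap

end

end SimplicialDeformation

namespace SimplicialDeformation

noncomputable section

/-! ### Base change of squares of adjunctions -/

section SquareMap

universe v₁ v₂ v₃ v₄ u₁ u₂ u₃ u₄ v₁' v₂' v₃' v₄' u₁' u₂' u₃' u₄'

variable {D : Type u₁} {E : Type u₂} {A : Type u₃} {B : Type u₄}
  [Category.{v₁} D] [Category.{v₂} E] [Category.{v₃} A] [Category.{v₄} B]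
  {D' : Type u₁'} {E' : Type u₂'} {A' : Type u₃'} {B' : Type u₄'}
  [Category.{v₁'} D'] [Category.{v₂'} E'] [Category.{v₃'} A'] [Category.{v₄'} B']

/-- A map of squares of adjunctions: functors between the corners that commute with the functors of
the squares, compatibly with the units and counits and with `UV ≅ VU`. Only the part of the
structure that enters the mixed distributive law and the bialgebras `UV X` is recorded. -/
structure AdjSquareMap (S : AdjSquare D E A B) (S' : AdjSquare D' E' A' B') where
  {ΦD : D ⥤ D'}
  {ΦE : E ⥤ E'}
  {ΦA : A ⥤ A'}
  {ΦB : B ⥤ B'}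
  u₁ : ΦD ⋙ S'.U₁ ⟶ S.U₁ ⋙ ΦE
  u₀ : ΦA ⋙ S'.U₀ ⟶ S.U₀ ⋙ ΦB
  f₀ : ΦB ⋙ S'.F₀ ⟶ S.F₀ ⋙ ΦA
  v₁ : ΦD ⋙ S'.V₁ ⟶ S.V₁ ⋙ ΦA
  g₁ : ΦA ⋙ S'.G₁ ⟶ S.G₁ ⋙ ΦD
  v₀ : ΦE ⋙ S'.V₀ ⟶ S.V₀ ⋙ ΦB
  g₀ : ΦB ⋙ S'.G₀ ⟶ S.G₀ ⋙ ΦE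
  unitFU (X : B) : S'.adjFU₀.unit.app (ΦB.obj X) ≫ S'.U₀.map (f₀.app X) ≫ u₀.app (S.F₀.obj X) =
    ΦB.map (S.adjFU₀.unit.app X)
  counitFU (a : A) : S'.F₀.map (u₀.app a) ≫ f₀.app (S.U₀.obj a) ≫
    ΦA.map (S.adjFU₀.counit.app a) = S'.adjFU₀.counit.app (ΦA.obj a)
  unitVG (X : E) : S'.adjVG₀.unit.app (ΦE.obj X) ≫ S'.G₀.map (v₀.app X) ≫ g₀.app (S.V₀.obj X) =
    ΦE.map (S.adjVG₀.unit.app X)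
  counitVG (X : B) : S'.V₀.map (g₀.app X) ≫ v₀.app (S.G₀.obj X) ≫
    ΦB.map (S.adjVG₀.counit.app X) = S'.adjVG₀.counit.app (ΦB.obj X)
  counitVG₁ (a : A) : S'.V₁.map (g₁.app a) ≫ v₁.app (S.G₁.obj a) ≫
    ΦA.map (S.adjVG₁.counit.app a) = S'.adjVG₁.counit.app (ΦA.obj a)
  isoUV (X : D) : S'.U₀.map (v₁.app X) ≫ u₀.app (S.V₁.obj X) ≫ ΦB.map (S.isoUV.hom.app X) =
    S'.isoUV.hom.app (ΦD.obj X) ≫ S'.V₀.map (u₁.app X) ≫ v₀.app (S.U₁.obj X)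

theorem AdjSquare.coact_map_counit (S : AdjSquare D E A B) (a : A) : S.coact (S.G₁.obj a) ≫
    S.L.map (S.U₀.map (S.adjVG₁.counit.app a)) = (S.kappa a).hom := by
  have := S.kappa_naturality (S.adjVG₁.counit.app a)
  dsimp [AdjSquare.coact] at this ⊢
  rw [Category.assoc, ← this, ← S.U₀.map_comp_assoc, ← S.V₁.map_comp,
    Adjunction.right_triangle_components]
  simp

namespace AdjSquareMap

variable {S : AdjSquare D E A B} {S' : AdjSquare D' E' A' B'} (P : AdjSquareMap S S')

/-- The map `⊤ₕΦ → Φ⊤ₕ`. -/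
def t : P.ΦB ⋙ S'.T ⟶ S.T ⋙ P.ΦB where
  app X := S'.U₀.map (P.f₀.app X) ≫ P.u₀.app (S.F₀.obj X)
  naturality X Y f := by
    have h1 := congr(S'.U₀.map $(P.f₀.naturality f))
    have h2 := P.u₀.naturality (S.F₀.map f)
    rw [S'.U₀.map_comp, S'.U₀.map_comp] at h1
    dsimp at h1 h2 ⊢
    rw [comp_eq_assoc h1, Category.assoc, Category.assoc, h2]

/-- The map `⊥ᵥΦ → Φ⊥ᵥ`. -/
def l : P.ΦB ⋙ S'.L ⟶ S.L ⋙ P.ΦB where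
  app X := S'.V₀.map (P.g₀.app X) ≫ P.v₀.app (S.G₀.obj X)
  naturality X Y f := by
    have h1 := congr(S'.V₀.map $(P.g₀.naturality f))
    have h2 := P.v₀.naturality (S.G₀.map f)
    rw [S'.V₀.map_comp, S'.V₀.map_comp] at h1
    dsimp at h1 h2 ⊢
    rw [comp_eq_assoc h1, Category.assoc, Category.assoc, h2]

/-- The map `UV Φ → Φ UV`. -/
def uv : P.ΦD ⋙ S'.UV ⟶ S.UV ⋙ P.ΦB where
  app X := S'.U₀.map (P.v₁.app X) ≫ P.u₀.app (S.V₁.obj X)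
  naturality X Y f := by
    have h1 := congr(S'.U₀.map $(P.v₁.naturality f))
    have h2 := P.u₀.naturality (S.V₁.map f)
    rw [S'.U₀.map_comp, S'.U₀.map_comp] at h1
    dsimp at h1 h2 ⊢
    rw [comp_eq_assoc h1, Category.assoc, Category.assoc, h2]

theorem t_app (X : B) : P.t.app X = S'.U₀.map (P.f₀.app X) ≫ P.u₀.app (S.F₀.obj X) := rfl

theorem l_app (X : B) : P.l.app X = S'.V₀.map (P.g₀.app X) ≫ P.v₀.app (S.G₀.obj X) := rfl

theorem uv_app (X : D) : P.uv.app X = S'.U₀.map (P.v₁.app X) ≫ P.u₀.app (S.V₁.obj X) := rfl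

theorem t_naturality {X Y : B} (f : X ⟶ Y) :
    S'.T.map (P.ΦB.map f) ≫ P.t.app Y = P.t.app X ≫ P.ΦB.map (S.T.map f) := P.t.naturality f

theorem l_naturality {X Y : B} (f : X ⟶ Y) :
    S'.L.map (P.ΦB.map f) ≫ P.l.app Y = P.l.app X ≫ P.ΦB.map (S.L.map f) := P.l.naturality f

theorem uv_naturality {X Y : D} (f : X ⟶ Y) :
    S'.UV.map (P.ΦD.map f) ≫ P.uv.app Y = P.uv.app X ≫ P.ΦB.map (S.UV.map f) := P.uv.naturality f

/-- The action of `⊤ₕ` on `U₀ a` is compatible with base change. -/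
theorem map_u₀_action (a : A) :
    S'.T.map (P.u₀.app a) ≫ P.t.app (S.U₀.obj a) ≫
        P.ΦB.map (S.U₀.map (S.adjFU₀.counit.app a)) =
      S'.U₀.map (S'.adjFU₀.counit.app (P.ΦA.obj a)) ≫ P.u₀.app a := by
  have h1 := P.u₀.naturality (S.adjFU₀.counit.app a)
  have h2 := congr(S'.U₀.map $(P.counitFU a))
  rw [S'.U₀.map_comp, S'.U₀.map_comp] at h2
  dsimp [t_app] at h1 h2 ⊢
  rw [Category.assoc, ← h1, comp_eq_assoc_three h2]

/-- The coaction of `⊥ᵥ` on `V₀ X` is compatible with base change. -/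
theorem coaction_map_v₀ (X : E) :
    S'.V₀.map (S'.adjVG₀.unit.app (P.ΦE.obj X)) ≫ S'.L.map (P.v₀.app X) ≫
        P.l.app (S.V₀.obj X) =
      P.v₀.app X ≫ P.ΦB.map (S.V₀.map (S.adjVG₀.unit.app X)) := by
  have h1 := P.v₀.naturality (S.adjVG₀.unit.app X)
  have h2 := congr(S'.V₀.map $(P.unitVG X))
  rw [S'.V₀.map_comp, S'.V₀.map_comp] at h2
  dsimp [l_app] at h1 h2 ⊢
  rw [← h1, comp_eq_assoc_three h2]

theorem map_uv_act (X : D) :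
    S'.T.map (P.uv.app X) ≫ P.t.app (S.UV.obj X) ≫ P.ΦB.map (S.act X) =
      S'.act (P.ΦD.obj X) ≫ P.uv.app X := by
  have h1 := congr(S'.U₀.map $(S'.adjFU₀.counit.naturality (P.v₁.app X)))
  rw [S'.U₀.map_comp, S'.U₀.map_comp] at h1
  have h2 := P.map_u₀_action (S.V₁.obj X)
  rw [uv_app, S'.T.map_comp, Category.assoc]
  refine (congrArg (_ ≫ ·) h2).trans ?_
  exact (comp_eq_assoc h1 _).trans (Category.assoc _ _ _)

variable (H : S.IsCompatible) (H' : S'.IsCompatible)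

section
include H H'

theorem coact_map_uv (X : D) :
    S'.coact (P.ΦD.obj X) ≫ S'.L.map (P.uv.app X) ≫ P.l.app (S.UV.obj X) =
      P.uv.app X ≫ P.ΦB.map (S.coact X) := by
  have e := P.isoUV X
  have e1 : S'.isoUV.inv.app (P.ΦD.obj X) ≫ P.uv.app X =
      S'.V₀.map (P.u₁.app X) ≫ P.v₀.app (S.U₁.obj X) ≫ P.ΦB.map (S.isoUV.inv.app X) := by
    rw [← cancel_epi (S'.isoUV.hom.app (P.ΦD.obj X)), Iso.hom_inv_id_app_assoc,
      comp_eq_assoc_three e.symm]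
    simp [uv_app]
  have e2 := congr(S'.V₀.map $(S'.adjVG₀.unit.naturality (P.u₁.app X)))
  rw [S'.V₀.map_comp, S'.V₀.map_comp] at e2
  have e3 := P.coaction_map_v₀ (S.U₁.obj X)
  have e4 := P.l_naturality (S.isoUV.inv.app X)
  have h := H.coact_eq X
  have h' := H'.coact_eq (P.ΦD.obj X)
  change S.coact X = _ at h
  change S'.coact (P.ΦD.obj X) = _ at h'
  rw [h, h']
  dsimp at e e1 e2 e3 e4 ⊢
  rw [Category.assoc, Category.assoc]
  have e5 := congr(S'.L.map $e1)
  simp only [CategoryTheory.Functor.map_comp] at e5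
  dsimp at e5
  rw [comp_eq_assoc e5]
  simp only [CategoryTheory.Functor.map_comp, Category.assoc]
  rw [e4, comp_eq_assoc e2.symm, Category.assoc, comp_eq_assoc_three e3, Category.assoc,
    comp_eq_assoc_three e.symm, Category.assoc, Category.assoc]
  simp [uv_app]

theorem kappa_map_u₀ (a : A) :
    (S'.kappa (P.ΦA.obj a)).hom ≫ S'.L.map (P.u₀.app a) ≫ P.l.app (S.U₀.obj a) =
      S'.UV.map (P.g₁.app a) ≫ P.uv.app (S.G₁.obj a) ≫ P.ΦB.map (S.kappa a).hom := by
  have e1 := P.coact_map_uv H H' (S.G₁.obj a)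
  have e2 := S'.coact_naturality (X := S'.G₁.obj (P.ΦA.obj a)) (Y := P.ΦD.obj (S.G₁.obj a))
    (P.g₁.app a)
  have e3 := P.l_naturality (X := S.UV.obj (S.G₁.obj a)) (Y := S.U₀.obj a)
    (S.U₀.map (S.adjVG₁.counit.app a))
  have e4 : S'.U₀.map (S'.adjVG₁.counit.app (P.ΦA.obj a)) ≫ P.u₀.app a =
      S'.UV.map (P.g₁.app a) ≫ P.uv.app (S.G₁.obj a) ≫
        P.ΦB.map (S.U₀.map (S.adjVG₁.counit.app a)) := by
    have e := congr(S'.U₀.map $(P.counitVG₁ a))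
    have e' := P.u₀.naturality (S.adjVG₁.counit.app a)
    rw [S'.U₀.map_comp, S'.U₀.map_comp] at e
    dsimp [uv_app] at e e' ⊢
    rw [← e, Category.assoc, Category.assoc, Category.assoc, e']
  rw [← S.coact_map_counit, ← S'.coact_map_counit, Category.assoc, ← S'.L.map_comp_assoc, e4,
    S'.L.map_comp, S'.L.map_comp,
    Category.assoc, Category.assoc, e3, comp_eq_assoc e2.symm, Category.assoc,
    comp_eq_assoc_three e1, P.ΦB.map_comp, Category.assoc]

theorem liftAct_map_u₀ (a : A) :
    S'.T.map (S'.L.map (P.u₀.app a) ≫ P.l.app (S.U₀.obj a)) ≫ P.t.app (S.L.obj (S.U₀.obj a)) ≫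
        P.ΦB.map (S.liftAct a) =
      S'.liftAct (P.ΦA.obj a) ≫ S'.L.map (P.u₀.app a) ≫ P.l.app (S.U₀.obj a) := by
  have e1 := P.kappa_map_u₀ H H' a
  have e2 := S.map_kappa_liftAct a
  have e3 := S'.map_kappa_liftAct (P.ΦA.obj a)
  have e4 := P.t_naturality (S.kappa a).hom
  have e5 := P.map_uv_act (S.G₁.obj a)
  have e6 := S'.act_naturality (P.g₁.app a)
  rw [← cancel_epi (S'.T.map (S'.kappa (P.ΦA.obj a)).hom), ← S'.T.map_comp_assoc, e1,
    comp_eq_assoc e3, S'.T.map_comp, S'.T.map_comp, Category.assoc, Category.assoc,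
    comp_eq_assoc e4, Category.assoc, ← P.ΦB.map_comp, e2, P.ΦB.map_comp, Category.assoc, e1]
  refine (congrArg (_ ≫ ·) (comp_eq_assoc_three e5 _)).trans ?_
  rw [Category.assoc]
  exact (comp_eq_assoc e6 _).trans (Category.assoc _ _ _)

end

/-- A map of compatible squares of adjunctions induces a map of mixed distributive laws. -/
def lawMap : LawMap H.law H'.law P.ΦB where
  t := P.t
  l := P.l
  η X := P.unitFU X
  μ X := by
    have e1 := P.map_u₀_action (S.F₀.obj X)
    have e2 := congr(S'.U₀.map $(S'.adjFU₀.counit.naturality (P.f₀.app X)))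
    rw [S'.U₀.map_comp, S'.U₀.map_comp] at e2
    rw [P.t_app X, S'.T.map_comp, Category.assoc]
    refine (congrArg (_ ≫ ·) e1).trans ?_
    exact (comp_eq_assoc e2 _).trans (Category.assoc _ _ _)
  γ X := (Category.assoc _ _ _).trans (P.counitVG X)
  ν X := by
    have e1 := P.coaction_map_v₀ (S.G₀.obj X)
    have e2 := congr(S'.V₀.map $(S'.adjVG₀.unit.naturality (P.g₀.app X)))
    rw [S'.V₀.map_comp, S'.V₀.map_comp] at e2
    rw [P.l_app X, S'.L.map_comp, Category.assoc, Category.assoc]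
    refine Eq.trans ?_ (congrArg (_ ≫ ·) e1)
    exact (comp_eq_assoc e2.symm _).trans (Category.assoc _ _ _)
  d X := by
    have e1 := P.liftAct_map_u₀ H H' (S.F₀.obj X)
    have e2 := S'.liftAct_naturality (P.f₀.app X)
    have e3 := P.t_naturality (X := S.L.obj X) (Y := S.L.obj (S.T.obj X))
      (S.L.map (S.adjFU₀.unit.app X))
    have e4 := congr(S'.T.map $(P.l_naturality (X := X) (Y := S.T.obj X)
      (S.adjFU₀.unit.app X)))
    have e5 := congr(S'.T.map (S'.L.map $(P.unitFU X)))
    simp only [S'.T.map_comp, S'.L.map_comp] at e4 e5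
    rw [S'.T.map_comp, Category.assoc] at e1
    change _ ≫ _ ≫ P.ΦB.map (S.delta.app X) = S'.delta.app _ ≫ _
    rw [H.delta_eq, H'.delta_eq, P.ΦB.map_comp, comp_eq_assoc e3.symm, Category.assoc,
      comp_eq_assoc e4.symm, ← e5, P.t_app X, S'.L.map_comp]
    simp only [Category.assoc]
    refine (congrArg (_ ≫ _ ≫ ·) e1).trans ?_
    exact congrArg (_ ≫ ·) ((comp_eq_assoc e2 _).trans (Category.assoc _ _ _))

end AdjSquareMap

end SquareMap

end

end SimplicialDeformation

namespace SimplicialDeformation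

set_option linter.unusedSectionVars false

noncomputable section

section

variable {Λ : Type u} [CommRing Λ] [IsLocalRing Λ]

open ArtAlg

/-! ### Base change in a square of category-valued functors -/

theorem natIso_id_app (𝓒 : CatFunctor.{u, v, w} Λ) {A A' : ArtAlg Λ} (f : A ⟶ A') (X : 𝓒.at A) :
    (CatFunctor.natIso (𝟙 𝓒) f).hom.app X = 𝟙 ((𝓒.bc f).obj X) :=
  Category.id_comp (𝟙 ((𝓒.bc f).obj X))

theorem natIso_comp_app {𝓒 𝓒' 𝓒'' : CatFunctor.{u, v, w} Λ} (F : 𝓒 ⟶ 𝓒') (G : 𝓒' ⟶ 𝓒'')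
    {A A' : ArtAlg Λ} (f : A ⟶ A') (X : 𝓒.at A) :
    (CatFunctor.natIso (F ≫ G) f).hom.app X =
      (CatFunctor.appAt G A').map ((CatFunctor.natIso F f).hom.app X) ≫
        (CatFunctor.natIso G f).hom.app ((CatFunctor.appAt F A).obj X) := by
  refine (Category.id_comp _).trans (congrArg (_ ≫ ·) ?_)
  exact (Category.id_comp _).trans (Category.comp_id _)

theorem adjAt_unit_naturality {𝓒 𝓒' : CatFunctor.{u, v, w} Λ} {F : 𝓒 ⟶ 𝓒'} {U : 𝓒' ⟶ 𝓒}
    (adj : Bicategory.Adjunction F U) {A A' : ArtAlg Λ} (f : A ⟶ A') (X : 𝓒.at A) :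
    (adjAt adj A').unit.app ((𝓒.bc f).obj X) ≫
      (CatFunctor.appAt U A').map ((CatFunctor.natIso F f).hom.app X) ≫
        (CatFunctor.natIso U f).hom.app ((CatFunctor.appAt F A).obj X) =
      (𝓒.bc f).map ((adjAt adj A).unit.app X) := by
  have h : (adjAt adj A').unit.app ((𝓒.bc f).obj X) ≫ (CatFunctor.natIso (F ≫ U) f).hom.app X =
      (CatFunctor.natIso (𝟙 𝓒) f).hom.app X ≫ (𝓒.bc f).map ((adjAt adj A).unit.app X) :=
    congr($(adj.unit.as.naturality f.toLoc).toNatTrans.app X)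
  rw [natIso_comp_app, natIso_id_app] at h
  exact h.trans (Category.id_comp _)

theorem adjAt_counit_naturality {𝓒 𝓒' : CatFunctor.{u, v, w} Λ} {F : 𝓒 ⟶ 𝓒'} {U : 𝓒' ⟶ 𝓒}
    (adj : Bicategory.Adjunction F U) {A A' : ArtAlg Λ} (f : A ⟶ A') (X : 𝓒'.at A) :
    (CatFunctor.appAt F A').map ((CatFunctor.natIso U f).hom.app X) ≫
      (CatFunctor.natIso F f).hom.app ((CatFunctor.appAt U A).obj X) ≫
        (𝓒'.bc f).map ((adjAt adj A).counit.app X) =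
      (adjAt adj A').counit.app ((𝓒'.bc f).obj X) := by
  have h : (adjAt adj A').counit.app ((𝓒'.bc f).obj X) ≫
      (CatFunctor.natIso (𝟙 𝓒') f).hom.app X =
      (CatFunctor.natIso (U ≫ F) f).hom.app X ≫ (𝓒'.bc f).map ((adjAt adj A).counit.app X) :=
    congr($(adj.counit.as.naturality f.toLoc).toNatTrans.app X)
  rw [natIso_comp_app, natIso_id_app] at h
  exact (Category.assoc _ _ _).symm.trans (h.symm.trans (Category.comp_id _))

theorem isoAt_naturality {𝓒 𝓒' : CatFunctor.{u, v, w} Λ} {S T : 𝓒 ⟶ 𝓒'} (e : S ≅ T)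
    {A A' : ArtAlg Λ} (f : A ⟶ A') (X : 𝓒.at A) :
    (CatFunctor.natIso S f).hom.app X ≫ (𝓒'.bc f).map ((isoAt e A).hom.app X) =
      (isoAt e A').hom.app ((𝓒.bc f).obj X) ≫ (CatFunctor.natIso T f).hom.app X :=
  congr($(e.hom.as.naturality f.toLoc).toNatTrans.app X).symm

namespace SquareDiagram

variable {𝓓 𝓔 𝓐 𝓑 : CatFunctor.{u, v, w} Λ} (S : SquareDiagram 𝓓 𝓔 𝓐 𝓑)

/-- Base change along `f` is a map of squares of adjunctions. -/
def bcSq {A A' : ArtAlg Λ} (f : A ⟶ A') : AdjSquareMap (S.sqAt A) (S.sqAt A') where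
  ΦD := 𝓓.bc f
  ΦE := 𝓔.bc f
  ΦA := 𝓐.bc f
  ΦB := 𝓑.bc f
  u₁ := (CatFunctor.natIso S.U₁ f).hom
  u₀ := (CatFunctor.natIso S.U₀ f).hom
  f₀ := (CatFunctor.natIso S.F₀ f).hom
  v₁ := (CatFunctor.natIso S.V₁ f).hom
  g₁ := (CatFunctor.natIso S.G₁ f).hom
  v₀ := (CatFunctor.natIso S.V₀ f).hom
  g₀ := (CatFunctor.natIso S.G₀ f).hom
  unitFU X := adjAt_unit_naturality S.adjFU₀ f X
  counitFU a := adjAt_counit_naturality S.adjFU₀ f a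
  unitVG X := adjAt_unit_naturality S.adjVG₀ f X
  counitVG X := adjAt_counit_naturality S.adjVG₀ f X
  counitVG₁ a := adjAt_counit_naturality S.adjVG₁ f a
  isoUV X := by
    have h := isoAt_naturality S.isoUV f X
    rw [natIso_comp_app, natIso_comp_app] at h
    exact (Category.assoc _ _ _).symm.trans h

theorem natIso_T {A A' : ArtAlg Λ} (f : A ⟶ A') (X : 𝓑.at A) :
    (CatFunctor.natIso (S.F₀ ≫ S.U₀) f).hom.app X = (S.bcSq f).t.app X :=
  natIso_comp_app _ _ _ _

theorem natIso_L {A A' : ArtAlg Λ} (f : A ⟶ A') (X : 𝓑.at A) :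
    (CatFunctor.natIso (S.G₀ ≫ S.V₀) f).hom.app X = (S.bcSq f).l.app X :=
  natIso_comp_app _ _ _ _

theorem natIso_UV {A A' : ArtAlg Λ} (f : A ⟶ A') (X : 𝓓.at A) :
    (CatFunctor.natIso (S.V₁ ≫ S.U₀) f).hom.app X = (S.bcSq f).uv.app X :=
  natIso_comp_app _ _ _ _

/-- The base change isomorphisms of `⊤ₕⁿ B`, for a formal object `B`. -/
theorem powIso_T_inv (B : FormalObject 𝓑) {A A' : ArtAlg Λ} (f : A ⟶ A') (n : ℕ) :
    ((B.pow (S.F₀ ≫ S.U₀) n).iso f).inv = powHom (S.bcSq f).t (B.iso f).inv n := by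
  induction n with
  | zero => rfl
  | succ n ih =>
    dsimp only [powHom]
    rw [← ih, ← natIso_T]
    rfl

/-- The base change isomorphisms of `⊥ᵥⁿ B`, for a formal object `B`. -/
theorem powIso_L_inv (B : FormalObject 𝓑) {A A' : ArtAlg Λ} (f : A ⟶ A') (n : ℕ) :
    ((B.pow (S.G₀ ≫ S.V₀) n).iso f).inv = powHom (S.bcSq f).l (B.iso f).inv n := by
  induction n with
  | zero => rfl
  | succ n ih =>
    dsimp only [powHom]
    rw [← ih, ← natIso_L]
    rfl

/-- The maps of `𝓑(A')` that are obtained by base change from those of `𝓑(A)`. -/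
theorem hom_map_eq_iff {D : 𝓓.at (k Λ)} (hS : S.IsCompatible) (B : S.Lift D) {A A' : ArtAlg Λ}
    (f : A ⟶ A') (n : ℕ) (g : (B.hom n).obj A) (g' : (B.hom n).obj A') :
    (B.hom n).map f g = g' ↔
      ((S.bcSq f).lawMap (hS A) (hS A')).IsBaseChange (B.toFormal.iso f).inv n g g' := by
  have h {C : Type w} [Category.{v} C] {X X' Y Y' : C} (e : X ≅ X') (e' : Y ≅ Y') (m : X ⟶ Y)
      (m' : X' ⟶ Y') : e.inv ≫ m ≫ e'.hom = m' ↔ e.inv ≫ m = m' ≫ e'.inv := by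
    rw [Iso.eq_comp_inv, Category.assoc]
  unfold LawMap.IsBaseChange
  change _ ↔ powHom (S.bcSq f).t _ n ≫ _ = _ ≫ powHom (S.bcSq f).l _ n
  rw [← powIso_T_inv, ← powIso_L_inv]
  exact h _ _ _ _

end SquareDiagram

end

end

end SimplicialDeformation

namespace SimplicialDeformation

set_option linter.unusedSectionVars false

noncomputable section

section

variable {Λ : Type u} [CommRing Λ] [IsLocalRing Λ]

/-! ### Artinian algebras -/

namespace ArtAlg

/-- An Artinian local `Λ`-algebra in which every element is congruent to an element of `Λ` modulo
the maximal ideal. -/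
def of (R : Type u) [CommRing R] [Algebra Λ R] [IsLocalRing R] [IsArtinianRing R]
    (h : ∀ a : R, ∃ l : Λ, ¬ IsUnit (a - algebraMap Λ R l)) : ArtAlg Λ where
  carrier := R
  residue_surjective x := by
    obtain ⟨a, rfl⟩ := IsLocalRing.residue_surjective x
    obtain ⟨l, hl⟩ := h a
    refine ⟨l, ?_⟩
    have h' := (IsLocalRing.residue_eq_zero_iff _).2 ((IsLocalRing.mem_maximalIdeal _).2 hl)
    rw [map_sub, sub_eq_zero] at h'
    exact h'.symm

theorem exists_not_isUnit_sub (A : ArtAlg Λ) (a : A.carrier) :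
    ∃ l : Λ, ¬ IsUnit (a - algebraMap Λ A.carrier l) := by
  obtain ⟨l, hl⟩ := A.residue_surjective (IsLocalRing.residue _ a)
  refine ⟨l, (IsLocalRing.mem_maximalIdeal _).1 ((IsLocalRing.residue_eq_zero_iff _).1 ?_)⟩
  rw [map_sub, sub_eq_zero]
  exact hl.symm

theorem isUnit_hom_iff {A A' : ArtAlg Λ} (f : A ⟶ A') (a : A.carrier) :
    IsUnit (f.hom a) ↔ IsUnit a := by
  refine ⟨fun h => ?_, fun h => h.map f.hom⟩
  by_contra h'
  obtain ⟨n, hn⟩ := IsArtinianRing.isNilpotent_jacobson_bot (R := A.carrier)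
  rw [IsLocalRing.jacobson_eq_maximalIdeal _ bot_ne_top] at hn
  have h0 : a ^ n = 0 := by
    have := Ideal.pow_mem_pow ((IsLocalRing.mem_maximalIdeal a).2 h') n
    rw [hn] at this
    exact this
  have h1 := h.pow n
  rw [← map_pow, h0, map_zero] at h1
  exact not_isUnit_zero h1

theorem surj_toK (A : ArtAlg Λ) : Surj A.toK := fun x => by
  obtain ⟨l, rfl⟩ := IsLocalRing.residue_surjective x
  exact ⟨algebraMap Λ A.carrier l, A.toK.hom.commutes l⟩

section Quotient

variable (A : ArtAlg Λ) (I : Ideal A.carrier) (hI : I ≠ ⊤)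

/-- The quotient of an Artinian algebra by a proper ideal. -/
def quot : ArtAlg Λ :=
  haveI : Nontrivial (A.carrier ⧸ I) := Ideal.Quotient.nontrivial_iff.2 hI
  haveI : IsLocalRing (A.carrier ⧸ I) :=
    IsLocalRing.of_surjective' (Ideal.Quotient.mk I) Ideal.Quotient.mk_surjective
  haveI : IsArtinianRing (A.carrier ⧸ I) :=
    Ideal.Quotient.mk_surjective.isArtinianRing (f := Ideal.Quotient.mk I)
  of (A.carrier ⧸ I) fun a => by
    obtain ⟨a, rfl⟩ := Ideal.Quotient.mk_surjective a
    obtain ⟨l, hl⟩ := A.exists_not_isUnit_sub a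
    refine ⟨l, fun h => hl ?_⟩
    change IsUnit (Ideal.Quotient.mk I (a - algebraMap Λ A.carrier l)) at h
    have := IsLocalHom.of_surjective (Ideal.Quotient.mk I) Ideal.Quotient.mk_surjective
    exact isUnit_of_map_unit (Ideal.Quotient.mk I) _ h

/-- The quotient map. -/
def toQuot : A ⟶ A.quot I hI := ⟨Ideal.Quotient.mkₐ Λ I⟩

theorem surj_toQuot : Surj (A.toQuot I hI) := Ideal.Quotient.mk_surjective

theorem toQuot_eq_zero_iff (a : A.carrier) : (A.toQuot I hI).hom a = 0 ↔ a ∈ I :=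
  Ideal.Quotient.eq_zero_iff_mem

end Quotient

section Pullback

variable {B C A : ArtAlg Λ} (f : B ⟶ A) (g : C ⟶ A)

/-- The fibre product of Artinian local algebras along surjections is again such an algebra. -/
theorem exists_isFibreProduct (hf : Surj f) (hg : Surj g) :
    ∃ (P : ArtAlg Λ) (p : P ⟶ B) (q : P ⟶ C), IsFibreProduct p q f g ∧ Surj p ∧ Surj q := by
  let R := AlgHom.equalizer (f.hom.comp (AlgHom.fst Λ B.carrier C.carrier))
    (g.hom.comp (AlgHom.snd Λ B.carrier C.carrier))
  have hR (x : R) : f.hom x.1.1 = g.hom x.1.2 := x.2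
  let p : R →ₐ[Λ] B.carrier := (AlgHom.fst Λ B.carrier C.carrier).comp R.val
  let q : R →ₐ[Λ] C.carrier := (AlgHom.snd Λ B.carrier C.carrier).comp R.val
  have hp : Function.Surjective p := fun b => by
    obtain ⟨c, hc⟩ := hg (f.hom b)
    exact ⟨⟨(b, c), hc.symm⟩, rfl⟩
  have hq : Function.Surjective q := fun c => by
    obtain ⟨b, hb⟩ := hf (g.hom c)
    exact ⟨⟨(b, c), hb⟩, rfl⟩
  have hu (x : R) (h : IsUnit (p x)) : IsUnit x := by
    have h' : IsUnit (q x) := by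
      rw [← isUnit_hom_iff g]
      change IsUnit (g.hom x.1.2)
      rw [← hR]
      exact h.map f.hom
    obtain ⟨b, hb⟩ := h
    obtain ⟨c, hc⟩ := h'
    have e1 : f.hom (b⁻¹ : B.carrierˣ) = g.hom (c⁻¹ : C.carrierˣ) := by
      have e := hR x
      change f.hom (p x) = g.hom (q x) at e
      rw [← hb, ← hc] at e
      have e' : Units.map (f.hom : B.carrier →* A.carrier) b =
          Units.map (g.hom : C.carrier →* A.carrier) c := Units.ext e
      have := congrArg (fun y => ((y⁻¹ : A.carrierˣ) : A.carrier)) e'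
      exact this
    refine IsUnit.of_mul_eq_one ⟨((b⁻¹ : B.carrierˣ), (c⁻¹ : C.carrierˣ)), e1⟩ ?_
    refine Subtype.ext (Prod.ext ?_ ?_)
    · change p x * _ = 1
      rw [← hb, Units.mul_inv]
    · change q x * _ = 1
      rw [← hc, Units.mul_inv]
  have : IsLocalHom p.toRingHom := ⟨hu⟩
  have : IsLocalRing R := p.toRingHom.domain_isLocalRing
  have : IsArtinianRing R := by
    let _ := p.toRingHom.toAlgebra
    let _ := q.toRingHom.toAlgebra
    have : IsArtinian R B.carrier := isArtinian_of_surjective_algebraMap hp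
    have : IsArtinian R C.carrier := isArtinian_of_surjective_algebraMap hq
    exact isArtinian_of_injective (P := B.carrier × C.carrier)
      ((Algebra.linearMap R B.carrier).prod (Algebra.linearMap R C.carrier))
      (fun x y h => Subtype.ext h)
  refine ⟨of R fun a => ?_, ⟨p⟩, ⟨q⟩, ⟨?_, ?_⟩, hp, hq⟩
  · obtain ⟨l, hl⟩ := B.exists_not_isUnit_sub (p a)
    refine ⟨l, fun h => hl ?_⟩
    have := h.map p
    rwa [map_sub, AlgHom.commutes] at this
  · exact ArtAlg.hom_ext (AlgHom.ext hR)
  · intro b c h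
    refine ⟨⟨(b, c), h⟩, ⟨rfl, rfl⟩, ?_⟩
    rintro y ⟨rfl, rfl⟩
    rfl

variable {f g} {P : ArtAlg Λ} {p : P ⟶ B} {q : P ⟶ C}

theorem IsFibreProduct.ext (h : IsFibreProduct p q f g) {x y : P.carrier}
    (h₁ : p.hom x = p.hom y) (h₂ : q.hom x = q.hom y) : x = y := by
  have e : f.hom (p.hom y) = g.hom (q.hom y) := congr($(h.w).hom y)
  exact (h.existsUnique _ _ e).unique ⟨h₁, h₂⟩ ⟨rfl, rfl⟩

theorem IsFibreProduct.exists_lift (h : IsFibreProduct p q f g) {Z : ArtAlg Λ} (s : Z ⟶ B)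
    (t : Z ⟶ C) (w : s ≫ f = t ≫ g) : ∃ r : Z ⟶ P, r ≫ p = s ∧ r ≫ q = t := by
  have e (z : Z.carrier) : f.hom (s.hom z) = g.hom (t.hom z) := congr($(w).hom z)
  choose r hr using fun z => (h.existsUnique _ _ (e z)).exists
  refine ⟨⟨AlgHom.mk ⟨⟨⟨r, ?_⟩, ?_⟩, ?_, ?_⟩ ?_⟩, ?_, ?_⟩
  · exact h.ext (by simp [hr]) (by simp [hr])
  · exact fun x y => h.ext (by simp [hr]) (by simp [hr])
  · exact h.ext (by simp [hr]) (by simp [hr])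
  · exact fun x y => h.ext (by simp [hr]) (by simp [hr])
  · exact fun x => h.ext (by simp [hr]) (by simp [hr])
  · exact ArtAlg.hom_ext (AlgHom.ext fun z => (hr z).1)
  · exact ArtAlg.hom_ext (AlgHom.ext fun z => (hr z).2)

end Pullback

/-- If the kernel of `f : A → A'` has square zero, then `(a, b, c) ↦ a - b + c` is a homomorphism
`A ×_{A'} A ×_{A'} A → A`. -/
theorem exists_heap_hom {A A' P : ArtAlg Λ} (f : A ⟶ A')
    (hf : ∀ x y, f.hom x = 0 → f.hom y = 0 → x * y = 0) (a b c : P ⟶ A) (hab : a ≫ f = b ≫ f)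
    (hbc : b ≫ f = c ≫ f) : ∃ r : P ⟶ A, ∀ x, r.hom x = a.hom x - b.hom x + c.hom x := by
  have h1 (x) : f.hom (a.hom x - b.hom x) = 0 := by
    rw [map_sub, sub_eq_zero]
    exact congr($(hab).hom x)
  have h2 (x) : f.hom (c.hom x - b.hom x) = 0 := by
    rw [map_sub, sub_eq_zero]
    exact congr($(hbc).hom x).symm
  refine ⟨⟨AlgHom.ofLinearMap (a.hom.toLinearMap - b.hom.toLinearMap + c.hom.toLinearMap) ?_ ?_⟩,
    fun x => rfl⟩
  · simp
  · intro x y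
    have e2 := hf _ _ (h1 x) (h2 y)
    have e3 := hf _ _ (h2 x) (h1 y)
    simp only [LinearMap.add_apply, LinearMap.sub_apply, AlgHom.toLinearMap_apply, map_mul]
    linear_combination -e2 - e3

end ArtAlg

end

end

end SimplicialDeformation

namespace SimplicialDeformation

set_option linter.unusedSectionVars false

noncomputable section

section

variable {Λ : Type u} [CommRing Λ] [IsLocalRing Λ]

open ArtAlg

/-! ### Uniform triviality: base change reflects isomorphisms -/

section Transfer

variable {𝓑 : CatFunctor.{u, v, w} Λ} {A : ArtAlg Λ} (X : 𝓑.at A)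

/-- Base change of endomorphisms of `X_B` along `h : B → C`, for an object `X` over `A` and an
`A`-algebra `B`. -/
def bcEnd {B C : ArtAlg Λ} (j : A ⟶ B) (h : B ⟶ C) (j' : A ⟶ C) (e : j ≫ h = j')
    (φ : (𝓑.bc j).obj X ⟶ (𝓑.bc j).obj X) : (𝓑.bc j').obj X ⟶ (𝓑.bc j').obj X :=
  (𝓑.bcComp j h j' e).hom.app X ≫ (𝓑.bc h).map φ ≫ (𝓑.bcComp j h j' e).inv.app X

section

variable {B C : ArtAlg Λ} (j : A ⟶ B) (h : B ⟶ C) (j' : A ⟶ C) (e : j ≫ h = j')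

theorem bcEnd_id : bcEnd X j h j' e (𝟙 _) = 𝟙 _ := by
  rw [bcEnd, (𝓑.bc h).map_id]
  refine (congrArg (_ ≫ ·) (Category.id_comp _)).trans ?_
  rw [Iso.hom_inv_id_app]

theorem bcEnd_comp (φ ψ : (𝓑.bc j).obj X ⟶ (𝓑.bc j).obj X) :
    bcEnd X j h j' e (φ ≫ ψ) = bcEnd X j h j' e φ ≫ bcEnd X j h j' e ψ := by
  simp [bcEnd]

theorem bcEnd_eq_iff (φ : (𝓑.bc j).obj X ⟶ (𝓑.bc j).obj X)
    (ψ : (𝓑.bc j').obj X ⟶ (𝓑.bc j').obj X) : bcEnd X j h j' e φ = ψ ↔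
      (𝓑.bc h).map φ = (𝓑.bcComp j h j' e).inv.app X ≫ ψ ≫ (𝓑.bcComp j h j' e).hom.app X := by
  have key {C : Type w} [Category.{v} C] {X Y : C} (i : X ≅ Y) (f : Y ⟶ Y) (g : X ⟶ X) :
      i.hom ≫ f ≫ i.inv = g ↔ f = i.inv ≫ g ≫ i.hom := by
    constructor <;> rintro rfl <;> simp
  exact key ((𝓑.bcComp j h j' e).app X) _ _

end

theorem bcComp_conj {B₁ B₂ B₃ : ArtAlg Λ} (j₁ : A ⟶ B₁) (f : B₁ ⟶ B₂) (g : B₂ ⟶ B₃)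
    (h : B₁ ⟶ B₃) (j₂ : A ⟶ B₂) (j₃ : A ⟶ B₃) (e₁ : j₁ ≫ f = j₂) (e₂ : j₂ ≫ g = j₃)
    (eh : f ≫ g = h) (e₃ : j₁ ≫ h = j₃)
    (φ : (𝓑.bc f).obj ((𝓑.bc j₁).obj X) ⟶ (𝓑.bc f).obj ((𝓑.bc j₁).obj X)) :
    (𝓑.bcComp j₁ h j₃ e₃).hom.app X ≫ ((𝓑.bcComp f g h eh).hom.app ((𝓑.bc j₁).obj X) ≫
        (𝓑.bc g).map φ ≫ (𝓑.bcComp f g h eh).inv.app ((𝓑.bc j₁).obj X)) ≫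
          (𝓑.bcComp j₁ h j₃ e₃).inv.app X =
      (𝓑.bcComp j₂ g j₃ e₂).hom.app X ≫ (𝓑.bc g).map ((𝓑.bcComp j₁ f j₂ e₁).hom.app X ≫ φ ≫
        (𝓑.bcComp j₁ f j₂ e₁).inv.app X) ≫ (𝓑.bcComp j₂ g j₃ e₂).inv.app X := by
  have e : (𝓑.bcComp j₁ h j₃ e₃).app X ≪≫ (𝓑.bcComp f g h eh).app ((𝓑.bc j₁).obj X) =
      (𝓑.bcComp j₂ g j₃ e₂).app X ≪≫ (𝓑.bc g).mapIso ((𝓑.bcComp j₁ f j₂ e₁).app X) :=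
    Iso.ext (𝓑.bcComp_assoc j₁ f g j₂ h j₃ e₁ eh e₃ e₂ X)
  have key {C : Type w} [Category.{v} C] {X Y Z : C} (i : X ≅ Y) (j : Y ≅ Z) (m : Z ⟶ Z) :
      i.hom ≫ (j.hom ≫ m ≫ j.inv) ≫ i.inv = (i ≪≫ j).hom ≫ m ≫ (i ≪≫ j).inv := by simp
  refine (key ((𝓑.bcComp j₁ h j₃ e₃).app X) ((𝓑.bcComp f g h eh).app ((𝓑.bc j₁).obj X)) _).trans ?_
  rw [e]
  simp

theorem bcEnd_bcEnd {B₁ B₂ B₃ : ArtAlg Λ} (j₁ : A ⟶ B₁) (f : B₁ ⟶ B₂) (g : B₂ ⟶ B₃) (h : B₁ ⟶ B₃)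
    (j₂ : A ⟶ B₂) (j₃ : A ⟶ B₃) (e₁ : j₁ ≫ f = j₂) (e₂ : j₂ ≫ g = j₃) (eh : f ≫ g = h)
    (e₃ : j₁ ≫ h = j₃) (φ : (𝓑.bc j₁).obj X ⟶ (𝓑.bc j₁).obj X) :
    bcEnd X j₂ g j₃ e₂ (bcEnd X j₁ f j₂ e₁ φ) = bcEnd X j₁ h j₃ e₃ φ := by
  have h2 := (𝓑.bcComp f g h eh).hom.naturality φ
  rw [bcEnd, bcEnd, ← bcComp_conj X j₁ f g h j₂ j₃ e₁ e₂ eh e₃]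
  dsimp at h2
  rw [← reassoc_of% h2, Iso.hom_inv_id_app]
  exact congrArg (fun m => _ ≫ m ≫ _) (Category.comp_id _)

theorem bcEnd_eq_self {B : ArtAlg Λ} (j : A ⟶ B) (h : B ⟶ B) (hh : h = 𝟙 B) (e : j ≫ h = j)
    (φ : (𝓑.bc j).obj X ⟶ (𝓑.bc j).obj X) : bcEnd X j h j e φ = φ := by
  subst hh
  have h1 := (𝓑.bcId B).inv.naturality φ
  rw [bcEnd_eq_iff, ← cancel_epi ((𝓑.bcComp j (𝟙 B) j e).hom.app X), Iso.hom_inv_id_app_assoc,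
    𝓑.bcComp_id_right]
  exact h1.symm

/-- The homogeneity of morphisms, for the endomorphisms of the base changes of an object `X` over
`A`. -/
theorem UniformlyTrivial.existsUnique_bcEnd (h𝓑 : UniformlyTrivial 𝓑) {P B C A' : ArtAlg Λ}
    {p : P ⟶ B} {q : P ⟶ C} {f : B ⟶ A'} {g : C ⟶ A'} (h : IsFibreProduct p q f g) (hf : Surj f)
    (j : A ⟶ P) (jB : A ⟶ B) (jC : A ⟶ C) (jA' : A ⟶ A') (eB : j ≫ p = jB) (eC : j ≫ q = jC)
    (eB' : jB ≫ f = jA') (eC' : jC ≫ g = jA')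
    (s : (𝓑.bc jB).obj X ⟶ (𝓑.bc jB).obj X) (t : (𝓑.bc jC).obj X ⟶ (𝓑.bc jC).obj X)
    (hst : bcEnd X jB f jA' eB' s = bcEnd X jC g jA' eC' t) :
    ∃! r, bcEnd X j p jB eB r = s ∧ bcEnd X j q jC eC r = t := by
  simp only [bcEnd_eq_iff]
  refine h𝓑.homogeneous p q f g h hf _ _ _ _ ?_
  have e : j ≫ p ≫ f = jA' := by rw [← eB', ← eB, Category.assoc]
  have h1 := bcComp_conj X j p f (p ≫ f) jB jA' eB eB' rfl e
    ((𝓑.bcComp j p jB eB).inv.app X ≫ s ≫ (𝓑.bcComp j p jB eB).hom.app X)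
  have h2 := bcComp_conj X j q g (p ≫ f) jC jA' eC eC' h.w.symm e
    ((𝓑.bcComp j q jC eC).inv.app X ≫ t ≫ (𝓑.bcComp j q jC eC).hom.app X)
  rw [← cancel_mono ((𝓑.bcComp j (p ≫ f) jA' e).inv.app X),
    ← cancel_epi ((𝓑.bcComp j (p ≫ f) jA' e).hom.app X)]
  refine h1.trans (Eq.trans ?_ h2.symm)
  simpa [bcEnd] using hst

/-- An endomorphism that becomes the identity over the quotient by an ideal of square zero is
invertible: `(1, g, 1)` is an endomorphism over `A ×_{A'} A ×_{A'} A`, and its image under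
`(a, b, c) ↦ a - b + c` is the inverse of `g`. -/
theorem UniformlyTrivial.isIso_of_bcEnd_eq_id (h𝓑 : UniformlyTrivial 𝓑) {A' : ArtAlg Λ}
    (f : A ⟶ A') (hf : Surj f) (hf' : ∀ x y, f.hom x = 0 → f.hom y = 0 → x * y = 0)
    (g : (𝓑.bc (𝟙 A)).obj X ⟶ (𝓑.bc (𝟙 A)).obj X)
    (hg : bcEnd X (𝟙 A) f f (Category.id_comp f) g = 𝟙 _) : IsIso g := by
  obtain ⟨P, p₁, p₂, hP, hp₁, hp₂⟩ := exists_isFibreProduct f f hf hf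
  obtain ⟨Q, q₁, q₂, hQ, hq₁, hq₂⟩ := exists_isFibreProduct p₂ p₁ hp₂ hp₁
  obtain ⟨ι, hι₁, hι₂⟩ := hP.exists_lift (𝟙 A) (𝟙 A) rfl
  obtain ⟨a, ha₁, ha₂⟩ := hQ.exists_lift (𝟙 P) (p₂ ≫ ι) (by simp [hι₁])
  obtain ⟨b, hb₁, hb₂⟩ := hQ.exists_lift (p₁ ≫ ι) (𝟙 P) (by simp [hι₂])
  obtain ⟨r, hr⟩ := exists_heap_hom f hf' (q₁ ≫ p₁) (q₁ ≫ p₂) (q₂ ≫ p₂)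
    (by rw [Category.assoc, hP.w, Category.assoc])
    (by rw [hQ.w, Category.assoc, hP.w, Category.assoc])
  have har : a ≫ r = p₁ := by
    refine hom_ext (AlgHom.ext fun x => ?_)
    have h1 : (a ≫ q₁ ≫ p₁).hom x = p₁.hom x := by rw [← Category.assoc, ha₁, Category.id_comp]
    have h2 : (a ≫ q₁ ≫ p₂).hom x = p₂.hom x := by rw [← Category.assoc, ha₁, Category.id_comp]
    have h3 : (a ≫ q₂ ≫ p₂).hom x = p₂.hom x := by
      rw [← Category.assoc, ha₂, Category.assoc, hι₂, Category.comp_id]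
    refine (hr (a.hom x)).trans ?_
    change (a ≫ q₁ ≫ p₁).hom x - (a ≫ q₁ ≫ p₂).hom x + (a ≫ q₂ ≫ p₂).hom x = _
    rw [h1, h2, h3, sub_add_cancel]
  have hbr : b ≫ r = p₂ := by
    refine hom_ext (AlgHom.ext fun x => ?_)
    have h1 : (b ≫ q₁ ≫ p₁).hom x = p₁.hom x := by
      rw [← Category.assoc, hb₁, Category.assoc, hι₁, Category.comp_id]
    have h2 : (b ≫ q₁ ≫ p₂).hom x = p₁.hom x := by
      rw [← Category.assoc, hb₁, Category.assoc, hι₂, Category.comp_id]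
    have h3 : (b ≫ q₂ ≫ p₂).hom x = p₂.hom x := by rw [← Category.assoc, hb₂, Category.id_comp]
    refine (hr (b.hom x)).trans ?_
    change (b ≫ q₁ ≫ p₁).hom x - (b ≫ q₁ ≫ p₂).hom x + (b ≫ q₂ ≫ p₂).hom x = _
    rw [h1, h2, h3, sub_self, zero_add]
  have hι : ι ≫ a = ι ≫ b := by
    have e (z : A ⟶ Q) (h₁ : z ≫ q₁ = ι) (h₂ : z ≫ q₂ = ι) (x : A.carrier) :
        q₁.hom (z.hom x) = ι.hom x ∧ q₂.hom (z.hom x) = ι.hom x :=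
      ⟨congr($(h₁).hom x), congr($(h₂).hom x)⟩
    have e₁ := e (ι ≫ a) (by rw [Category.assoc, ha₁, Category.comp_id])
      (by rw [Category.assoc, ha₂, reassoc_of% hι₂])
    have e₂ := e (ι ≫ b) (by rw [Category.assoc, hb₁, reassoc_of% hι₁])
      (by rw [Category.assoc, hb₂, Category.comp_id])
    exact hom_ext (AlgHom.ext fun x =>
      hQ.ext ((e₁ x).1.trans (e₂ x).1.symm) ((e₁ x).2.trans (e₂ x).2.symm))
  have e₁ : (ι ≫ a) ≫ q₁ = ι := by rw [Category.assoc, ha₁, Category.comp_id]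
  have e₂ : (ι ≫ a) ≫ q₂ = ι := by rw [hι, Category.assoc, hb₂, Category.comp_id]
  have er : (ι ≫ a) ≫ r = 𝟙 A := by rw [Category.assoc, har, hι₁]
  -- the endomorphisms `(1, g)` and `(g, 1)` over `A ×_{A'} A`
  obtain ⟨W, ⟨hW₁, hW₂⟩, -⟩ := h𝓑.existsUnique_bcEnd X hP hf ι _ _ f hι₁ hι₂ (Category.id_comp f)
    (Category.id_comp f) (𝟙 _) g (by rw [bcEnd_id, hg])
  obtain ⟨W', ⟨hW'₁, hW'₂⟩, -⟩ := h𝓑.existsUnique_bcEnd X hP hf ι _ _ f hι₁ hι₂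
    (Category.id_comp f) (Category.id_comp f) g (𝟙 _) (by rw [bcEnd_id, hg])
  -- the endomorphism `(1, g, 1)`
  obtain ⟨V, ⟨hV₁, hV₂⟩, -⟩ := h𝓑.existsUnique_bcEnd X hQ hp₂ (ι ≫ a) _ _ (𝟙 A) e₁ e₂ hι₂ hι₁ W W'
    (by rw [hW₂, hW'₁])
  have uniqP (s t : (𝓑.bc ι).obj X ⟶ (𝓑.bc ι).obj X)
      (h₁ : bcEnd X ι p₁ _ hι₁ s = bcEnd X ι p₁ _ hι₁ t)
      (h₂ : bcEnd X ι p₂ _ hι₂ s = bcEnd X ι p₂ _ hι₂ t) : s = t :=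
    (h𝓑.existsUnique_bcEnd X hP hf ι _ _ f hι₁ hι₂ (Category.id_comp f) (Category.id_comp f) _ _ (by
      rw [bcEnd_bcEnd X _ _ _ _ _ _ hι₁ (Category.id_comp f) rfl (by rw [reassoc_of% hι₁]),
        bcEnd_bcEnd X _ _ _ _ _ _ hι₂ (Category.id_comp f) hP.w.symm (by rw [reassoc_of% hι₁])]
      )).unique ⟨h₁, h₂⟩ ⟨rfl, rfl⟩
  have uniqQ (s t : (𝓑.bc (ι ≫ a)).obj X ⟶ (𝓑.bc (ι ≫ a)).obj X)
      (h₁ : bcEnd X (ι ≫ a) q₁ _ e₁ s = bcEnd X (ι ≫ a) q₁ _ e₁ t)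
      (h₂ : bcEnd X (ι ≫ a) q₂ _ e₂ s = bcEnd X (ι ≫ a) q₂ _ e₂ t) : s = t :=
    (h𝓑.existsUnique_bcEnd X hQ hp₂ (ι ≫ a) _ _ (𝟙 A) e₁ e₂ hι₂ hι₁ _ _ (by
      rw [bcEnd_bcEnd X _ _ _ _ _ _ e₁ hι₂ rfl (by rw [← Category.assoc, e₁, hι₂]),
        bcEnd_bcEnd X _ _ _ _ _ _ e₂ hι₁ hQ.w.symm (by rw [← Category.assoc, e₁, hι₂])]
      )).unique ⟨h₁, h₂⟩ ⟨rfl, rfl⟩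
  have eG₁ : bcEnd X ι p₁ _ hι₁ (bcEnd X (𝟙 A) ι ι (Category.id_comp ι) g) = g := by
    rw [bcEnd_bcEnd X _ _ _ (𝟙 A) _ _ _ _ hι₁ (Category.id_comp _), bcEnd_eq_self X _ _ rfl]
  have eG₂ : bcEnd X ι p₂ _ hι₂ (bcEnd X (𝟙 A) ι ι (Category.id_comp ι) g) = g := by
    rw [bcEnd_bcEnd X _ _ _ (𝟙 A) _ _ _ _ hι₂ (Category.id_comp _), bcEnd_eq_self X _ _ rfl]
  have c₁ : W ≫ W' = bcEnd X (𝟙 A) ι ι (Category.id_comp ι) g :=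
    uniqP _ _ (by rw [bcEnd_comp, hW₁, hW'₁, eG₁, Category.id_comp])
      (by rw [bcEnd_comp, hW₂, hW'₂, eG₂, Category.comp_id])
  have c₂ : W' ≫ W = bcEnd X (𝟙 A) ι ι (Category.id_comp ι) g :=
    uniqP _ _ (by rw [bcEnd_comp, hW₁, hW'₁, eG₁, Category.comp_id])
      (by rw [bcEnd_comp, hW₂, hW'₂, eG₂, Category.id_comp])
  -- the endomorphisms `(1, g, g)` and `(1, 1, g)`
  have ha₁' : bcEnd X (ι ≫ a) q₁ _ e₁ (bcEnd X ι a _ rfl W) = W := by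
    rw [bcEnd_bcEnd X _ _ _ (𝟙 P) _ _ _ _ ha₁ (Category.comp_id _), bcEnd_eq_self X _ _ rfl]
  have ha₂' : bcEnd X (ι ≫ a) q₂ _ e₂ (bcEnd X ι a _ rfl W) =
      bcEnd X (𝟙 A) ι ι (Category.id_comp ι) g := by
    rw [bcEnd_bcEnd X _ _ _ (p₂ ≫ ι) _ _ _ _ ha₂ (by rw [reassoc_of% hι₂]), ← hW₂,
      bcEnd_bcEnd X _ _ _ (p₂ ≫ ι) _ _ _ _ rfl]
  have hb₁' : bcEnd X (ι ≫ a) q₁ _ e₁ (bcEnd X ι b _ hι.symm W) = 𝟙 _ := by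
    rw [bcEnd_bcEnd X _ _ _ (p₁ ≫ ι) _ _ _ _ hb₁ (by rw [reassoc_of% hι₁]),
      ← bcEnd_bcEnd X _ _ _ (p₁ ≫ ι) _ _ hι₁ (Category.id_comp ι) rfl, hW₁, bcEnd_id]
  have hb₂' : bcEnd X (ι ≫ a) q₂ _ e₂ (bcEnd X ι b _ hι.symm W) = W := by
    rw [bcEnd_bcEnd X _ _ _ (𝟙 P) _ _ _ _ hb₂ (Category.comp_id _), bcEnd_eq_self X _ _ rfl]
  have d₁ : V ≫ bcEnd X ι b _ hι.symm W = bcEnd X ι a _ rfl W :=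
    uniqQ _ _ (by rw [bcEnd_comp, hV₁, hb₁', ha₁', Category.comp_id])
      (by rw [bcEnd_comp, hV₂, hb₂', ha₂', c₂])
  have d₂ : bcEnd X ι b _ hι.symm W ≫ V = bcEnd X ι a _ rfl W :=
    uniqQ _ _ (by rw [bcEnd_comp, hV₁, hb₁', ha₁', Category.id_comp])
      (by rw [bcEnd_comp, hV₂, hb₂', ha₂', c₁])
  have ea : bcEnd X (ι ≫ a) r _ er (bcEnd X ι a _ rfl W) = 𝟙 _ := by
    rw [bcEnd_bcEnd X _ _ _ p₁ _ _ _ _ har hι₁, hW₁]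
  have eb : bcEnd X (ι ≫ a) r _ er (bcEnd X ι b _ hι.symm W) = g := by
    rw [bcEnd_bcEnd X _ _ _ p₂ _ _ _ _ hbr hι₂, hW₂]
  refine ⟨bcEnd X (ι ≫ a) r _ er V, ?_, ?_⟩
  · rw [← eb, ← bcEnd_comp, d₂, ea]
  · rw [← ea, ← d₁, bcEnd_comp, eb]

end Transfer

end

end

end SimplicialDeformation

namespace SimplicialDeformation

set_option linter.unusedSectionVars false

noncomputable section

section

variable {Λ : Type u} [CommRing Λ] [IsLocalRing Λ]

open ArtAlg

variable {𝓑 : CatFunctor.{u, v, w} Λ}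

theorem isIso_bc_comp_iff {A A' A'' : ArtAlg Λ} (f : A ⟶ A') (g : A' ⟶ A'') (h : A ⟶ A'')
    (e : f ≫ g = h) {X Y : 𝓑.at A} (φ : X ⟶ Y) :
    IsIso ((𝓑.bc h).map φ) ↔ IsIso ((𝓑.bc g).map ((𝓑.bc f).map φ)) :=
  NatIso.isIso_map_iff (𝓑.bcComp f g h e) φ

theorem isIso_bc_id_iff {A : ArtAlg Λ} {X Y : 𝓑.at A} (φ : X ⟶ Y) :
    IsIso ((𝓑.bc (𝟙 A)).map φ) ↔ IsIso φ :=
  NatIso.isIso_map_iff (𝓑.bcId A) φ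

/-- A full functor reflects isomorphisms if every endomorphism that it sends to the identity is
invertible. -/
theorem isIso_of_full {C C' : Type w} [Category.{v} C] [Category.{v} C'] (F : C ⥤ C') [F.Full]
    (h : ∀ (X : C) (g : X ⟶ X), F.map g = 𝟙 _ → IsIso g) {X Y : C} (φ : X ⟶ Y)
    (hφ : IsIso (F.map φ)) : IsIso φ := by
  obtain ⟨ψ, hψ⟩ := F.map_surjective (inv (F.map φ))
  have h1 : IsIso (φ ≫ ψ) := h _ _ (by rw [F.map_comp, hψ, IsIso.hom_inv_id])
  have h2 : IsIso (ψ ≫ φ) := h _ _ (by rw [F.map_comp, hψ, IsIso.inv_hom_id])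
  have : IsSplitMono φ := ⟨⟨⟨ψ ≫ inv (φ ≫ ψ), by rw [← Category.assoc, IsIso.hom_inv_id]⟩⟩⟩
  have : Epi φ := epi_of_epi ψ φ
  exact isIso_of_epi_of_isSplitMono φ

variable (h𝓑 : UniformlyTrivial 𝓑)
include h𝓑

/-- Base change along a surjection whose kernel has square zero reflects isomorphisms. -/
theorem UniformlyTrivial.isIso_of_sq_zero {A A' : ArtAlg Λ}
    (f : A ⟶ A') (hf : Surj f) (hf' : ∀ x y, f.hom x = 0 → f.hom y = 0 → x * y = 0)
    {X Y : 𝓑.at A} (φ : X ⟶ Y) (hφ : IsIso ((𝓑.bc f).map φ)) : IsIso φ := by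
  have := h𝓑.full f hf
  refine isIso_of_full (𝓑.bc f) (fun X g hg => ?_) φ hφ
  have h := h𝓑.isIso_of_bcEnd_eq_id X f hf hf' ((𝓑.bc (𝟙 A)).map g) ?_
  · exact (isIso_bc_id_iff g).1 h
  · have e := (𝓑.bcComp (𝟙 A) f f (Category.id_comp f)).hom.naturality g
    rw [bcEnd]
    dsimp at e
    rw [← reassoc_of% e, hg, Iso.hom_inv_id_app]
    exact Category.comp_id _

/-- In a uniformly trivial deformation theory a map is invertible if it is invertible over the
residue field. -/
theorem UniformlyTrivial.isIso_of_toK {A : ArtAlg Λ} {X Y : 𝓑.at A} (φ : X ⟶ Y)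
    (hφ : IsIso ((𝓑.bc A.toK).map φ)) : IsIso φ := by
  have key (n : ℕ) : ∀ (A : ArtAlg Λ), IsLocalRing.maximalIdeal A.carrier ^ (n + 1) = ⊥ →
      ∀ {X Y : 𝓑.at A} (φ : X ⟶ Y), IsIso ((𝓑.bc A.toK).map φ) → IsIso φ := by
    induction n with
    | zero =>
      intro A hA X Y φ hφ
      rw [zero_add, pow_one] at hA
      refine h𝓑.isIso_of_sq_zero A.toK A.surj_toK (fun x y hx _ => ?_) φ hφ
      have hx' : x ∈ IsLocalRing.maximalIdeal A.carrier := fun h => by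
        have := (isUnit_hom_iff A.toK x).2 h
        rw [hx] at this
        exact not_isUnit_zero this
      rw [hA, Ideal.mem_bot] at hx'
      rw [hx', zero_mul]
    | succ n ih =>
      intro A hA X Y φ hφ
      have hI : IsLocalRing.maximalIdeal A.carrier ^ (n + 1) ≠ ⊤ := fun h =>
        Ideal.IsPrime.ne_top' (top_le_iff.1 (h ▸ Ideal.pow_le_self n.succ_ne_zero))
      have hz := A.toQuot_eq_zero_iff _ hI
      refine h𝓑.isIso_of_sq_zero (A.toQuot _ hI) (A.surj_toQuot _ hI) (fun x y hx hy => ?_) φ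
        (ih _ ?_ _ ?_)
      · have := Ideal.mul_mem_mul ((hz x).1 hx) ((hz y).1 hy)
        rw [← pow_add] at this
        have := Ideal.pow_le_pow_right (show n + 1 + 1 ≤ n + 1 + (n + 1) by omega) this
        rwa [hA] at this
      · have hm : IsLocalRing.maximalIdeal (A.quot _ hI).carrier ≤
            (IsLocalRing.maximalIdeal A.carrier).map (A.toQuot _ hI).hom := fun x hx => by
          obtain ⟨a, rfl⟩ := A.surj_toQuot _ hI x
          exact Ideal.mem_map_of_mem _ (fun h => hx ((isUnit_hom_iff _ a).2 h))
        rw [eq_bot_iff]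
        refine (Ideal.pow_right_mono hm _).trans ?_
        rw [← Ideal.map_pow, Ideal.map_le_iff_le_comap]
        exact fun x hx => (hz x).2 hx
      · exact (isIso_bc_comp_iff _ _ A.toK (Subsingleton.elim _ _) φ).1 hφ
  obtain ⟨n, hn⟩ := IsArtinianRing.isNilpotent_jacobson_bot (R := A.carrier)
  rw [IsLocalRing.jacobson_eq_maximalIdeal _ bot_ne_top] at hn
  refine key n A ?_ φ hφ
  rw [pow_succ, hn]
  exact zero_mul _

omit h𝓑

/-! ### The tower of quotients of `Λ` by powers of its maximal ideal -/

section Tower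

variable [IsNoetherianRing Λ]

variable (Λ) in
/-- The Artinian algebra `Λ / 𝔪ⁿ⁺¹`. -/
def tower (n : ℕ) : ArtAlg Λ :=
  haveI hI : IsLocalRing.maximalIdeal Λ ^ (n + 1) ≠ ⊤ := fun h =>
    Ideal.IsPrime.ne_top' (top_le_iff.1 (h ▸ Ideal.pow_le_self n.succ_ne_zero))
  haveI : Nontrivial (Λ ⧸ IsLocalRing.maximalIdeal Λ ^ (n + 1)) :=
    Ideal.Quotient.nontrivial_iff.2 hI
  haveI : IsLocalRing (Λ ⧸ IsLocalRing.maximalIdeal Λ ^ (n + 1)) :=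
    IsLocalRing.of_surjective' (Ideal.Quotient.mk _) Ideal.Quotient.mk_surjective
  haveI : IsArtinianRing (Λ ⧸ IsLocalRing.maximalIdeal Λ ^ (n + 1)) := by
    rw [isArtinianRing_iff_isNilpotent_maximalIdeal]
    refine ⟨n + 1, ?_⟩
    have hm : IsLocalRing.maximalIdeal (Λ ⧸ IsLocalRing.maximalIdeal Λ ^ (n + 1)) ≤
        (IsLocalRing.maximalIdeal Λ).map (Ideal.Quotient.mk _) := fun x hx => by
      obtain ⟨a, rfl⟩ := Ideal.Quotient.mk_surjective x
      exact Ideal.mem_map_of_mem _ (fun h => hx (h.map _))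
    rw [Ideal.zero_eq_bot, eq_bot_iff]
    refine (Ideal.pow_right_mono hm _).trans ?_
    rw [← Ideal.map_pow, Ideal.map_quotient_self]
  of (Λ ⧸ IsLocalRing.maximalIdeal Λ ^ (n + 1)) fun a => by
    obtain ⟨l, rfl⟩ := Ideal.Quotient.mk_surjective a
    refine ⟨l, ?_⟩
    change ¬ IsUnit (Ideal.Quotient.mk _ l - Ideal.Quotient.mk _ l)
    rw [sub_self]
    exact not_isUnit_zero

instance (n : ℕ) (A : ArtAlg Λ) : Subsingleton (tower Λ n ⟶ A) where
  allEq _ _ := hom_ext (Ideal.Quotient.algHom_ext _ (Subsingleton.elim _ _))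

theorem surj_of_tower {n : ℕ} {A : ArtAlg Λ} (f : A ⟶ tower Λ n) : Surj f := fun x => by
  obtain ⟨l, rfl⟩ := Ideal.Quotient.mk_surjective x
  exact ⟨algebraMap Λ A.carrier l, f.hom.commutes l⟩

/-- The transition maps of the tower. -/
def towerMap {m n : ℕ} (h : n ≤ m) : tower Λ m ⟶ tower Λ n :=
  ⟨Ideal.Quotient.factorₐ Λ (Ideal.pow_le_pow_right (Nat.succ_le_succ h))⟩

/-- An algebra receives a map from `Λ / 𝔪ⁿ⁺¹` exactly if `𝔪ⁿ⁺¹` acts on it by zero. -/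
theorem nonempty_tower_hom_iff (n : ℕ) (A : ArtAlg Λ) : Nonempty (tower Λ n ⟶ A) ↔
    IsLocalRing.maximalIdeal Λ ^ (n + 1) ≤ RingHom.ker (algebraMap Λ A.carrier) := by
  constructor
  · rintro ⟨f⟩ x hx
    have h := f.hom.commutes x
    have h0 : algebraMap Λ (tower Λ n).carrier x = 0 := Ideal.Quotient.eq_zero_iff_mem.2 hx
    rw [RingHom.mem_ker, ← h, h0, map_zero]
  · intro h
    exact ⟨⟨Ideal.Quotient.liftₐ _ (Algebra.ofId Λ A.carrier) h⟩⟩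

theorem exists_tower_hom (A : ArtAlg Λ) : ∃ n, Nonempty (tower Λ n ⟶ A) := by
  obtain ⟨n, hn⟩ := IsArtinianRing.isNilpotent_jacobson_bot (R := A.carrier)
  rw [IsLocalRing.jacobson_eq_maximalIdeal _ bot_ne_top] at hn
  refine ⟨n, (nonempty_tower_hom_iff n A).2 ?_⟩
  have h : (IsLocalRing.maximalIdeal Λ).map (algebraMap Λ A.carrier) ≤
      IsLocalRing.maximalIdeal A.carrier := by
    rw [Ideal.map_le_iff_le_comap, ← A.ker_eq]
    exact fun x hx => (IsLocalRing.residue_eq_zero_iff _).1 hx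
  refine (Ideal.pow_le_pow_right n.le_succ).trans ?_
  rw [RingHom.ker_eq_comap_bot, ← Ideal.map_le_iff_le_comap, Ideal.map_pow]
  exact (Ideal.pow_right_mono h n).trans hn.le

open Classical in
/-- The first level of the tower that maps to `A`. -/
def level (A : ArtAlg Λ) : ℕ := Nat.find (exists_tower_hom A)

open Classical in
/-- The map to `A` from the first possible level of the tower. -/
def ofTower (A : ArtAlg Λ) : tower Λ (level A) ⟶ A := (Nat.find_spec (exists_tower_hom A)).some

open Classical in
theorem level_le {A A' : ArtAlg Λ} (f : A ⟶ A') : level A' ≤ level A :=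
  Nat.find_min' (exists_tower_hom A') ⟨ofTower A ≫ f⟩

end Tower

end

end

end SimplicialDeformation

namespace SimplicialDeformation

set_option linter.unusedSectionVars false

noncomputable section

section

variable {Λ : Type u} [CommRing Λ] [IsLocalRing Λ] [IsNoetherianRing Λ]

open ArtAlg

/-! ### Existence and uniqueness of lifts -/

/-- An element of `F(k)`, for a smooth functor `F`, lifts to a compatible family of elements. -/
theorem IsSmooth.exists_section {F : ArtAlg Λ ⥤ Type v} (hF : IsSmooth F) (x : F.obj (k Λ)) :
    ∃ s : ∀ A, F.obj A, s (k Λ) = x ∧ ∀ {A A' : ArtAlg Λ} (f : A ⟶ A'), F.map f (s A) = s A' := by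
  obtain ⟨t₀, ht₀⟩ := hF (tower Λ 0).toK (surj_toK _) x
  choose L hL using fun n (y : F.obj (tower Λ n)) =>
    hF (towerMap (Λ := Λ) n.le_succ) (surj_of_tower _) y
  let t (n : ℕ) : F.obj (tower Λ n) := Nat.rec t₀ L n
  have ht {m n : ℕ} (h : n ≤ m) : F.map (towerMap h) (t m) = t n := by
    induction m, h using Nat.le_induction with
    | base =>
      rw [Subsingleton.elim (towerMap (Λ := Λ) (le_refl n)) (𝟙 _)]
      simp
    | succ m h ih =>
      have e : towerMap (Λ := Λ) (Nat.le_succ_of_le h) = towerMap m.le_succ ≫ towerMap h :=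
        Subsingleton.elim _ _
      have e' := congr(F.map $e (t (m + 1)))
      rw [← ih, e', F.map_comp]
      exact congrArg _ (hL m (t m))
  have hs {A A' : ArtAlg Λ} (f : A ⟶ A') :
      F.map f (F.map (ofTower A) (t (level A))) = F.map (ofTower A') (t (level A')) := by
    rw [← ht (level_le f)]
    have e : ofTower A ≫ f = towerMap (level_le f) ≫ ofTower A' := Subsingleton.elim _ _
    have := congr(F.map $e (t (level A)))
    simpa using this
  refine ⟨fun A => F.map (ofTower A) (t (level A)), ?_, hs⟩
  rw [← ht₀]
  change _ = F.map (tower Λ 0).toK (t 0)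
  rw [← ht (Nat.zero_le (level (k Λ)))]
  have e : ofTower (k Λ) = towerMap (Nat.zero_le _) ≫ (tower Λ 0).toK := Subsingleton.elim _ _
  have := congr(F.map $e (t (level (k Λ))))
  simpa using this

/-- Smoothness of maps is the fullness of base change along surjections. -/
theorem UniformlyTrivial.isSmooth_homFunctor {𝓑 : CatFunctor.{u, v, w} Λ}
    (h𝓑 : UniformlyTrivial 𝓑) (X Y : FormalObject 𝓑) : IsSmooth (X.homFunctor Y) := by
  intro A A' f hf y
  have := h𝓑.full f hf
  have key (y : X.obj A' ⟶ Y.obj A') :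
      ∃ x, (X.iso f).inv ≫ (𝓑.bc f).map x ≫ (Y.iso f).hom = y := by
    obtain ⟨x, hx⟩ := (𝓑.bc f).map_surjective ((X.iso f).hom ≫ y ≫ (Y.iso f).inv)
    exact ⟨x, by rw [hx]; simp⟩
  exact key y

/-- A map of formal objects is invertible if it is invertible over the residue field. -/
theorem UniformlyTrivial.isIso_of_base {𝓑 : CatFunctor.{u, v, w} Λ} (h𝓑 : UniformlyTrivial 𝓑)
    (X Y : FormalObject 𝓑) {A : ArtAlg Λ} (φ : X.obj A ⟶ Y.obj A)
    (h : IsIso ((X.iso A.toK).inv ≫ (𝓑.bc A.toK).map φ ≫ (Y.iso A.toK).hom)) : IsIso φ := by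
  apply h𝓑.isIso_of_toK
  have e : (𝓑.bc A.toK).map φ = (X.iso A.toK).hom ≫ ((X.iso A.toK).inv ≫ (𝓑.bc A.toK).map φ ≫
      (Y.iso A.toK).hom) ≫ (Y.iso A.toK).inv := by simp
  rw [e]
  infer_instance

namespace SquareDiagram

variable {𝓓 𝓔 𝓐 𝓑 : CatFunctor.{u, v, w} Λ} {S : SquareDiagram 𝓓 𝓔 𝓐 𝓑} {D : 𝓓.at (k Λ)}

/-- The identification over `k` lifts to a compatible family of maps, since maps between the two
lifts form a smooth functor. These maps are invertible, because they are so over `k`. -/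
theorem Lift.nonempty_isoTo (h𝓑 : UniformlyTrivial 𝓑) (B B' : S.Lift D) :
    Nonempty (B.IsoTo B') := by
  obtain ⟨s, hs, hs'⟩ : ∃ s : ∀ A, B.toFormal.obj A ⟶ B'.toFormal.obj A,
      s (k Λ) = (B.iso ≪≫ B'.iso.symm).hom ∧ ∀ {A A' : ArtAlg Λ} (f : A ⟶ A'),
        (B.toFormal.iso f).inv ≫ (𝓑.bc f).map (s A) ≫ (B'.toFormal.iso f).hom = s A' :=
    (h𝓑.isSmooth_homFunctor B.toFormal B'.toFormal).exists_section (B.iso ≪≫ B'.iso.symm).hom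
  have hi (A : ArtAlg Λ) : IsIso (s A) :=
    h𝓑.isIso_of_base _ _ _ (by rw [hs' A.toK, hs]; infer_instance)
  refine ⟨⟨fun A => asIso (s A), fun f => ?_, ?_⟩⟩
  · rw [asIso_hom, asIso_hom, ← hs' f, Iso.hom_inv_id_assoc]
  · rw [asIso_hom, hs]
    simp

end SquareDiagram

end

end

end SimplicialDeformation

namespace SimplicialDeformation

set_option linter.unusedSectionVars false

noncomputable section

section

variable {Λ : Type u} [CommRing Λ] [IsLocalRing Λ]

open ArtAlg

namespace CatFunctor

variable (𝓑 : CatFunctor.{u, v, w} Λ)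

/-- Base change along an identity map, where the map is only propositionally the identity. -/
def bcSelf {A : ArtAlg Λ} (f : A ⟶ A) (hf : f = 𝟙 A) (X : 𝓑.at A) : (𝓑.bc f).obj X ≅ X :=
  eqToIso (by rw [hf]) ≪≫ (𝓑.bcId A).app X

theorem bcSelf_id {A : ArtAlg Λ} (X : 𝓑.at A) : 𝓑.bcSelf (𝟙 A) rfl X = (𝓑.bcId A).app X :=
  Iso.ext (Category.id_comp _)

theorem bcComp_self_left {A A' : ArtAlg Λ} (f : A ⟶ A) (hf : f = 𝟙 A) (g : A ⟶ A') (e : f ≫ g = g)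
    (X : 𝓑.at A) : (𝓑.bcComp f g g e).hom.app X ≫ (𝓑.bc g).map (𝓑.bcSelf f hf X).hom = 𝟙 _ := by
  subst hf
  rw [bcSelf_id, bcComp_id_left, ← CategoryTheory.Functor.map_comp, Iso.app_hom,
    Iso.inv_hom_id_app]
  exact (𝓑.bc g).map_id _

end CatFunctor

variable [IsNoetherianRing Λ] {𝓑 : CatFunctor.{u, v, w} Λ}

/-- A compatible system of objects over the algebras `Λ / 𝔪ⁿ⁺¹`. -/
structure TowerObject (𝓑 : CatFunctor.{u, v, w} Λ) where
  obj (n : ℕ) : 𝓑.at (tower Λ n)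
  step (n : ℕ) : (𝓑.bc (towerMap n.le_succ)).obj (obj (n + 1)) ≅ obj n

namespace TowerObject

variable (X : TowerObject 𝓑)

/-- The base change isomorphisms of a compatible system. -/
def trans {n m : ℕ} (h : n ≤ m) : (𝓑.bc (towerMap h)).obj (X.obj m) ≅ X.obj n :=
  Nat.leRec (motive := fun m h => (𝓑.bc (towerMap h)).obj (X.obj m) ≅ X.obj n)
    (𝓑.bcSelf _ (Subsingleton.elim _ _) (X.obj n))
    (fun m h J => (𝓑.bcComp (towerMap m.le_succ) (towerMap h) _ (Subsingleton.elim _ _)).app _ ≪≫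
      (𝓑.bc (towerMap h)).mapIso (X.step m) ≪≫ J) h

theorem trans_self (n : ℕ) :
    X.trans (le_refl n) = 𝓑.bcSelf _ (Subsingleton.elim _ _) (X.obj n) := by
  rw [trans, Nat.leRec_self]

theorem trans_succ {n m : ℕ} (h : n ≤ m) : (X.trans (Nat.le_succ_of_le h)).hom =
    (𝓑.bcComp (towerMap m.le_succ) (towerMap h) _ (Subsingleton.elim _ _)).hom.app _ ≫
      (𝓑.bc (towerMap h)).map (X.step m).hom ≫ (X.trans h).hom := by
  rw [trans, Nat.leRec_succ]
  rfl

theorem trans_trans {n m l : ℕ} (h : n ≤ m) (h' : m ≤ l) : (X.trans (h.trans h')).hom =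
    (𝓑.bcComp (towerMap h') (towerMap h) _ (Subsingleton.elim _ _)).hom.app (X.obj l) ≫
      (𝓑.bc (towerMap h)).map (X.trans h').hom ≫ (X.trans h).hom := by
  induction l, h' using Nat.le_induction with
  | base =>
    rw [trans_self, ← Category.assoc, 𝓑.bcComp_self_left, Category.id_comp]
  | succ l h' ih =>
    have e := 𝓑.bcComp_assoc (towerMap (Λ := Λ) l.le_succ) (towerMap h') (towerMap h)
      (towerMap (Nat.le_succ_of_le h')) (towerMap (h.trans h')) (towerMap (Nat.le_succ_of_le
        (h.trans h'))) (Subsingleton.elim _ _) (Subsingleton.elim _ _) (Subsingleton.elim _ _)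
      (Subsingleton.elim _ _) (X.obj (l + 1))
    have e' := (𝓑.bcComp (towerMap h') (towerMap h) (towerMap (h.trans h'))
      (Subsingleton.elim _ _)).hom.naturality (X.step l).hom
    dsimp at e'
    rw [X.trans_succ (h.trans h'), X.trans_succ h', ih, reassoc_of% e']
    simp only [CategoryTheory.Functor.map_comp, Category.assoc]
    rw [reassoc_of% e]

/-- The base change isomorphisms of the formal object defined by a compatible system. -/
def isoAux {A A' : ArtAlg Λ} (f : A ⟶ A') (c : tower Λ (level A) ⟶ A') (e : ofTower A ≫ f = c)
    (e' : towerMap (level_le f) ≫ ofTower A' = c) :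
    (𝓑.bc f).obj ((𝓑.bc (ofTower A)).obj (X.obj (level A))) ≅
      (𝓑.bc (ofTower A')).obj (X.obj (level A')) :=
  ((𝓑.bcComp (ofTower A) f c e).app _).symm ≪≫
    (𝓑.bcComp (towerMap (level_le f)) (ofTower A') c e').app _ ≪≫
      (𝓑.bc (ofTower A')).mapIso (X.trans (level_le f))

/-- The formal object defined by a compatible system: over `A` it is the base change of the object
over the first algebra of the tower that maps to `A`. -/
def toFormal : FormalObject 𝓑 where
  obj A := (𝓑.bc (ofTower A)).obj (X.obj (level A))
  iso {A A'} f := X.isoAux f _ rfl (Subsingleton.elim _ _)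
  iso_id A := by
    have h : X.isoAux (𝟙 A) _ rfl (Subsingleton.elim _ _) =
        X.isoAux (𝟙 A) (ofTower A) (Category.comp_id _) (Subsingleton.elim _ _) := by
      congr 1
    rw [h]
    dsimp [isoAux]
    rw [trans_self, 𝓑.bcComp_self_left, Category.comp_id,
      ← cancel_epi ((𝓑.bcComp (ofTower A) (𝟙 A) (ofTower A) (Category.comp_id _)).hom.app _),
      Iso.hom_inv_id_app, 𝓑.bcComp_id_right, Iso.inv_hom_id_app]
    rfl
  iso_comp {A A' A''} f g := by
    have e₁ := 𝓑.bcComp_assoc (ofTower A) f g (ofTower A ≫ f) (f ≫ g)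
      (ofTower A ≫ f ≫ g) rfl rfl rfl
      (Category.assoc _ _ _) (X.obj (level A))
    have e₂ := 𝓑.bcComp_assoc (towerMap (level_le f)) (ofTower A') g (ofTower A ≫ f)
      (ofTower A' ≫ g) (ofTower A ≫ f ≫ g) (Subsingleton.elim _ _) rfl (Subsingleton.elim _ _)
      (Category.assoc _ _ _) (X.obj (level A))
    have e₃ := 𝓑.bcComp_assoc (towerMap (level_le f)) (towerMap (level_le g)) (ofTower A'')
      (towerMap (level_le (f ≫ g))) (ofTower A' ≫ g) (ofTower A ≫ f ≫ g) (Subsingleton.elim _ _)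
      (Subsingleton.elim _ _) (Subsingleton.elim _ _) (Subsingleton.elim _ _) (X.obj (level A))
    have n₁ := (𝓑.bcComp (ofTower A') g (ofTower A' ≫ g) rfl).inv.naturality
      (X.trans (level_le f)).hom
    have n₂ := (𝓑.bcComp (towerMap (level_le g)) (ofTower A'') (ofTower A' ≫ g)
      (Subsingleton.elim _ _)).hom.naturality (X.trans (level_le f)).hom
    dsimp [isoAux] at e₁ e₂ e₃ n₁ n₂ ⊢
    rw [X.trans_trans (level_le g) (level_le f), ← cancel_epi ((𝓑.bcComp (ofTower A) (f ≫ g)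
      (ofTower A ≫ f ≫ g) rfl).hom.app _), Iso.hom_inv_id_app_assoc]
    simp only [CategoryTheory.Functor.map_comp, Category.assoc]
    rw [← reassoc_of% e₃, reassoc_of% n₁, reassoc_of% n₂, reassoc_of% e₁,
      ← (𝓑.bc g).map_comp_assoc, Iso.hom_inv_id_app,
      (𝓑.bc g).map_id, Category.id_comp, ← reassoc_of% e₂, Iso.hom_inv_id_app_assoc]

end TowerObject

/-- Essential surjectivity gives a compatible sequence of objects over the algebras `Λ / 𝔪ⁿ⁺¹`, and
base change along `Λ / 𝔪ⁿ⁺¹ → A`, for large `n`, extends it to all Artinian algebras. -/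
theorem UniformlyTrivial.exists_formalObject (h𝓑 : UniformlyTrivial 𝓑) (Y : 𝓑.at (k Λ)) :
    ∃ X : FormalObject 𝓑, Nonempty (X.obj (k Λ) ≅ Y) := by
  have h₀ := h𝓑.essSurj (tower Λ 0).toK (surj_toK _)
  have h (n : ℕ) := h𝓑.essSurj (towerMap (Λ := Λ) n.le_succ) (surj_of_tower _)
  let X : TowerObject 𝓑 :=
    { obj := fun n => Nat.rec ((𝓑.bc (tower Λ 0).toK).objPreimage Y)
        (fun n X => (𝓑.bc (towerMap n.le_succ)).objPreimage X) n
      step := fun n => (𝓑.bc (towerMap n.le_succ)).objObjPreimageIso _ }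
  refine ⟨X.toFormal, ⟨?_⟩⟩
  exact (𝓑.bcComp (towerMap (Nat.zero_le _)) (tower Λ 0).toK _ (Subsingleton.elim _ _)).app _ ≪≫
    (𝓑.bc (tower Λ 0).toK).mapIso (X.trans (Nat.zero_le _)) ≪≫
      (𝓑.bc (tower Λ 0).toK).objObjPreimageIso Y

theorem SquareDiagram.nonempty_lift {𝓓 𝓔 𝓐 𝓑 : CatFunctor.{u, v, w} Λ}
    (S : SquareDiagram 𝓓 𝓔 𝓐 𝓑) (h𝓑 : UniformlyTrivial 𝓑) (D : 𝓓.at (k Λ)) :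
    Nonempty (S.Lift D) := by
  obtain ⟨X, ⟨e⟩⟩ := h𝓑.exists_formalObject ((S.sqAt (k Λ)).UV.obj D)
  exact ⟨⟨X, e⟩⟩

end

end

end SimplicialDeformation

namespace SimplicialDeformation

set_option linter.unusedSectionVars false

noncomputable section

section

variable {Λ : Type u} [CommRing Λ] [IsLocalRing Λ]

open ArtAlg

/-! ### The simplicial deformation complex of a lift -/

theorem toK_k : (k Λ).toK = 𝟙 (k Λ) := Subsingleton.elim _ _

section Fibre

variable {F : ArtAlg Λ ⥤ Type v} (x : F.obj (k Λ))

theorem fibreFunctor_map_toK {A A' : ArtAlg Λ} (f : A ⟶ A') (y : F.obj A) :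
    F.map A'.toK (F.map f y) = F.map A.toK y := by
  have e : f ≫ A'.toK = A.toK := Subsingleton.elim _ _
  have := congr(F.map $e y)
  simpa using this

theorem fibreFunctor_point : ∃! _y : (fibreFunctor F x).obj (k Λ), True := by
  have h (y : F.obj (k Λ)) : F.map (k Λ).toK y = y := by
    rw [toK_k]
    simp
  refine ⟨⟨x, h x⟩, trivial, fun y _ => Subtype.ext ?_⟩
  exact (h y.1).symm.trans y.2

theorem IsSmooth.fibreFunctor (hF : IsSmooth F) : IsSmooth (fibreFunctor F x) := by
  rintro A A' f hf ⟨y, hy⟩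
  obtain ⟨z, rfl⟩ := hF f hf y
  exact ⟨⟨z, by rw [← fibreFunctor_map_toK f z, hy]⟩, rfl⟩

theorem IsHomogeneous.fibreFunctor (hF : IsHomogeneous F) : IsHomogeneous (fibreFunctor F x) := by
  rintro P B C A p q f g h hf ⟨b, hb⟩ ⟨c, hc⟩ e
  obtain ⟨y, ⟨rfl, rfl⟩, hy⟩ := hF p q f g h hf b c (congrArg Subtype.val e)
  refine ⟨⟨y, by rw [← fibreFunctor_map_toK p y, hb]⟩, ⟨rfl, rfl⟩, ?_⟩
  rintro ⟨z, hz⟩ ⟨h₁, h₂⟩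
  exact Subtype.ext (hy z ⟨congrArg Subtype.val h₁, congrArg Subtype.val h₂⟩)

end Fibre

theorem FormalObject.iso_comp' {𝓑 : CatFunctor.{u, v, w} Λ} (X : FormalObject 𝓑)
    {A A' A'' : ArtAlg Λ} (f : A ⟶ A') (g : A' ⟶ A'') (h : A ⟶ A'') (e : f ≫ g = h) :
    (X.iso h).hom =
      (𝓑.bcComp f g h e).hom.app (X.obj A) ≫ (𝓑.bc g).map (X.iso f).hom ≫ (X.iso g).hom := by
  subst e
  exact X.iso_comp f g

/-- The homogeneity of morphisms, transported along the base change isomorphisms of the two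
families. -/
theorem UniformlyTrivial.isHomogeneous_homFunctor {𝓑 : CatFunctor.{u, v, w} Λ}
    (h𝓑 : UniformlyTrivial 𝓑) (X Y : FormalObject 𝓑) : IsHomogeneous (X.homFunctor Y) := by
  intro P B C A p q f g h hf
  have key (b : X.obj B ⟶ Y.obj B) (c : X.obj C ⟶ Y.obj C)
      (e : (X.iso f).inv ≫ (𝓑.bc f).map b ≫ (Y.iso f).hom =
        (X.iso g).inv ≫ (𝓑.bc g).map c ≫ (Y.iso g).hom) :
      ∃! r : X.obj P ⟶ Y.obj P, (X.iso p).inv ≫ (𝓑.bc p).map r ≫ (Y.iso p).hom = b ∧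
        (X.iso q).inv ≫ (𝓑.bc q).map r ≫ (Y.iso q).hom = c := by
    have hiff {C : Type w} [Category.{v} C] {X X' Y Y' : C} (i : X ≅ X') (j : Y ≅ Y') (m : X ⟶ Y)
        (m' : X' ⟶ Y') : i.inv ≫ m ≫ j.hom = m' ↔ m = i.hom ≫ m' ≫ j.inv := by
      rw [Iso.inv_comp_eq, ← Iso.eq_comp_inv, Category.assoc]
    simp only [hiff]
    refine h𝓑.homogeneous p q f g h hf _ _ _ _ ?_
    have conj {P' B' : ArtAlg Λ} (p : P ⟶ B') (f : B' ⟶ P') (c : P ⟶ P') (e : p ≫ f = c)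
        (b : X.obj B' ⟶ Y.obj B') : (𝓑.bcComp p f c e).hom.app (X.obj P) ≫
          (𝓑.bc f).map ((X.iso p).hom ≫ b ≫ (Y.iso p).inv) ≫
            (𝓑.bcComp p f c e).inv.app (Y.obj P) =
          (X.iso c).hom ≫ ((X.iso f).inv ≫ (𝓑.bc f).map b ≫ (Y.iso f).hom) ≫ (Y.iso c).inv := by
      have hX := X.iso_comp' p f c e
      have hY : (Y.iso c).inv = (Y.iso f).inv ≫ (𝓑.bc f).map (Y.iso p).inv ≫
          (𝓑.bcComp p f c e).inv.app (Y.obj P) := by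
        rw [← cancel_epi (Y.iso c).hom, Iso.hom_inv_id, Y.iso_comp' p f c e]
        simp
      rw [hX, hY]
      simp
    rw [conj, conj, e]
  exact key

namespace SquareDiagram

variable {𝓓 𝓔 𝓐 𝓑 : CatFunctor.{u, v, w} Λ} {S : SquareDiagram 𝓓 𝓔 𝓐 𝓑} {D : 𝓓.at (k Λ)}

namespace Lift

variable (B : S.Lift D)

/-- Maps `⊤ₕⁿB → ⊥ᵥⁿB` in `𝓑(A)`. -/
abbrev Mor (n : ℕ) (A : ArtAlg Λ) : Type v :=
  (iter (S.sqAt A).T n).obj (B.toFormal.obj A) ⟶ (iter (S.sqAt A).L n).obj (B.toFormal.obj A)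

/-- Base change of maps `⊤ₕⁿB → ⊥ᵥⁿB`. -/
def bcMor {n : ℕ} {A A' : ArtAlg Λ} (f : A ⟶ A') (x : B.Mor n A) : B.Mor n A' :=
  (B.hom n).map f x

variable {B}

theorem bcMor_eq_iff (hS : S.IsCompatible) {n : ℕ} {A A' : ArtAlg Λ} (f : A ⟶ A') (x : B.Mor n A)
    (y : B.Mor n A') : B.bcMor f x = y ↔
      ((S.bcSq f).lawMap (hS A) (hS A')).IsBaseChange (B.toFormal.iso f).inv n x y :=
  S.hom_map_eq_iff hS B f n x y

section

variable (hS : S.IsCompatible) {A A' : ArtAlg Λ} (f : A ⟶ A')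
include hS

theorem bcMor_prod {m n p : ℕ} (e : m + n = p) (x : B.Mor m A) (y : B.Mor n A) :
    B.bcMor f ((hS A).law.prod e x y) = (hS A').law.prod e (B.bcMor f x) (B.bcMor f y) :=
  (bcMor_eq_iff hS f _ _).2 (((bcMor_eq_iff hS f x _).1 rfl).prod e ((bcMor_eq_iff hS f y _).1 rfl))

theorem bcMor_face {n : ℕ} (i : ℕ) (hi : 1 ≤ i) (hn : i ≤ n) (x : B.Mor n A) :
    B.bcMor f ((hS A).law.face i hi hn x) = (hS A').law.face i hi hn (B.bcMor f x) :=
  (bcMor_eq_iff hS f _ _).2 (((bcMor_eq_iff hS f x _).1 rfl).face i hi hn)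

theorem bcMor_degen {n : ℕ} (i : ℕ) (hn : i ≤ n) (x : B.Mor (n + 1) A) :
    B.bcMor f ((hS A).law.degen i hn x) = (hS A').law.degen i hn (B.bcMor f x) :=
  (bcMor_eq_iff hS f _ _).2 (((bcMor_eq_iff hS f x _).1 rfl).degen i hn)

omit hS

theorem bcMor_id : B.bcMor (n := 0) f (𝟙 (B.toFormal.obj A)) = 𝟙 (B.toFormal.obj A') := by
  change (B.toFormal.iso f).inv ≫ (𝓑.bc f).map (𝟙 _) ≫ (B.toFormal.iso f).hom = _
  simp

end

variable (B)

/-- The action of `⊤ₕ` on `B_k`. -/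
def baseAct : (S.sqAt (k Λ)).T.obj (B.toFormal.obj (k Λ)) ⟶ B.toFormal.obj (k Λ) :=
  (S.sqAt (k Λ)).T.map B.iso.hom ≫ (S.sqAt (k Λ)).act D ≫ B.iso.inv

/-- The coaction of `⊥ᵥ` on `B_k`. -/
def baseCoact : B.toFormal.obj (k Λ) ⟶ (S.sqAt (k Λ)).L.obj (B.toFormal.obj (k Λ)) :=
  B.iso.hom ≫ (S.sqAt (k Λ)).coact D ≫ (S.sqAt (k Λ)).L.map B.iso.inv

variable {B}

theorem isBialgebra_base (hS : S.IsCompatible) :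
    (hS (k Λ)).law.IsBialgebra B.baseAct B.baseCoact :=
  ((hS (k Λ)).isBialgebra D).of_iso B.iso.symm
    (by rw [baseAct, ← Functor.map_comp_assoc]; simp) (by rw [baseCoact]; simp)

/-- The base point `UV(αⁿ ∘ εⁿ)` of `Hom(⊤ₕⁿB_k, ⊥ᵥⁿB_k)` is the iterated action followed by the
iterated coaction of the bialgebra `B_k`. -/
theorem basePoint_eq (hS : S.IsCompatible) (n : ℕ) :
    B.basePoint n = canon B.baseAct B.baseCoact n := by
  have hL : (iter (S.sqAt (k Λ)).L n).map B.iso.hom ≫ (iter (S.sqAt (k Λ)).L n).map B.iso.inv =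
      𝟙 _ := by
      rw [← Functor.map_comp, B.iso.hom_inv_id]
      exact (iter (S.sqAt (k Λ)).L n).map_id _
  have hf : (S.sqAt (k Λ)).T.map B.iso.hom ≫ (S.sqAt (k Λ)).act D = B.baseAct ≫ B.iso.hom := by
    simp [baseAct]
  have hv : B.iso.hom ≫ (S.sqAt (k Λ)).coact D =
      B.baseCoact ≫ (S.sqAt (k Λ)).L.map B.iso.hom := by
    rw [baseCoact, Category.assoc, Category.assoc, ← Functor.map_comp]
    simp
  rw [basePoint, (hS (k Λ)).canonicalMap_eq]
  exact (comp_eq_assoc (canon_naturality hf hv n) _).trans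
    ((Category.assoc _ _ _).trans
      ((congrArg _ hL).trans (Category.comp_id _)))

/-- The elements of `Eⁿ(A)` are the maps `⊤ₕⁿB → ⊥ᵥⁿB` that reduce to the canonical map of the
bialgebra `B_k`. -/
def gradedMk (hS : S.IsCompatible) {n : ℕ} {A : ArtAlg Λ} (x : B.Mor n A)
    (hx : B.bcMor A.toK x = canon B.baseAct B.baseCoact n) : (B.gradedHom n).obj A :=
  ⟨x, hx.trans (basePoint_eq hS n).symm⟩

theorem bcMor_toHom (hS : S.IsCompatible) {n : ℕ} {A : ArtAlg Λ} (x : (B.gradedHom n).obj A) :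
    B.bcMor A.toK (B.toHom x) = canon B.baseAct B.baseCoact n :=
  x.2.trans (basePoint_eq hS n)

theorem toHom_injective {n : ℕ} {A : ArtAlg Λ} {x y : (B.gradedHom n).obj A}
    (h : B.toHom x = B.toHom y) : x = y := Subtype.ext h

variable [IsNoetherianRing Λ]

variable (B) in
/-- The simplicial deformation complex of a lift. -/
def sdc (hS : S.IsCompatible) (h𝓑 : UniformlyTrivial 𝓑) : SDC B.gradedHom where
  point n := fibreFunctor_point _
  smooth n := (h𝓑.isSmooth_homFunctor _ _).fibreFunctor _
  homogeneous n := (h𝓑.isHomogeneous_homFunctor _ _).fibreFunctor _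
  face := fun {n} i hi hn {A} x => gradedMk hS ((hS A).law.face i hi hn (B.toHom x)) (by
    rw [bcMor_face hS, bcMor_toHom hS, (isBialgebra_base hS).face_canon])
  degen := fun {n} i hn {A} x => gradedMk hS ((hS A).law.degen i hn (B.toHom x)) (by
    rw [bcMor_degen hS, bcMor_toHom hS, (isBialgebra_base hS).degen_canon])
  mul := fun {m n p} h {A} x y => gradedMk hS ((hS A).law.prod h (B.toHom x) (B.toHom y)) (by
    rw [bcMor_prod hS, bcMor_toHom hS, bcMor_toHom hS, (isBialgebra_base hS).prod_canon])
  one A := gradedMk hS (n := 0) (𝟙 (B.toFormal.obj A)) (by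
    rw [bcMor_id]
    exact (canon_zero _ _).symm)
  map_face := fun {n} i hi hn {A A'} f x => toHom_injective (bcMor_face hS f i hi hn (B.toHom x))
  map_degen := fun {n} i hn {A A'} f x => toHom_injective (bcMor_degen hS f i hn (B.toHom x))
  map_mul := fun {m n p} h {A A'} f x y =>
    toHom_injective (bcMor_prod hS f h (B.toHom x) (B.toHom y))
  map_one := fun {A A'} f => toHom_injective (bcMor_id f)
  mul_assoc := fun {m n p q r s} h₁ h₂ h₃ h₄ {A} x y z =>
    toHom_injective ((hS A).law.prod_assoc h₁ h₂ h₃ h₄ _ _ _)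
  one_mul := fun {n A} x => toHom_injective ((hS A).law.one_prod _)
  mul_one := fun {n A} x => toHom_injective ((hS A).law.prod_one _)
  face_face := fun {n} i j hi hij hj {A} x => toHom_injective ((hS A).law.face_face i j hi hij hj _)
  degen_degen := fun {n} i j hij hj {A} x => toHom_injective ((hS A).law.degen_degen i j hij hj _)
  degen_face_of_lt := fun {n} i j hi hij hj {A} x =>
    toHom_injective ((hS A).law.degen_face_of_lt i j hi hij hj _)
  degen_face_self := fun {n} j hj hn {A} x => toHom_injective ((hS A).law.degen_face_self j hj hn _)
  degen_face_succ := fun {n} j hn {A} x => toHom_injective ((hS A).law.degen_face_succ j hn _)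
  degen_face_of_gt := fun {n} i j hij hi {A} x =>
    toHom_injective ((hS A).law.degen_face_of_gt i j hij hi _)
  face_mul := fun {m n p} h i hi hm {A} x y => toHom_injective ((hS A).law.face_prod h i hi hm _ _)
  mul_face := fun {m n p} h i hi hn {A} x y => toHom_injective ((hS A).law.prod_face h i hi hn _ _)
  degen_mul := fun {m n p} h i hm {A} x y => toHom_injective ((hS A).law.degen_prod h i hm _ _)
  mul_degen := fun {m n p} h i hn {A} x y => toHom_injective ((hS A).law.prod_degen h i hn _ _)

theorem isStandard_sdc (hS : S.IsCompatible) (h𝓑 : UniformlyTrivial 𝓑) :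
    B.IsStandard (B.sdc hS h𝓑) where
  mul := fun {_ _ _} h {A} _ _ => ((hS A).prodMap_eq h _ _).symm
  one _ := rfl
  face := fun {_} i hi hn {A} _ => ((hS A).faceMap_eq i hi hn _).symm
  degen := fun {_} i hn {A} _ => ((hS A).degenMap_eq i hn _).symm

end Lift

end SquareDiagram

end

end

end SimplicialDeformation

namespace SimplicialDeformation

set_option linter.unusedSectionVars false

noncomputable section

section

universe v₁ v₂ v₃ v₄ u₁ u₂ u₃ u₄

namespace AdjSquare

variable {D : Type u₁} {E : Type u₂} {A : Type u₃} {B : Type u₄}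
  [Category.{v₁} D] [Category.{v₂} E] [Category.{v₃} A] [Category.{v₄} B]
  (S : AdjSquare D E A B)

/-! ### Bialgebra structures obtained by transport from `UV X` -/

/-- The action on `b` obtained by transport along `θ : UV X ≅ b`. -/
def trAct {X : D} {b : B} (θ : S.UV.obj X ≅ b) : S.T.obj b ⟶ b :=
  S.T.map θ.inv ≫ S.act X ≫ θ.hom

/-- The coaction on `b` obtained by transport along `θ : UV X ≅ b`. -/
def trCoact {X : D} {b : B} (θ : S.UV.obj X ≅ b) : b ⟶ S.L.obj b :=
  θ.inv ≫ S.coact X ≫ S.L.map θ.hom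

variable {S} {X Y : D} {b c : B}

theorem map_trAct (θ : S.UV.obj X ≅ b) : S.T.map θ.hom ≫ S.trAct θ = S.act X ≫ θ.hom := by
  rw [trAct, ← S.T.map_comp_assoc, θ.hom_inv_id, S.T.map_id, Category.id_comp]

theorem hom_trCoact (θ : S.UV.obj X ≅ b) : θ.hom ≫ S.trCoact θ = S.coact X ≫ S.L.map θ.hom := by
  rw [trCoact, θ.hom_inv_id_assoc]

theorem trAct_eq (θ : S.UV.obj X ≅ b) {h : S.T.obj b ⟶ b}
    (e : S.T.map θ.hom ≫ h = S.act X ≫ θ.hom) : S.trAct θ = h := by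
  rw [trAct, ← e, ← S.T.map_comp_assoc, θ.inv_hom_id, S.T.map_id, Category.id_comp]

theorem trCoact_eq (θ : S.UV.obj X ≅ b) {v : b ⟶ S.L.obj b}
    (e : θ.hom ≫ v = S.coact X ≫ S.L.map θ.hom) : S.trCoact θ = v := by
  rw [trCoact, ← e, θ.inv_hom_id_assoc]

theorem IsCompatible.isBialgebra_tr (H : S.IsCompatible) (θ : S.UV.obj X ≅ b) :
    H.law.IsBialgebra (S.trAct θ) (S.trCoact θ) :=
  (H.isBialgebra X).of_iso θ (map_trAct θ) (hom_trCoact θ)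

/-- A map respects the transported actions exactly if it respects the original ones. -/
theorem map_trAct_iff (θ : S.UV.obj X ≅ b) (θ' : S.UV.obj Y ≅ c) {g : b ⟶ c}
    {φ : S.UV.obj X ⟶ S.UV.obj Y} (e : θ.hom ≫ g = φ ≫ θ'.hom) :
    S.T.map g ≫ S.trAct θ' = S.trAct θ ≫ g ↔ S.T.map φ ≫ S.act Y = S.act X ≫ φ := by
  have h1 : S.T.map θ.hom ≫ S.T.map g ≫ S.trAct θ' = (S.T.map φ ≫ S.act Y) ≫ θ'.hom := by
    rw [← S.T.map_comp_assoc, e, S.T.map_comp, Category.assoc, map_trAct, Category.assoc]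
  have h2 : S.T.map θ.hom ≫ S.trAct θ ≫ g = (S.act X ≫ φ) ≫ θ'.hom := by
    rw [comp_eq_assoc (map_trAct θ), Category.assoc, e, Category.assoc]
  rw [← cancel_mono θ'.hom, ← h1, ← h2, cancel_epi]

/-- A map respects the transported coactions exactly if it respects the original ones. -/
theorem comp_trCoact_iff (θ : S.UV.obj X ≅ b) (θ' : S.UV.obj Y ≅ c) {g : b ⟶ c}
    {φ : S.UV.obj X ⟶ S.UV.obj Y} (e : θ.hom ≫ g = φ ≫ θ'.hom) :
    g ≫ S.trCoact θ' = S.trCoact θ ≫ S.L.map g ↔ φ ≫ S.coact Y = S.coact X ≫ S.L.map φ := by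
  have h1 : θ.hom ≫ g ≫ S.trCoact θ' = (φ ≫ S.coact Y) ≫ S.L.map θ'.hom := by
    rw [comp_eq_assoc e, Category.assoc, hom_trCoact, Category.assoc]
  have h2 : θ.hom ≫ S.trCoact θ ≫ S.L.map g = (S.coact X ≫ S.L.map φ) ≫ S.L.map θ'.hom := by
    rw [comp_eq_assoc (hom_trCoact θ), Category.assoc, ← S.L.map_comp, e, S.L.map_comp,
      Category.assoc]
  rw [← cancel_mono (S.L.map θ'.hom), ← h1, ← h2, cancel_epi]

/-- A map of `D`, transported to a map `b ⟶ c`, intertwines the Maurer-Cartan elements of the two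
bialgebras. -/
theorem map_trAct_trCoact (θ : S.UV.obj X ≅ b) (θ' : S.UV.obj Y ≅ c) {g : b ⟶ c} (φ : X ⟶ Y)
    (e : θ.hom ≫ g = S.UV.map φ ≫ θ'.hom) :
    S.T.map g ≫ S.trAct θ' ≫ S.trCoact θ' = (S.trAct θ ≫ S.trCoact θ) ≫ S.L.map g := by
  have e₁ := (map_trAct_iff θ θ' e).2 (act_naturality φ)
  have e₂ := (comp_trCoact_iff θ θ' e).2 (coact_naturality φ)
  rw [comp_eq_assoc e₁, Category.assoc, e₂, Category.assoc]

/-- Isomorphisms of `D` are the same as isomorphisms of bialgebras. -/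
theorem exists_iso_of_bialgebra_iso [(Monad.comparison S.adjFU₀).IsEquivalence]
    [(Comonad.comparison S.adjVG₁).IsEquivalence] (ψ : S.UV.obj X ≅ S.UV.obj Y)
    (h : S.T.map ψ.hom ≫ S.act Y = S.act X ≫ ψ.hom)
    (h' : ψ.hom ≫ S.coact Y = S.coact X ≫ S.L.map ψ.hom) :
    ∃ e : X ≅ Y, S.UV.map e.hom = ψ.hom := by
  have := UV_faithful (S := S)
  obtain ⟨f, hf⟩ := exists_map_of_bialgebra_map ψ.hom h h'
  obtain ⟨g, hg⟩ := exists_map_of_bialgebra_map ψ.inv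
    (by rw [← cancel_epi (S.T.map ψ.hom), ← S.T.map_comp_assoc, ψ.hom_inv_id, S.T.map_id,
      comp_eq_assoc h, Category.assoc, ψ.hom_inv_id, Category.id_comp, Category.comp_id])
    (by rw [← cancel_epi ψ.hom, ψ.hom_inv_id_assoc, comp_eq_assoc h', Category.assoc,
      ← S.L.map_comp, ψ.hom_inv_id, S.L.map_id, Category.comp_id])
  refine ⟨⟨f, g, S.UV.map_injective ?_, S.UV.map_injective ?_⟩, hf⟩
  · rw [S.UV.map_comp, hf, hg, ψ.hom_inv_id, S.UV.map_id]
  · rw [S.UV.map_comp, hf, hg, ψ.inv_hom_id, S.UV.map_id]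

end AdjSquare

namespace AdjSquareMap

variable {D : Type u₁} {E : Type u₂} {A : Type u₃} {B : Type u₄}
  [Category.{v₁} D] [Category.{v₂} E] [Category.{v₃} A] [Category.{v₄} B]
  {S : AdjSquare D E A B} {D' : Type u₁} {E' : Type u₂} {A' : Type u₃} {B' : Type u₄}
  [Category.{v₁} D'] [Category.{v₂} E'] [Category.{v₃} A'] [Category.{v₄} B']
  {S' : AdjSquare D' E' A' B'} (P : AdjSquareMap S S') {X : D} {b : B} {b' : B'}
  (θ : S.UV.obj X ≅ b) (θ' : S'.UV.obj (P.ΦD.obj X) ≅ b') {j : b' ⟶ P.ΦB.obj b}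
  (hj : θ'.hom ≫ j = P.uv.app X ≫ P.ΦB.map θ.hom)
include hj

/-- Transport of the action is compatible with base change. -/
theorem trAct_map : S'.T.map j ≫ P.t.app b ≫ P.ΦB.map (S.trAct θ) = S'.trAct θ' ≫ j := by
  have h1 := P.t_naturality θ.hom
  have h2 := congr(P.ΦB.map $(AdjSquare.map_trAct θ))
  rw [P.ΦB.map_comp, P.ΦB.map_comp] at h2
  rw [← cancel_epi (S'.T.map θ'.hom), ← S'.T.map_comp_assoc, hj, S'.T.map_comp, Category.assoc,
    comp_eq_assoc h1, Category.assoc, h2, comp_eq_assoc_three (P.map_uv_act X), Category.assoc,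
    ← hj, comp_eq_assoc (AdjSquare.map_trAct θ'), Category.assoc]

/-- Transport of the coaction is compatible with base change. -/
theorem trCoact_map (H : S.IsCompatible) (H' : S'.IsCompatible) :
    S'.trCoact θ' ≫ S'.L.map j ≫ P.l.app b = j ≫ P.ΦB.map (S.trCoact θ) := by
  have h1 := P.l_naturality θ.hom
  have h2 := congr(P.ΦB.map $(AdjSquare.hom_trCoact θ))
  rw [P.ΦB.map_comp, P.ΦB.map_comp] at h2
  rw [← cancel_epi θ'.hom, comp_eq_assoc hj, Category.assoc, h2,
    comp_eq_assoc (AdjSquare.hom_trCoact θ'),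
    Category.assoc, ← S'.L.map_comp_assoc, hj, S'.L.map_comp, Category.assoc, h1,
    comp_eq_assoc_three (P.coact_map_uv H H' X), Category.assoc]

end AdjSquareMap

end

section

variable {Λ : Type u} [CommRing Λ] [IsLocalRing Λ]

open ArtAlg AdjSquare

namespace SquareDiagram

variable {𝓓 𝓔 𝓐 𝓑 : CatFunctor.{u, v, w} Λ} {S : SquareDiagram 𝓓 𝓔 𝓐 𝓑} {D : 𝓓.at (k Λ)}

namespace Lift

variable {B : S.Lift D}

/-! ### Trivialisations of `UV X` -/

/-- Base change of an isomorphism `UV X ≅ B_A` along `A → A'`. -/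
def bcTriv {A A' : ArtAlg Λ} (f : A ⟶ A') {X : 𝓓.at A}
    (θ : (S.sqAt A).UV.obj X ≅ B.toFormal.obj A) :
    (S.sqAt A').UV.obj ((𝓓.bc f).obj X) ≅ B.toFormal.obj A' :=
  (CatFunctor.natIso (S.V₁ ≫ S.U₀) f).app X ≪≫ (𝓑.bc f).mapIso θ ≪≫ B.toFormal.iso f

theorem bcTriv_hom {A A' : ArtAlg Λ} (f : A ⟶ A') {X : 𝓓.at A}
    (θ : (S.sqAt A).UV.obj X ≅ B.toFormal.obj A) : (bcTriv f θ).hom =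
      (S.bcSq f).uv.app X ≫ (𝓑.bc f).map θ.hom ≫ (B.toFormal.iso f).hom := by
  rw [← natIso_UV]
  rfl

theorem bcTriv_hom_inv {A A' : ArtAlg Λ} (f : A ⟶ A') {X : 𝓓.at A}
    (θ : (S.sqAt A).UV.obj X ≅ B.toFormal.obj A) :
    (bcTriv f θ).hom ≫ (B.toFormal.iso f).inv = (S.bcSq f).uv.app X ≫ (𝓑.bc f).map θ.hom := by
  have key {C : Type w} [Category.{v} C] {x₀ x₁ x₂ x₃ : C} (a : x₀ ⟶ x₁) (b : x₁ ⟶ x₂)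
      (c : x₂ ≅ x₃) : (a ≫ b ≫ c.hom) ≫ c.inv = a ≫ b := by simp
  rw [bcTriv_hom]
  exact key _ _ _

theorem bcTriv_comp_bcMor {A A' : ArtAlg Λ} (f : A ⟶ A') {X Y : 𝓓.at A}
    (θ : (S.sqAt A).UV.obj X ≅ B.toFormal.obj A) (θ' : (S.sqAt A).UV.obj Y ≅ B.toFormal.obj A)
    (φ : X ⟶ Y) (g : B.Mor 0 A) (h : θ.hom ≫ g = (S.sqAt A).UV.map φ ≫ θ'.hom) :
    (bcTriv f θ).hom ≫ B.bcMor f g =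
      (S.sqAt A').UV.map ((𝓓.bc f).map φ) ≫ (bcTriv f θ').hom := by
  have h1 := congr((𝓑.bc f).map $h)
  have h1' : (𝓑.bc f).map θ.hom ≫ (𝓑.bc f).map g =
      (𝓑.bc f).map ((S.sqAt A).UV.map φ) ≫ (𝓑.bc f).map θ'.hom :=
    ((𝓑.bc f).map_comp _ _).symm.trans (h1.trans ((𝓑.bc f).map_comp _ _))
  have h2 := (S.bcSq f).uv_naturality φ
  have key {C : Type w} [Category.{v} C] {x₀ x₁ x₂ x₃ y₀ y₁ : C} {a : x₀ ⟶ x₁} {b : x₁ ⟶ x₂}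
      (c : x₂ ≅ x₃) {d : x₂ ⟶ x₂} {p : x₀ ⟶ y₀} {q : y₀ ⟶ y₁} {m : x₁ ⟶ y₁} {r : y₁ ⟶ x₂}
      (h1 : b ≫ d = m ≫ r) (h2 : p ≫ q = a ≫ m) :
      (a ≫ b ≫ c.hom) ≫ c.inv ≫ d ≫ c.hom = p ≫ q ≫ r ≫ c.hom := by
    simp only [Category.assoc, Iso.hom_inv_id_assoc]
    rw [reassoc_of% h1, reassoc_of% h2]
  rw [bcTriv_hom, bcTriv_hom]
  exact key (B.toFormal.iso f) h1' h2

theorem bcTriv_id {A : ArtAlg Λ} {X : 𝓓.at A} (θ : (S.sqAt A).UV.obj X ≅ B.toFormal.obj A) :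
    (bcTriv (𝟙 A) θ).hom = (S.sqAt A).UV.map ((𝓓.bcId A).hom.app X) ≫ θ.hom := by
  have h1 := CatFunctor.natIso_id (S.V₁ ≫ S.U₀) A X
  have h2 := (𝓑.bcId A).hom.naturality θ.hom
  refine Eq.trans (b := (CatFunctor.natIso (S.V₁ ≫ S.U₀) (𝟙 A)).hom.app X ≫
    (𝓑.bc (𝟙 A)).map θ.hom ≫ (B.toFormal.iso (𝟙 A)).hom) rfl ?_
  rw [B.toFormal.iso_id]
  refine (congrArg (_ ≫ ·) h2).trans ?_
  exact (Category.assoc _ _ _).symm.trans (congrArg (· ≫ θ.hom) h1)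

theorem bcTriv_comp {A A' A'' : ArtAlg Λ} (f : A ⟶ A') (g : A' ⟶ A'') {X : 𝓓.at A}
    (θ : (S.sqAt A).UV.obj X ≅ B.toFormal.obj A) :
    (bcTriv (f ≫ g) θ).hom =
      (S.sqAt A'').UV.map ((𝓓.bcComp f g _ rfl).hom.app X) ≫ (bcTriv g (bcTriv f θ)).hom := by
  have h1 := CatFunctor.natIso_comp (S.V₁ ≫ S.U₀) f g X
  have h2 := (𝓑.bcComp f g _ rfl).hom.naturality θ.hom
  have h3 : (bcTriv (f ≫ g) θ).hom = (CatFunctor.natIso (S.V₁ ≫ S.U₀) (f ≫ g)).hom.app X ≫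
    (𝓑.bc (f ≫ g)).map θ.hom ≫ (B.toFormal.iso (f ≫ g)).hom := rfl
  have h4 : (bcTriv g (bcTriv f θ)).hom =
      (CatFunctor.natIso (S.V₁ ≫ S.U₀) g).hom.app ((𝓓.bc f).obj X) ≫
      (𝓑.bc g).map ((CatFunctor.natIso (S.V₁ ≫ S.U₀) f).hom.app X ≫ (𝓑.bc f).map θ.hom ≫
        (B.toFormal.iso f).hom) ≫ (B.toFormal.iso g).hom := rfl
  have h5 : (𝓑.bc g).map ((CatFunctor.natIso (S.V₁ ≫ S.U₀) f).hom.app X ≫ (𝓑.bc f).map θ.hom ≫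
        (B.toFormal.iso f).hom) = (𝓑.bc g).map ((CatFunctor.natIso (S.V₁ ≫ S.U₀) f).hom.app X) ≫
      (𝓑.bc g).map ((𝓑.bc f).map θ.hom) ≫ (𝓑.bc g).map (B.toFormal.iso f).hom :=
    ((𝓑.bc g).map_comp _ _).trans (congrArg (_ ≫ ·) ((𝓑.bc g).map_comp _ _))
  have key {C : Type w} [Category.{v} C] {x₀ x₁ x₂ x₃ x₄ x₅ y₁ y₂ y₃ : C} {a : x₀ ⟶ x₁}
      {b : x₁ ⟶ x₂} {c : x₂ ⟶ x₃} {d : x₃ ⟶ x₄} {e : x₄ ⟶ x₅} {c' : x₁ ⟶ y₁} {b' : y₁ ⟶ x₃}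
      {p : x₀ ⟶ y₂} {q : y₂ ⟶ y₃} {r : y₃ ⟶ y₁} (h2 : b ≫ c = c' ≫ b')
      (h1 : a ≫ c' = p ≫ q ≫ r) : a ≫ b ≫ c ≫ d ≫ e = p ≫ q ≫ (r ≫ b' ≫ d) ≫ e := by
    rw [reassoc_of% h2, reassoc_of% h1]
    simp only [Category.assoc]
  rw [h3, h4, h5, B.toFormal.iso_comp]
  exact key h2 h1

theorem bcTriv_comp' {A A' A'' : ArtAlg Λ} (f : A ⟶ A') (g : A' ⟶ A'') (h : A ⟶ A'')
    (e : f ≫ g = h) {X : 𝓓.at A} (θ : (S.sqAt A).UV.obj X ≅ B.toFormal.obj A) :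
    (bcTriv g (bcTriv f θ)).hom =
      (S.sqAt A'').UV.map ((𝓓.bcComp f g h e).inv.app X) ≫ (bcTriv h θ).hom := by
  subst e
  rw [bcTriv_comp]
  exact ((comp_eq_assoc (((S.sqAt A'').UV.map_comp _ _).symm.trans
    ((congrArg _ ((𝓓.bcComp f g _ rfl).inv_hom_id_app X)).trans
      ((S.sqAt A'').UV.map_id _))) _).trans
      (Category.id_comp _)).symm

/-- The bialgebra structures obtained by transport are compatible with base change. -/
theorem bcMor_canon (hS : S.IsCompatible) {A A' : ArtAlg Λ} (f : A ⟶ A') {X : 𝓓.at A}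
    (θ : (S.sqAt A).UV.obj X ≅ B.toFormal.obj A) (n : ℕ) :
    B.bcMor f (canon ((S.sqAt A).trAct θ) ((S.sqAt A).trCoact θ) n) =
      canon ((S.sqAt A').trAct (bcTriv f θ)) ((S.sqAt A').trCoact (bcTriv f θ)) n := by
  have hj := bcTriv_hom_inv f θ
  exact (bcMor_eq_iff hS f _ _).2 (LawMap.isBaseChange_canon
    ((S.bcSq f).trAct_map θ (bcTriv f θ) hj)
    ((S.bcSq f).trCoact_map θ (bcTriv f θ) hj (hS A) (hS A')) n)

end Lift

end SquareDiagram

end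

end

end SimplicialDeformation

namespace SimplicialDeformation

set_option linter.unusedSectionVars false

noncomputable section

section

variable {Λ : Type u} [CommRing Λ] [IsLocalRing Λ] [IsNoetherianRing Λ]

open ArtAlg AdjSquare

namespace SquareDiagram

variable {𝓓 𝓔 𝓐 𝓑 : CatFunctor.{u, v, w} Λ} {S : SquareDiagram 𝓓 𝓔 𝓐 𝓑} {D : 𝓓.at (k Λ)}

namespace Lift

variable (B : S.Lift D) (hS : S.IsCompatible) (h𝓑 : UniformlyTrivial 𝓑)

/-! ### The deformation groupoid of a lift -/

universe w'

section Def

variable {B hS h𝓑} {A : ArtAlg Λ}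

/-- The map `B_A → B_A` given by a morphism of the deformation groupoid. -/
def defEnd {x y : SDC.DefObj.{u, v, w'} (B.sdc hS h𝓑) A} (g : x ⟶ y) :
    B.toFormal.obj A ⟶ B.toFormal.obj A := B.toHom g.pt

theorem defEnd_injective {x y : SDC.DefObj.{u, v, w'} (B.sdc hS h𝓑) A} {g h : x ⟶ y}
    (e : defEnd g = defEnd h) : g = h := SDC.DefHom.ext (toHom_injective e)

theorem defEnd_id (x : SDC.DefObj.{u, v, w'} (B.sdc hS h𝓑) A) : defEnd (𝟙 x) = 𝟙 _ := rfl

theorem defEnd_comp {x y z : SDC.DefObj.{u, v, w'} (B.sdc hS h𝓑) A} (g : x ⟶ y) (h : y ⟶ z) :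
    defEnd (g ≫ h) = defEnd g ≫ defEnd h :=
  MixedLaw.prod_zero_zero (defEnd h) (defEnd g)

/-- The map `⊤ₕB → ⊥ᵥB` of a Maurer-Cartan element. -/
def defMor (x : SDC.DefObj.{u, v, w'} (B.sdc hS h𝓑) A) :
    (S.sqAt A).T.obj (B.toFormal.obj A) ⟶ (S.sqAt A).L.obj (B.toFormal.obj A) := B.toHom x.pt

theorem defEnd_comm {x y : SDC.DefObj.{u, v, w'} (B.sdc hS h𝓑) A} (g : x ⟶ y) :
    (S.sqAt A).T.map (defEnd g) ≫ defMor y = defMor x ≫ (S.sqAt A).L.map (defEnd g) := by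
  have h := congr(B.toHom $(SDC.DefHom.comm g))
  exact ((MixedLaw.prod_one_zero (M := (hS A).law) (defMor y) (defEnd g)).symm.trans h.symm).trans
    (MixedLaw.prod_zero_one (defEnd g) (defMor x))

theorem bcMor_defEnd {x y : SDC.DefObj.{u, v, w'} (B.sdc hS h𝓑) A} (g : x ⟶ y) :
    B.bcMor (n := 0) A.toK (defEnd g) = 𝟙 (B.toFormal.obj (k Λ)) :=
  (bcMor_toHom hS (SDC.DefHom.pt g)).trans (canon_zero _ _)

/-- A morphism of the deformation groupoid, from a map `B_A → B_A`. -/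
def defHomMk {x y : SDC.DefObj.{u, v, w'} (B.sdc hS h𝓑) A}
    (g : B.toFormal.obj A ⟶ B.toFormal.obj A)
    (h : B.bcMor (n := 0) A.toK g = 𝟙 (B.toFormal.obj (k Λ)))
    (comm : (S.sqAt A).T.map g ≫ defMor y = defMor x ≫ (S.sqAt A).L.map g) : x ⟶ y where
  pt := gradedMk hS (n := 0) g (h.trans (canon_zero _ _).symm)
  comm := toHom_injective (((MixedLaw.prod_zero_one (M := (hS A).law) g (defMor x)).trans
    comm.symm).trans (MixedLaw.prod_one_zero (defMor y) g).symm)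

theorem defEnd_mk {x y : SDC.DefObj.{u, v, w'} (B.sdc hS h𝓑) A}
    (g : B.toFormal.obj A ⟶ B.toFormal.obj A)
    (h : B.bcMor (n := 0) A.toK g = 𝟙 (B.toFormal.obj (k Λ)))
    (comm : (S.sqAt A).T.map g ≫ defMor y = defMor x ≫ (S.sqAt A).L.map g) :
    defEnd (defHomMk (h𝓑 := h𝓑) (hS := hS) g h comm) = g := rfl

include h𝓑 in
theorem isIso_of_bcMor (g : B.Mor 0 A) (h : B.bcMor (n := 0) A.toK g = 𝟙 (B.toFormal.obj (k Λ))) :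
    IsIso (C := 𝓑.at A) (X := B.toFormal.obj A) (Y := B.toFormal.obj A) g :=
  h𝓑.isIso_of_base B.toFormal B.toFormal g (by
    have h' : (B.toFormal.iso A.toK).inv ≫ (𝓑.bc A.toK).map g ≫ (B.toFormal.iso A.toK).hom =
      𝟙 (B.toFormal.obj (k Λ)) := h
    exact h' ▸ inferInstance)

theorem bcMor_comp {A A' : ArtAlg Λ} (f : A ⟶ A') (g h : B.toFormal.obj A ⟶ B.toFormal.obj A) :
    B.bcMor (n := 0) f (g ≫ h) = B.bcMor (n := 0) f g ≫ B.bcMor (n := 0) f h := by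
  have key {C : Type w} [Category.{v} C] {x y : C} (i : y ≅ x) (a b : y ⟶ y) :
    i.inv ≫ (a ≫ b) ≫ i.hom = (i.inv ≫ a ≫ i.hom) ≫ i.inv ≫ b ≫ i.hom := by simp
  exact (congrArg (fun t => (B.toFormal.iso f).inv ≫ t ≫ (B.toFormal.iso f).hom)
    ((𝓑.bc f).map_comp g h)).trans (key _ _ _)

/-- A morphism of the deformation groupoid is a map `B_A → B_A` that is the identity over `k`, hence
it is invertible. -/
theorem isGroupoid_defObj : IsGroupoid (SDC.DefObj.{u, v, w'} (B.sdc hS h𝓑) A) where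
  all_isIso {x y} g := by
    have hi : IsIso (defEnd g) := isIso_of_bcMor (h𝓑 := h𝓑) (defEnd g) (bcMor_defEnd g)
    obtain ⟨h, h₁, h₂⟩ : ∃ h : B.toFormal.obj A ⟶ B.toFormal.obj A,
        defEnd g ≫ h = 𝟙 _ ∧ h ≫ defEnd g = 𝟙 _ := ⟨inv (defEnd g), by simp, by simp⟩
    have hh : B.bcMor (n := 0) A.toK h = 𝟙 (B.toFormal.obj (k Λ)) := by
      have e := (bcMor_comp A.toK (defEnd g) h).symm.trans ((congrArg _ h₁).trans (bcMor_id _))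
      exact (Category.id_comp _).symm.trans
        ((congrArg (· ≫ B.bcMor (n := 0) A.toK h) (bcMor_defEnd g)).symm.trans e)
    refine ⟨defHomMk h hh ?_, defEnd_injective ?_, defEnd_injective ?_⟩
    · rw [← cancel_epi ((S.sqAt A).T.map (defEnd g)), ← (S.sqAt A).T.map_comp_assoc,
        h₁, (S.sqAt A).T.map_id, Category.id_comp, comp_eq_assoc (defEnd_comm g),
        Category.assoc, ← (S.sqAt A).L.map_comp, h₁, (S.sqAt A).L.map_id, Category.comp_id]
    · rw [defEnd_comp, defEnd_mk, h₁, defEnd_id]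
    · rw [defEnd_comp, defEnd_mk, h₂, defEnd_id]

end Def

/-! ### The transformation from the fibre to the deformation groupoid -/

variable {B} in
include h𝓑 in
/-- The identification `UV(X)_k ≅ UV D ≅ B_k` lifts to an isomorphism `UV X ≅ B_A`. -/
theorem exists_triv {A : ArtAlg Λ} (x : FibreObj 𝓓 D A) :
    ∃ θ : (S.sqAt A).UV.obj x.obj ≅ B.toFormal.obj A,
      (bcTriv A.toK θ).hom = (S.sqAt (k Λ)).UV.map x.iso.hom ≫ B.iso.inv := by
  have := h𝓑.full A.toK (surj_toK A)
  let i : (𝓑.bc A.toK).obj ((S.sqAt A).UV.obj x.obj) ≅ (𝓑.bc A.toK).obj (B.toFormal.obj A) :=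
    ((CatFunctor.natIso (S.V₁ ≫ S.U₀) A.toK).app x.obj).symm ≪≫
      (S.sqAt (k Λ)).UV.mapIso x.iso ≪≫ B.iso.symm ≪≫ (B.toFormal.iso A.toK).symm
  obtain ⟨t, ht⟩ := (𝓑.bc A.toK).map_surjective i.hom
  have hi : IsIso t := h𝓑.isIso_of_toK t (ht ▸ inferInstance)
  refine ⟨asIso t, ?_⟩
  have key {C : Type w} [Category.{v} C] {x₀ x₁ x₂ x₃ x₄ : C} (a : x₀ ≅ x₁) (b : x₀ ⟶ x₂)
    (c : x₂ ⟶ x₃) (d : x₄ ≅ x₃) (t : x₁ ⟶ x₄) (h : t = a.inv ≫ b ≫ c ≫ d.inv) :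
    a.hom ≫ t ≫ d.hom = b ≫ c := by simp [h]
  exact key ((CatFunctor.natIso (S.V₁ ≫ S.U₀) A.toK).app x.obj) _ _ _ _ ht

/-- A chosen isomorphism `UV X ≅ B_A`, for an object `X` of the fibre. -/
def triv {A : ArtAlg Λ} (x : FibreObj 𝓓 D A) :
    (S.sqAt A).UV.obj x.obj ≅ B.toFormal.obj A := (exists_triv (B := B) h𝓑 x).choose

theorem bcTriv_triv {A : ArtAlg Λ} (x : FibreObj 𝓓 D A) :
    (bcTriv A.toK (B.triv h𝓑 x)).hom = (S.sqAt (k Λ)).UV.map x.iso.hom ≫ B.iso.inv :=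
  (exists_triv h𝓑 x).choose_spec

section

variable {B}

/-- If `θ` lifts the identification over `k`, then the action transported along `θ` reduces to that
of `B_k`. -/
theorem trAct_eq_baseAct {A : ArtAlg Λ} (x : FibreObj 𝓓 D A)
    (θ : (S.sqAt A).UV.obj x.obj ≅ B.toFormal.obj A)
    (h : (bcTriv A.toK θ).hom = (S.sqAt (k Λ)).UV.map x.iso.hom ≫ B.iso.inv) :
    (S.sqAt (k Λ)).trAct (bcTriv A.toK θ) = B.baseAct := by
  refine trAct_eq _ ?_
  have hn := act_naturality (S := S.sqAt (k Λ)) x.iso.hom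
  rw [h, baseAct, ← (S.sqAt (k Λ)).T.map_comp_assoc, Category.assoc, Iso.inv_hom_id,
    Category.comp_id, comp_eq_assoc hn, Category.assoc]

theorem trCoact_eq_baseCoact {A : ArtAlg Λ} (x : FibreObj 𝓓 D A)
    (θ : (S.sqAt A).UV.obj x.obj ≅ B.toFormal.obj A)
    (h : (bcTriv A.toK θ).hom = (S.sqAt (k Λ)).UV.map x.iso.hom ≫ B.iso.inv) :
    (S.sqAt (k Λ)).trCoact (bcTriv A.toK θ) = B.baseCoact := by
  refine trCoact_eq _ ?_
  have hn := coact_naturality (S := S.sqAt (k Λ)) x.iso.hom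
  rw [h, baseCoact, Category.assoc, Iso.inv_hom_id_assoc, comp_eq_assoc hn, Category.assoc,
    (S.sqAt (k Λ)).L.map_comp]

/-- The Maurer-Cartan element of a trivialised object of the fibre. -/
def mcElt {A : ArtAlg Λ} (x : FibreObj 𝓓 D A)
    (θ : (S.sqAt A).UV.obj x.obj ≅ B.toFormal.obj A)
    (h : (bcTriv A.toK θ).hom = (S.sqAt (k Λ)).UV.map x.iso.hom ≫ B.iso.inv) :
    SDC.DefObj.{u, v, w} (B.sdc hS h𝓑) A where
  pt := gradedMk hS (n := 1) (canon ((S.sqAt A).trAct θ) ((S.sqAt A).trCoact θ) 1)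
    (by rw [bcMor_canon hS, trAct_eq_baseAct x θ h, trCoact_eq_baseCoact x θ h])
  mc := toHom_injective ((((hS A).isBialgebra_tr θ).prod_canon _).trans
    (((hS A).isBialgebra_tr θ).face_canon 1 le_rfl le_rfl).symm)

theorem defMor_mcElt {A : ArtAlg Λ} (x : FibreObj 𝓓 D A)
    (θ : (S.sqAt A).UV.obj x.obj ≅ B.toFormal.obj A)
    (h : (bcTriv A.toK θ).hom = (S.sqAt (k Λ)).UV.map x.iso.hom ≫ B.iso.inv) :
    defMor (mcElt hS h𝓑 x θ h) = (S.sqAt A).trAct θ ≫ (S.sqAt A).trCoact θ :=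
  canon_one ((S.sqAt A).trAct θ) ((S.sqAt A).trCoact θ)

/-- An endomorphism of `B_A` that corresponds to a map `φ` of `𝓓(A)` is the identity over `k`
exactly if `UV φ` respects the identifications with `UV D` over `k`. -/
theorem bcMor_eq_id_iff {A : ArtAlg Λ} (x y : FibreObj 𝓓 D A)
    (θ : (S.sqAt A).UV.obj x.obj ≅ B.toFormal.obj A)
    (θ' : (S.sqAt A).UV.obj y.obj ≅ B.toFormal.obj A)
    (h : (bcTriv A.toK θ).hom = (S.sqAt (k Λ)).UV.map x.iso.hom ≫ B.iso.inv)
    (h' : (bcTriv A.toK θ').hom = (S.sqAt (k Λ)).UV.map y.iso.hom ≫ B.iso.inv)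
    (φ : x.obj ⟶ y.obj) (g : B.toFormal.obj A ⟶ B.toFormal.obj A)
    (hg : θ.hom ≫ g = (S.sqAt A).UV.map φ ≫ θ'.hom) :
    B.bcMor (n := 0) A.toK g = 𝟙 (B.toFormal.obj (k Λ)) ↔
      (S.sqAt (k Λ)).UV.map ((𝓓.bc A.toK).map φ ≫ y.iso.hom) =
        (S.sqAt (k Λ)).UV.map x.iso.hom := by
  have e := bcTriv_comp_bcMor A.toK θ θ' φ g hg
  rw [h'] at e
  rw [← cancel_mono B.iso.inv, (S.sqAt (k Λ)).UV.map_comp, Category.assoc, ← h]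
  have e' : (bcTriv A.toK θ).hom ≫ B.bcMor (n := 0) A.toK g =
      (S.sqAt (k Λ)).UV.map ((𝓓.bc A.toK).map φ) ≫ (S.sqAt (k Λ)).UV.map y.iso.hom ≫
        B.iso.inv := e
  rw [← e']
  constructor
  · intro hb
    exact (congrArg (_ ≫ ·) hb).trans (Category.comp_id _)
  · intro hb
    exact (cancel_epi (bcTriv A.toK θ).hom).1 (hb.trans (Category.comp_id _).symm)

end

/-- The functor from the fibre to the deformation groupoid over `A`. It sends an object `X` with the
chosen isomorphism `UV X ≅ B_A` to the Maurer-Cartan element of the bialgebra structure of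
`B_A`. -/
def toDef (A : ArtAlg Λ) : FibreObj 𝓓 D A ⥤ SDC.DefObj.{u, v, w} (B.sdc hS h𝓑) A where
  obj x := mcElt hS h𝓑 x (B.triv h𝓑 x) (B.bcTriv_triv h𝓑 x)
  map {x y} φ := defHomMk
    ((B.triv h𝓑 x).inv ≫ (S.sqAt A).UV.map φ.hom ≫ (B.triv h𝓑 y).hom)
    ((bcMor_eq_id_iff x y _ _ (B.bcTriv_triv h𝓑 x) (B.bcTriv_triv h𝓑 y) φ.hom _
      (Iso.hom_inv_id_assoc _ _)).2 (congrArg _ φ.comm))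
    (by
      rw [defMor_mcElt, defMor_mcElt]
      exact map_trAct_trCoact _ _ φ.hom (Iso.hom_inv_id_assoc _ _))
  map_id x := defEnd_injective (by
    rw [defEnd_mk, FibreObj.id_hom, (S.sqAt A).UV.map_id, Category.id_comp, Iso.inv_hom_id]
    rfl)
  map_comp {x y z} φ ψ := defEnd_injective (by
    rw [defEnd_comp, defEnd_mk, defEnd_mk, defEnd_mk, FibreObj.comp_hom, (S.sqAt A).UV.map_comp]
    simp only [Category.assoc, Iso.hom_inv_id_assoc])

theorem defEnd_toDef_map {A : ArtAlg Λ} {x y : FibreObj 𝓓 D A} (φ : x ⟶ y) :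
    defEnd ((B.toDef hS h𝓑 A).map φ) =
      (B.triv h𝓑 x).inv ≫ (S.sqAt A).UV.map φ.hom ≫ (B.triv h𝓑 y).hom := rfl

end Lift

end SquareDiagram

end

end

end SimplicialDeformation

namespace SimplicialDeformation

set_option linter.unusedSectionVars false

noncomputable section

section

variable {Λ : Type u} [CommRing Λ] [IsLocalRing Λ] [IsNoetherianRing Λ]

open ArtAlg AdjSquare

namespace SquareDiagram

variable {𝓓 𝓔 𝓐 𝓑 : CatFunctor.{u, v, w} Λ} {S : SquareDiagram 𝓓 𝓔 𝓐 𝓑} {D : 𝓓.at (k Λ)}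

namespace Lift

variable (B : S.Lift D) (hS : S.IsCompatible) (h𝓑 : UniformlyTrivial 𝓑)

theorem bcTriv_bcTriv_triv {A A' : ArtAlg Λ} (f : A ⟶ A') (x : FibreObj 𝓓 D A) :
    (bcTriv A'.toK (bcTriv f (B.triv h𝓑 x))).hom =
      (S.sqAt (k Λ)).UV.map ((FibreObj.map 𝓓 D f).obj x).iso.hom ≫ B.iso.inv := by
  rw [bcTriv_comp' f A'.toK A.toK (Subsingleton.elim _ _), bcTriv_triv]
  refine (Category.assoc _ _ _).symm.trans (congrArg (· ≫ _) ?_)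
  exact ((S.sqAt (k Λ)).UV.map_comp _ _).symm

theorem defMor_defMap {A A' : ArtAlg Λ} (f : A ⟶ A') (x : FibreObj 𝓓 D A) :
    defMor ((SDC.defMap.{u, v, w} (B.sdc hS h𝓑) f).obj ((B.toDef hS h𝓑 A).obj x)) =
      (S.sqAt A').trAct (bcTriv f (B.triv h𝓑 x)) ≫
        (S.sqAt A').trCoact (bcTriv f (B.triv h𝓑 x)) :=
  (bcMor_canon hS f _ 1).trans (canon_one _ _)

/-- The compatibility of `toDef` with base change, at an object. -/
def toDefBc {A A' : ArtAlg Λ} (f : A ⟶ A') (x : FibreObj 𝓓 D A) :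
    (B.toDef hS h𝓑 A').obj ((FibreObj.map 𝓓 D f).obj x) ⟶
      (SDC.defMap.{u, v, w} (B.sdc hS h𝓑) f).obj ((B.toDef hS h𝓑 A).obj x) :=
  have e : (B.triv h𝓑 ((FibreObj.map 𝓓 D f).obj x)).hom ≫
      (B.triv h𝓑 ((FibreObj.map 𝓓 D f).obj x)).inv ≫ (bcTriv f (B.triv h𝓑 x)).hom =
        (S.sqAt A').UV.map (𝟙 ((FibreObj.map 𝓓 D f).obj x).obj) ≫
          (bcTriv f (B.triv h𝓑 x)).hom :=
    (Iso.hom_inv_id_assoc _ _).trans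
      ((congrArg (· ≫ _) ((S.sqAt A').UV.map_id _)).trans (Category.id_comp _)).symm
  defHomMk ((B.triv h𝓑 ((FibreObj.map 𝓓 D f).obj x)).inv ≫ (bcTriv f (B.triv h𝓑 x)).hom)
    ((bcMor_eq_id_iff _ _ _ _ (B.bcTriv_triv h𝓑 _) (B.bcTriv_bcTriv_triv h𝓑 f x) _ _ e).2
      (congrArg _ (FibreHom.comm (𝟙 ((FibreObj.map 𝓓 D f).obj x)))))
    (by
      rw [defMor_defMap]
      exact (map_trAct_trCoact _ _ _ e).trans
        (congrArg (· ≫ _) (defMor_mcElt hS h𝓑 _ _ (B.bcTriv_triv h𝓑 _)).symm))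

theorem comp_defEnd_toDefBc {A A' : ArtAlg Λ} (f : A ⟶ A') (x : FibreObj 𝓓 D A) :
    (B.triv h𝓑 ((FibreObj.map 𝓓 D f).obj x)).hom ≫ defEnd (B.toDefBc hS h𝓑 f x) =
      (bcTriv f (B.triv h𝓑 x)).hom :=
  Iso.hom_inv_id_assoc _ _

theorem comp_defEnd_toDef_map {A : ArtAlg Λ} {x y : FibreObj 𝓓 D A} (φ : x ⟶ y) :
    (B.triv h𝓑 x).hom ≫ defEnd ((B.toDef hS h𝓑 A).map φ) =
      (S.sqAt A).UV.map φ.hom ≫ (B.triv h𝓑 y).hom := by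
  rw [defEnd_toDef_map, Iso.hom_inv_id_assoc]

theorem defEnd_defMap {A A' : ArtAlg Λ} (f : A ⟶ A')
    {x y : SDC.DefObj.{u, v, w} (B.sdc hS h𝓑) A} (g : x ⟶ y) :
    defEnd ((SDC.defMap.{u, v, w} (B.sdc hS h𝓑) f).map g) =
      B.bcMor (n := 0) f (defEnd g) := rfl

theorem toDefBc_naturality {A A' : ArtAlg Λ} (f : A ⟶ A') {x y : FibreObj 𝓓 D A} (φ : x ⟶ y) :
    (B.toDef hS h𝓑 A').map ((FibreObj.map 𝓓 D f).map φ) ≫ B.toDefBc hS h𝓑 f y =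
      B.toDefBc hS h𝓑 f x ≫
        (SDC.defMap.{u, v, w} (B.sdc hS h𝓑) f).map ((B.toDef hS h𝓑 A).map φ) := by
  refine defEnd_injective ((cancel_epi (B.triv h𝓑 ((FibreObj.map 𝓓 D f).obj x)).hom).1 ?_)
  rw [defEnd_comp, defEnd_comp, comp_eq_assoc (comp_defEnd_toDefBc ..),
    comp_eq_assoc (comp_defEnd_toDef_map ..), defEnd_defMap, Category.assoc, comp_defEnd_toDefBc]
  exact (bcTriv_comp_bcMor f _ _ φ.hom _ (comp_defEnd_toDef_map ..)).symm

theorem toDefBc_id (A : ArtAlg Λ) (x : FibreObj 𝓓 D A) :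
    defEnd (B.toDefBc hS h𝓑 (𝟙 A) x) =
      defEnd ((B.toDef hS h𝓑 A).map ((FibreObj.mapId 𝓓 D A).hom.app x)) := by
  refine (cancel_epi (B.triv h𝓑 ((FibreObj.map 𝓓 D (𝟙 A)).obj x)).hom).1 ?_
  rw [comp_defEnd_toDefBc, comp_defEnd_toDef_map]
  exact bcTriv_id _

theorem toDefBc_comp {A A' A'' : ArtAlg Λ} (f : A ⟶ A') (g : A' ⟶ A'') (x : FibreObj 𝓓 D A) :
    defEnd (B.toDefBc hS h𝓑 (f ≫ g) x) =
      defEnd ((B.toDef hS h𝓑 A'').map ((FibreObj.mapComp 𝓓 D f g).hom.app x)) ≫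
        defEnd (B.toDefBc hS h𝓑 g ((FibreObj.map 𝓓 D f).obj x)) ≫
          B.bcMor (n := 0) g (defEnd (B.toDefBc hS h𝓑 f x)) := by
  refine (cancel_epi (B.triv h𝓑 ((FibreObj.map 𝓓 D (f ≫ g)).obj x)).hom).1 ?_
  have h := bcTriv_comp_bcMor g (B.triv h𝓑 ((FibreObj.map 𝓓 D f).obj x))
    (bcTriv f (B.triv h𝓑 x)) (𝟙 ((𝓓.bc f).obj x.obj)) (defEnd (B.toDefBc hS h𝓑 f x))
    ((comp_defEnd_toDefBc ..).trans
      ((congrArg (· ≫ _) ((S.sqAt A').UV.map_id _)).trans (Category.id_comp _)).symm)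
  have h' : (bcTriv g (B.triv h𝓑 ((FibreObj.map 𝓓 D f).obj x))).hom ≫
      B.bcMor (n := 0) g (defEnd (B.toDefBc hS h𝓑 f x)) =
        (bcTriv g (bcTriv f (B.triv h𝓑 x))).hom := by
    refine h.trans ?_
    exact (congrArg (· ≫ _) ((congrArg (S.sqAt A'').UV.map ((𝓓.bc g).map_id _)).trans
      ((S.sqAt A'').UV.map_id _))).trans (Category.id_comp _)
  have h1 := B.comp_defEnd_toDef_map hS h𝓑 ((FibreObj.mapComp 𝓓 D f g).hom.app x)
  have h2 := B.comp_defEnd_toDefBc hS h𝓑 g ((FibreObj.map 𝓓 D f).obj x)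
  rw [comp_defEnd_toDefBc, bcTriv_comp]
  refine ((comp_eq_assoc h1 _).trans ((Category.assoc _ _ _).trans
    (congrArg (_ ≫ ·) ((comp_eq_assoc h2 _).trans h')))).symm

instance {A A' : ArtAlg Λ} (f : A ⟶ A') (x : FibreObj 𝓓 D A) : IsIso (B.toDefBc hS h𝓑 f x) :=
  have := isGroupoid_defObj (B := B) (hS := hS) (h𝓑 := h𝓑) (A := A')
  IsGroupoid.all_isIso _

/-- The compatibility of `toDef` with base change. -/
def toDefBcIso {A A' : ArtAlg Λ} (f : A ⟶ A') :
    FibreObj.map 𝓓 D f ⋙ B.toDef hS h𝓑 A' ≅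
      B.toDef hS h𝓑 A ⋙ SDC.defMap.{u, v, w} (B.sdc hS h𝓑) f :=
  NatIso.ofComponents (fun x => asIso (B.toDefBc hS h𝓑 f x))
    (fun φ => B.toDefBc_naturality hS h𝓑 f φ)

variable {B hS h𝓑} in
theorem defEnd_eqToHom_app {A A' : ArtAlg Λ}
    {F G : Cat.of (SDC.DefObj.{u, v, w} (B.sdc hS h𝓑) A) ⟶
      Cat.of (SDC.DefObj.{u, v, w} (B.sdc hS h𝓑) A')} (e : F = G)
    (y : SDC.DefObj.{u, v, w} (B.sdc hS h𝓑) A) :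
    defEnd ((eqToHom e).toNatTrans.app y) = 𝟙 (B.toFormal.obj A') := by
  subst e
  rfl

/-- The transformation from the functor of fibres to the functor of deformation groupoids. -/
def toDefTrans : DefFibre 𝓓 D ⟶ SDC.Def.{u, v, w} (B.sdc hS h𝓑) where
  app a := (B.toDef hS h𝓑 a.as).toCatHom
  naturality {a b} f := Cat.Hom.isoMk (B.toDefBcIso hS h𝓑 f.as)
  naturality_naturality {a b f g} η := by
    obtain rfl := LocallyDiscrete.eq_of_hom η
    obtain rfl := Subsingleton.elim η (𝟙 f)
    have h₁ := (congrArg (· ▷ (B.toDef hS h𝓑 b.as).toCatHom)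
      ((DefFibre 𝓓 D).map₂_id f)).trans (id_whiskerRight _ _)
    have h₂ := (congrArg ((B.toDef hS h𝓑 a.as).toCatHom ◁ ·)
      ((SDC.Def.{u, v, w} (B.sdc hS h𝓑)).map₂_id f)).trans (whiskerLeft_id _ _)
    exact ((congrArg (· ≫ _) h₁).trans (Category.id_comp _)).trans
      ((congrArg (_ ≫ ·) h₂).trans (Category.comp_id _)).symm
  naturality_id a := by
    ext x
    refine defEnd_injective ((defEnd_comp _ _).trans ?_)
    refine (congrArg (_ ≫ ·) (defEnd_eqToHom_app
      (Cat.ext (SDC.defMap_id.{u, v, w} (B.sdc hS h𝓑) a.as)) _)).trans ((Category.comp_id _).trans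
      ((B.toDefBc_id hS h𝓑 a.as x).trans ?_))
    change _ = defEnd ((B.toDef hS h𝓑 a.as).map ((FibreObj.mapId 𝓓 D a.as).hom.app x) ≫
      𝟙 _ ≫ 𝟙 _)
    rw [Category.comp_id, Category.comp_id]
  naturality_comp f g := by
    ext x
    refine defEnd_injective ((defEnd_comp _ _).trans ?_)
    refine (congrArg (_ ≫ ·) (defEnd_eqToHom_app
      (Cat.ext (SDC.defMap_comp.{u, v, w} (B.sdc hS h𝓑) f.as g.as)) _)).trans
        ((Category.comp_id _).trans
      ((B.toDefBc_comp hS h𝓑 f.as g.as x).trans ?_))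
    change _ = defEnd ((B.toDef hS h𝓑 _).map ((FibreObj.mapComp 𝓓 D f.as g.as).hom.app x) ≫
      𝟙 _ ≫ B.toDefBc hS h𝓑 g.as ((FibreObj.map 𝓓 D f.as).obj x) ≫ 𝟙 _ ≫
        (SDC.defMap.{u, v, w} (B.sdc hS h𝓑) g.as).map (B.toDefBc hS h𝓑 f.as x) ≫ 𝟙 _)
    rw [Category.comp_id, Category.id_comp, Category.id_comp, defEnd_comp, defEnd_comp,
      defEnd_defMap]
    rfl

end Lift

end SquareDiagram

end

end

end SimplicialDeformation

namespace SimplicialDeformation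

set_option linter.unusedSectionVars false

noncomputable section

section

variable {Λ : Type u} [CommRing Λ] [IsLocalRing Λ] [IsNoetherianRing Λ]

open ArtAlg AdjSquare

namespace SquareDiagram

variable {𝓓 𝓔 𝓐 𝓑 : CatFunctor.{u, v, w} Λ} {S : SquareDiagram 𝓓 𝓔 𝓐 𝓑} {D : 𝓓.at (k Λ)}

namespace Lift

variable (B : S.Lift D) (hS : S.IsCompatible) (h𝓑 : UniformlyTrivial 𝓑)

/-! ### The transformation is an equivalence -/

variable (hm : S.IsMonadic) (hc : S.IsComonadic)
include hm hc

/-- The functors `U` and `V` are faithful, as they are monadic and comonadic. -/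
theorem faithful_toDef (A : ArtAlg Λ) : (B.toDef hS h𝓑 A).Faithful where
  map_injective {x y} φ ψ h := by
    have := (hm A).2
    have := (hc A).1
    have := UV_faithful (S := S.sqAt A)
    refine FibreObj.hom_ext ((S.sqAt A).UV.map_injective ((cancel_mono (B.triv h𝓑 y).hom).1 ?_))
    rw [← comp_defEnd_toDef_map B hS h𝓑 φ, ← comp_defEnd_toDef_map B hS h𝓑 ψ, h]

/-- A morphism of the deformation groupoid is a map of bialgebras, so it comes from a map of
`𝓓(A)`. -/
theorem full_toDef (A : ArtAlg Λ) : (B.toDef hS h𝓑 A).Full where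
  map_surjective {x y} g := by
    have := (hm A).2
    have := (hc A).1
    have := (hm (k Λ)).2
    have := (hc (k Λ)).1
    have := UV_faithful (S := S.sqAt (k Λ))
    have e : (B.triv h𝓑 x).hom ≫ defEnd g =
        ((B.triv h𝓑 x).hom ≫ defEnd g ≫ (B.triv h𝓑 y).inv) ≫ (B.triv h𝓑 y).hom := by
      rw [Category.assoc, Category.assoc, Iso.inv_hom_id, Category.comp_id]
    have hg : (S.sqAt A).T.map (defEnd g) ≫ (S.sqAt A).trAct (B.triv h𝓑 y) ≫
        (S.sqAt A).trCoact (B.triv h𝓑 y) = ((S.sqAt A).trAct (B.triv h𝓑 x) ≫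
          (S.sqAt A).trCoact (B.triv h𝓑 x)) ≫ (S.sqAt A).L.map (defEnd g) := by
      have h := defEnd_comm g
      exact (congrArg (_ ≫ ·) (defMor_mcElt hS h𝓑 y _ (B.bcTriv_triv h𝓑 y)).symm).trans
        (h.trans (congrArg (· ≫ _) (defMor_mcElt hS h𝓑 x _ (B.bcTriv_triv h𝓑 x))))
    obtain ⟨h₁, h₂⟩ := (((hS A).isBialgebra_tr (B.triv h𝓑 x)).intertwine_iff
      ((hS A).isBialgebra_tr (B.triv h𝓑 y)) _).1 hg
    obtain ⟨φ, hφ⟩ := exists_map_of_bialgebra_map _ ((map_trAct_iff _ _ e).1 h₁)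
      ((comp_trCoact_iff _ _ e).1 h₂)
    rw [← hφ] at e
    refine ⟨⟨φ, (S.sqAt (k Λ)).UV.map_injective ((bcMor_eq_id_iff x y _ _ (B.bcTriv_triv h𝓑 x)
      (B.bcTriv_triv h𝓑 y) φ _ e).1 (bcMor_defEnd g))⟩, defEnd_injective ?_⟩
    rw [← cancel_epi (B.triv h𝓑 x).hom, comp_defEnd_toDef_map, e]

/-- A Maurer-Cartan element is a bialgebra structure on `B_A`, and therefore comes from an object of
`𝓓(A)`. -/
theorem essSurj_toDef (A : ArtAlg Λ) : (B.toDef hS h𝓑 A).EssSurj where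
  mem_essImage ω := by
    have := (hm A).2
    have := (hc A).1
    have := (hm (k Λ)).2
    have := (hc (k Λ)).1
    have := UV_faithful (S := S.sqAt (k Λ))
    have hmc : (hS A).law.IsMaurerCartan (defMor ω) := by
      have h := congr(B.toHom $(ω.mc))
      exact (MixedLaw.prod_one_one (defMor ω) (defMor ω)).symm.trans h
    -- `σ⁰(ω)` reduces to the identity over `k`, so it is invertible, and hence it is the identity.
    have hi : IsIso ((hS A).law.η.app (B.toFormal.obj A) ≫ defMor ω ≫
        (hS A).law.γ.app (B.toFormal.obj A)) :=
      isIso_of_bcMor (h𝓑 := h𝓑) _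
        ((bcMor_toHom hS ((B.sdc hS h𝓑).degen 0 le_rfl ω.pt)).trans (canon_zero _ _))
    have hb := hmc.isBialgebra hmc.η_comp_comp_γ
    obtain ⟨Y, θ, h₁, h₂⟩ := (hS A).exists_of_bialgebra hb
    have hA := trAct_eq θ h₁
    have hC := trCoact_eq θ h₂
    have hω : defMor ω = (S.sqAt A).trAct θ ≫ (S.sqAt A).trCoact θ := by
      rw [hA, hC]
      exact hmc.fac.symm
    -- Over `k`, the bialgebra structures of `UV Y` and `UV D` on `B_k` have the same composite.
    have hk : (S.sqAt (k Λ)).trAct (bcTriv A.toK θ) ≫ (S.sqAt (k Λ)).trCoact (bcTriv A.toK θ) =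
        B.baseAct ≫ B.baseCoact := by
      have h := bcMor_canon hS A.toK θ 1
      have h' : defMor ω = canon ((S.sqAt A).trAct θ) ((S.sqAt A).trCoact θ) 1 :=
        hω.trans (canon_one _ _).symm
      rw [← canon_one, ← canon_one, ← bcMor_toHom hS ω.pt, ← h]
      exact congrArg _ h'.symm
    obtain ⟨hk₁, hk₂⟩ := (((hS (k Λ)).isBialgebra_tr (bcTriv A.toK θ)).intertwine_iff
      (isBialgebra_base hS) (𝟙 _)).1 (by
        rw [(S.sqAt (k Λ)).T.map_id, (S.sqAt (k Λ)).L.map_id, Category.id_comp, Category.comp_id,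
          hk])
    let ψ : (S.sqAt (k Λ)).UV.obj ((𝓓.bc A.toK).obj Y) ≅ (S.sqAt (k Λ)).UV.obj D :=
      bcTriv A.toK θ ≪≫ B.iso
    have hψ : (bcTriv A.toK θ).hom ≫ 𝟙 _ = ψ.hom ≫ B.iso.symm.hom := by
      simp [ψ]
    obtain ⟨x, hx⟩ := exists_iso_of_bialgebra_iso ψ
      ((map_trAct_iff (bcTriv A.toK θ) B.iso.symm hψ).1 hk₁)
      ((comp_trCoact_iff (bcTriv A.toK θ) B.iso.symm hψ).1 hk₂)
    let X : FibreObj 𝓓 D A := ⟨Y, x⟩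
    have hX : (bcTriv A.toK θ).hom = (S.sqAt (k Λ)).UV.map X.iso.hom ≫ B.iso.inv :=
      (Category.comp_id _).symm.trans (hψ.trans (congrArg (· ≫ B.iso.inv) hx.symm))
    have e : (B.triv h𝓑 X).hom ≫ (B.triv h𝓑 X).inv ≫ θ.hom =
        (S.sqAt A).UV.map (𝟙 Y) ≫ θ.hom :=
      (Iso.hom_inv_id_assoc _ _).trans
        ((congrArg (· ≫ _) ((S.sqAt A).UV.map_id _)).trans (Category.id_comp _)).symm
    let g : (B.toDef hS h𝓑 A).obj X ⟶ ω := defHomMk ((B.triv h𝓑 X).inv ≫ θ.hom)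
      ((bcMor_eq_id_iff X X _ _ (B.bcTriv_triv h𝓑 X) hX (𝟙 Y) _ e).2
        (congrArg _ (FibreHom.comm (𝟙 X))))
      (by
        rw [hω]
        exact (map_trAct_trCoact _ θ (𝟙 Y) e).trans
          (congrArg (· ≫ _) (defMor_mcElt hS h𝓑 X _ (B.bcTriv_triv h𝓑 X)).symm))
    have := isGroupoid_defObj (B := B) (hS := hS) (h𝓑 := h𝓑) (A := A)
    have : IsIso g := IsGroupoid.all_isIso _
    exact ⟨X, ⟨asIso g⟩⟩

theorem isEquivalence_toDef (A : ArtAlg Λ) : (B.toDef hS h𝓑 A).IsEquivalence where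
  faithful := B.faithful_toDef hS h𝓑 hm hc A
  full := B.full_toDef hS h𝓑 hm hc A
  essSurj := B.essSurj_toDef hS h𝓑 hm hc A

include B hS h𝓑 in
theorem isGroupoid_fibreObj (A : ArtAlg Λ) : IsGroupoid (FibreObj 𝓓 D A) where
  all_isIso φ := by
    have := B.faithful_toDef hS h𝓑 hm hc A
    have := B.full_toDef hS h𝓑 hm hc A
    have := isGroupoid_defObj (B := B) (hS := hS) (h𝓑 := h𝓑) (A := A)
    have : IsIso ((B.toDef hS h𝓑 A).map φ) := IsGroupoid.all_isIso _
    exact isIso_of_fully_faithful (B.toDef hS h𝓑 A) φ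

end Lift

end SquareDiagram

end

end

end SimplicialDeformation

open SimplicialDeformation
theorem mainTheorem1 {Λ : Type u} [CommRing Λ] [IsLocalRing Λ] [IsNoetherianRing Λ]
    [IsAdicComplete (IsLocalRing.maximalIdeal Λ) Λ]
    {𝓓 𝓔 𝓐 𝓑 : CatFunctor.{u, v, w} Λ} (S : SquareDiagram 𝓓 𝓔 𝓐 𝓑)
    (hcompat : S.IsCompatible) (hmonadic : S.IsMonadic) (hcomonadic : S.IsComonadic)
    (huniform : UniformlyTrivial 𝓑) (D : 𝓓.at (ArtAlg.k Λ)) :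
    Nonempty (S.Lift D) ∧
    (∀ B B' : S.Lift D, Nonempty (B.IsoTo B')) ∧
    ∀ B : S.Lift D, ∃ E : SDC B.gradedHom, B.IsStandard E ∧
      (∀ A : ArtAlg Λ, IsGroupoid ((DefFibre 𝓓 D).at A)) ∧
      (∀ A : ArtAlg Λ, IsGroupoid (E.Def.at A)) ∧
      Equivalent (DefFibre 𝓓 D) E.Def :=
  ⟨S.nonempty_lift huniform D, fun B B' => B.nonempty_isoTo huniform B', fun B =>
    ⟨B.sdc hcompat huniform, B.isStandard_sdc hcompat huniform,
      fun A => B.isGroupoid_fibreObj hcompat huniform hmonadic hcomonadic A,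
      fun A => SquareDiagram.Lift.isGroupoid_defObj (B := B) (hS := hcompat) (h𝓑 := huniform)
        (A := A),
      B.toDefTrans hcompat huniform,
      fun A => B.isEquivalence_toDef hcompat huniform hmonadic hcomonadic A⟩⟩
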